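/- **Graphs.** A *Kontsevich graph* on $m$ sinks has sinks $0,\dots,m-1$ and $n\ge 0$ internal vertices $m,\dots,m+n-1$, each the source of two edges, ordered Left $\prec$ Right; it is encoded by the list of targets of the edges of the consecutive internal vertices. Graph sums are finite real linear combinations of such graphs, a graph with $n$ internal vertices standing at $\hbar^n$; they are considered modulo *skew-symmetry*: relabelling internal vertices does not change a graph, and swapping Left and Right at one internal vertex reverses its sign. For a bi-vector field $\mathcal P$ on an affine manifold $N^d$ (with an atlas whose coordinate changes are locally affine), a graph encodes an $m$-differential operator: in affine coordinates, put the $m$ arguments in the sinks, put $\mathcal P^{ij}$ in every internal vertex whose Left and Right edges carry the indices $i,j$, let each edge with index $i$ act as $\partial_i$ on the content of its target, multiply, and sum over all indices. The action of a graph on a graph placed in one of its sinks is expanded by the Leibniz rule, so the operations with operators are also defined for graph sums. **Leibniz graphs.** A *Leibniz graph* is a graph whose vertices are sinks, vertices with two outgoing edges, and at least one *Jacobiator* vertex with three outgoing edges, which land on three distinct vertices different from that Jacobiator. It expands to a sum of Kontsevich graphs: a Jacobiator with targets $1,2,3$ is the sum, over the cyclic permutations $(i,j,k)$ of $(1,2,3)$,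 of two internal vertices $v,w$ with $v$ pointing to $i,j$ and $w$ pointing to $v,k$, and every edge falling on a Jacobiator acts on these two vertices by the Leibniz rule. A linear combination $\Diamond$ of Leibniz graphs is an operator $\Diamond(\mathcal P,\mathrm{Jac}(\mathcal P),\dots,\mathrm{Jac}(\mathcal P))$, where $$\mathrm{Jac}(\mathcal P)^{ijk}=\sum_\ell\bigl(\partial_\ell \mathcal P^{ij}\,\mathcal P^{\ell k}+\partial_\ell \mathcal P^{jk}\,\mathcal P^{\ell i}+\partial_\ell \mathcal P^{ki}\,\mathcal P^{\ell j}\bigr)$$ is put in the Jacobiator vertices. Its differential order in the Jacobiator is the largest number of edges that fall on a Jacobiator vertex in a Leibniz graph of $\Diamond$. **The star-product.** Let $\star=\star_p \bmod \bar o(\hbar^4)$ be the following graph sum on two sinks, which depends on ten real parameters $p_1,\dots,p_{10}$. At $\hbar^0,\hbar^1,\hbar^2$ it is $$f\star g = fg+\hbar\{f,g\}_{\mathcal P}+\hbar^2\bigl(\tfrac12\,[01\,01]+\tfrac13\,[01\,02]-\tfrac13\,[01\,12]-\tfrac16\,[03\,12]\bigr)+\cdots,$$ where $\{f,g\}_{\mathcal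 P}=\sum_{i,j}\mathcal P^{ij}\,\partial_if\,\partial_jg$. At $\hbar^3$ it is $$\begin{aligned}&\tfrac16[01\,01\,01]+\tfrac13[01\,01\,02]-\tfrac13[01\,01\,12]-\tfrac16[01\,04\,13]+\tfrac16[01\,02\,02]+\tfrac16[01\,12\,12]-\tfrac16[01\,02\,23]\\&-\tfrac16[01\,12\,23]-\tfrac16[01\,04\,12]-\tfrac16[01\,02\,13]+\tfrac16[03\,12\,12]-\tfrac16[03\,12\,03]-\tfrac16[03\,12\,23].\end{aligned}$$ At $\hbar^4$ there are 19 composite graphs with constant rational coefficients and 280 prime graphs with coefficients $\pm c\,w_k$, where $c$ is a rational number and $w_1,\dots,w_{149}$ are the Kontsevich weights of 149 basic graphs, written as explicit affine functions of $p_1,\dots,p_{10}$ with rational coefficients. The parameters $p_1,\dots,p_{10}$ are the weights of the graphs $$\begin{gathered}[03\,04\,25\,13],\ [03\,04\,25\,14],\ [03\,04\,35\,12],\ [03\,04\,35\,13],\ [03\,04\,35\,14],\\ [03\,12\,03\,14],\ [03\,12\,03\,23],\ [03\,12\,03\,24],\ [03\,14\,05\,23],\ [03\,14\,23\,23].\end{gathered}$$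 All graphs and coefficients are listed in the definition of the star-product in the formal text below (`starConst`, `starPrime`, `weightTable`). **Theorem.** The associator $\mathrm{Assoc}_\star(f,g,h)=(f\star g)\star h-f\star(g\star h)\bmod\bar o(\hbar^4)$, as a graph sum on three sinks, is affine in the parameters; write $$\mathrm{Assoc}_\star(f,g,h)\bmod\bar o(\hbar^4)=:S^{(0)}+p_1S^{(1)}+\dots+p_{10}S^{(10)}.$$ 1. For every $0\le i\le 10$ there is a linear combination $\Diamond^{(i)}$ of Leibniz graphs, each of them with exactly one Jacobiator vertex and with at most two edges falling on it, such that the expansion of $\Diamond^{(i)}$ equals $S^{(i)}$ modulo skew-symmetry. Moreover, $$S^{(i)}(f,g,h)=\Diamond^{(i)}\bigl(\mathcal P,\mathrm{Jac}(\mathcal P)\bigr)(f,g,h)$$ for all smooth functions $f,g,h$ and all smooth bi-vector fields $\mathcal P$ (Poisson or not) on all finite-dimensional affine manifolds. 2. Hence, for all values of $p_1,\dots,p_{10}$ and for every Poisson structure $\mathcal P$ on every finite-dimensional affine manifold $N$, the product $\star$ on $C^\infty(N)[[\hbar]]$ is associative modulo $\bar o(\hbar^4)$. 3. At no values of $p_1,\dots,p_{10}$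 can the associator modulo $\bar o(\hbar^4)$ be factorized by an operator of differential order at most one in the Jacobiator. That is, there is no linear combination $\Diamond$ of Leibniz graphs (with any numbers of Jacobiator vertices), with at most one edge falling on each Jacobiator vertex, whose expansion equals the associator modulo skew-symmetry; nor is there such a $\Diamond$ that equals the associator as a tri-differential operator for all smooth bi-vector fields $\mathcal P$ on all $\mathbb R^d$. -/

import Mathlib

open scoped ContDiff Manifold

noncomputable section

/-! ## Kontsevich graphs and graph sums -/

/-- A Kontsevich graph on `m` sinks: it has `n` internal vertices, each of them the source of two
ordered edges (`0` is Left, `1` is Right); `tgt v j` is the target of the `j`-th edge of `v`,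
either a sink (`Sum.inl`) or an internal vertex (`Sum.inr`). -/
structure KGraph (m : ℕ) where
  n : ℕ
  tgt : Fin n → Fin 2 → Fin m ⊕ Fin n

/-- Finite formal sums of Kontsevich graphs on `m` sinks. The power of `ℏ` in front of a graph is
its number of internal vertices, so that these are also polynomials in `ℏ`. -/
abbrev GraphSum (m : ℕ) := KGraph m →₀ ℝ

/-- Relabelling of the internal vertices. -/
def KGraph.relabel {m : ℕ} (Γ : KGraph m) (σ : Equiv.Perm (Fin Γ.n)) : KGraph m :=
  ⟨Γ.n, fun v j => Sum.map id σ (Γ.tgt (σ.symm v) j)⟩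

/-- The swap of Left and Right at the internal vertex `v`. -/
def KGraph.swap {m : ℕ} (Γ : KGraph m) (v : Fin Γ.n) : KGraph m :=
  ⟨Γ.n, fun u j => if u = v then Γ.tgt u j.rev else Γ.tgt u j⟩

/-- The relations between graph sums: graphs that differ by a relabelling of internal vertices are
equal, and a swap of Left and Right at one vertex reverses the sign. Two graph sums are equal
modulo skew-symmetry when their difference lies in this subspace. -/
def skewRel (m : ℕ) : Submodule ℝ (GraphSum m) :=
  Submodule.span ℝ
    ({A | ∃ (Γ : KGraph m) (σ : Equiv.Perm (Fin Γ.n)),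
        A = Finsupp.single (Γ.relabel σ) 1 - Finsupp.single Γ 1} ∪
     {A | ∃ (Γ : KGraph m) (v : Fin Γ.n),
        A = Finsupp.single (Γ.swap v) 1 + Finsupp.single Γ 1})

/-! ## Insertion of graphs into graphs -/

/-- The place, among three sinks, of the `i`-th sink of a graph that is inserted in slot `s`. -/
def innerSink (s i : Fin 2) : Fin 3 := ⟨s.val + i.val, by omega⟩

/-- The place, among three sinks, of the sink `t` of the outer graph which is not filled. -/
def outerSink (t : Fin 2) : Fin 3 := ⟨2 * t.val, by omega⟩

/-- The vertices of the inserted graph `Δ` as vertices of the composite graph. -/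
def innerVertex (s : Fin 2) (Δ : KGraph 2) (a : ℕ) : Fin 2 ⊕ Fin Δ.n → Fin 3 ⊕ Fin (Δ.n + a) :=
  Sum.map (innerSink s) (Fin.castAdd a)

/-- Where an edge of the outer graph `Γ` may land after `Δ` is inserted in the sink `s` of `Γ`:
an edge to the sink `s` acts on `Δ` by the Leibniz rule, hence lands on any vertex of `Δ`. -/
def insertTargets (s : Fin 2) (Γ Δ : KGraph 2) :
    Fin 2 ⊕ Fin Γ.n → Finset (Fin 3 ⊕ Fin (Δ.n + Γ.n))
  | .inl t => if t = s then Finset.univ.image (innerVertex s Δ Γ.n) else {.inl (outerSink t)}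
  | .inr v => {.inr (Fin.natAdd Δ.n v)}

/-- The action of `Γ` on `Δ` placed in its sink `s`, expanded by the Leibniz rules. -/
def KGraph.insert (s : Fin 2) (Γ Δ : KGraph 2) : GraphSum 3 :=
  ∑ τ ∈ Fintype.piFinset (fun v => Fintype.piFinset fun j => insertTargets s Γ Δ (Γ.tgt v j)),
    Finsupp.single
      ⟨Δ.n + Γ.n, Fin.append (fun u j => innerVertex s Δ Γ.n (Δ.tgt u j)) τ⟩ 1

/-! ## The ten-parameter star-product modulo `o(ℏ⁴)` -/

/-- The graph on two sinks with a given list of targets: the vertices `0`, `1` are the sinks, the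
vertices `2`, `3`, … are internal, and the targets of the two edges of every internal vertex are
listed consecutively. -/
def KGraph.ofTargets (l : List ℕ) : KGraph 2 where
  n := l.length / 2
  tgt v j :=
    let t := l.getD (2 * v.val + j.val) 0
    if h : t < 2 then .inl ⟨t, h⟩
    else .inr ⟨(t - 2) % (l.length / 2), Nat.mod_lt _ v.pos⟩

/-- The graphs of the star-product with at most three internal vertices, and the composite graphs
with four internal vertices, with their coefficients. -/
def starConst : List (List ℕ × ℚ) :=
  [([], 1), ([0,1], 1), ([0,1,0,1], 1/2), ([0,1,0,2], 1/3), ([0,1,1,2], -1/3), ([0,3,1,2], -1/6),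
   ([0,1,0,1,0,1], 1/6), ([0,1,0,1,0,2], 1/3), ([0,1,0,1,1,2], -1/3), ([0,1,0,4,1,3], -1/6),
   ([0,1,0,2,0,2], 1/6), ([0,1,1,2,1,2], 1/6), ([0,1,0,2,2,3], -1/6), ([0,1,1,2,2,3], -1/6),
   ([0,1,0,4,1,2], -1/6), ([0,1,0,2,1,3], -1/6), ([0,3,1,2,1,2], 1/6), ([0,3,1,2,0,3], -1/6),
   ([0,3,1,2,2,3], -1/6), ([0,1,0,1,0,1,0,1], 1/24), ([0,1,0,1,0,1,0,2], 1/6),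
   ([0,1,0,1,0,1,1,2], -1/6), ([0,1,0,1,0,5,1,4], -1/12), ([0,1,0,1,0,2,0,2], 1/6),
   ([0,1,0,1,1,2,1,2], 1/6), ([0,1,0,1,0,2,2,4], -1/6), ([0,1,0,1,1,2,2,4], -1/6),
   ([0,1,0,1,0,5,1,2], -1/6), ([0,1,0,1,0,2,1,4], -1/6), ([0,1,0,4,1,3,1,3], 1/6),
   ([0,1,0,4,1,3,0,4], -1/6), ([0,1,0,4,1,3,3,4], -1/6), ([0,1,0,1,0,2,0,3], 1/18),
   ([0,1,0,1,0,2,1,3], -1/9), ([0,1,0,2,0,5,1,4], -1/18), ([0,1,0,1,1,2,1,3], 1/18),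
   ([0,1,0,4,1,3,1,2], 1/18), ([0,3,1,2,0,5,1,4], 1/72)]

set_option maxHeartbeats 4000000 in
/-- The weights `w₁, …, w₁₄₉` of the basic graphs with four internal vertices, as affine functions
of the master-parameters: `(0, c)` is the constant `c` and `(i, c)` is the term `c * pᵢ`. -/
def weightTable : List (List (Fin 11 × ℚ)) :=
  [
  -- entries 1 to 10
  [(0, -1/144)], [(0, -1/288)], [(0, 17/360), (7, 6)], [(0, 49/2880), (5, -3), (6, -1), (7, 3/2)],
   [(0, -1/96), (5, 6), (6, 2)], [(0, 1/80)], [(0, 1/360)], [(0, -1/240)], [(0, -13/1440)],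
   [(0, -7/1440)],
  -- entries 11 to 20
  [(0, 1/240)], [(0, -1/720)], [(0, 1/720)], [(0, 1/480)], [(0, -1/1440)], [(0, 1/1440)],
   [(0, -1/480)], [(0, -1/360)], [(0, -1/480)], [(0, -1/240)],
  -- entries 21 to 30
  [(0, -1/480)], [(0, -1/720)], [(0, 1/1440)], [(0, 1/360)],
   [(0, 53/1440), (1, 3), (4, 12), (5, -15), (6, -1), (7, 6), (8, -6)], [(0, 1/120)],
   [(0, 1/1440)], [(0, -1/960), (7, -3/2)],
   [(0, -49/1440), (1, -3/2), (4, -9), (5, 21/2), (6, 3/2), (7, -9/2), (8, 3)],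
   [(0, 1/72), (4, 6), (5, -6), (7, 3), (8, -3)],
  -- entries 31 to 40
  [(0, 61/2880), (1, 3/2), (4, 6), (5, -15/2), (6, -1/2), (7, 3), (8, -3)], [(0, 1/1440)],
   [(0, 5/288), (4, 6), (5, -6), (7, 3), (8, -3)], [(0, 1/96), (7, 1)], [(4, -1)],
   [(0, -13/2880), (1, -1/2), (5, 3/2), (6, 1/2)], [],
   [(0, 1/1440), (1, -1/2), (4, 1), (5, 3/2), (6, 1/2), (7, 1/2)], [], [],
  -- entries 41 to 50
  [(0, 1/1440)], [(0, 1/1440)], [(0, 37/1440), (4, 6), (5, -6), (6, -1), (7, 3), (8, -3)],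
   [(0, 17/360), (4, 15), (5, -18), (6, -2), (7, 6), (8, -6)], [(0, 7/1440), (5, -3), (6, -1)],
   [(0, -1/480)], [(0, 1/60), (4, 6), (5, -6), (7, 3), (8, -3)],
   [(0, 11/1440), (1, -1/2), (4, -1), (5, 5/2), (6, 1/2), (7, 3/2)], [(5, -1)],
   [(0, -1/192), (7, -1/2)],
  -- entries 51 to 60
  [(4, -1)], [(0, -1/1440), (1, 1/2), (5, -3/2), (6, -1/2), (7, -1/2)], [(4, 1)],
   [(0, -1/576), (4, 1), (5, -1), (7, -1/2)], [(5, 1)], [], [], [], [], [],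
  -- entries 61 to 70
  [], [], [], [], [], [], [], [], [], [],
  -- entries 71 to 80
  [], [(0, 1/1440)], [(0, 1/1440)], [(0, 1/1440)], [(0, -1/480)], [(0, -1/720)],
   [(0, 1/180), (4, 3), (5, -3), (6, -1)], [(0, -1/144), (4, -3), (5, 3), (6, 1)], [(0, -1/1440)],
   [(0, 1/80), (1, 1), (5, -3), (7, 3), (8, -2), (10, -2)],
  -- entries 81 to 90
  [(0, 1/480), (1, -1/2), (4, 2), (5, 1/2), (6, 1/2), (7, 1/2), (10, 2)],
   [(0, 1/2880), (4, -1), (5, -1), (7, 1/2), (8, -1), (10, -2)], [(0, -1/480)], [(0, -1/720)],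
   [(0, 1/180), (6, -1)], [(0, 1/480)], [(0, -1/1440)],
   [(0, 1/96), (4, 4), (5, -4), (7, 2), (8, -2)],
   [(0, 1/240), (1, 3/2), (4, 3), (5, -9/2), (6, 1/2), (7, 3/2), (8, -2)],
   [(0, -1/192), (7, -1/2)],
  -- entries 91 to 100
  [(0, -1/720)], [(0, 17/1440), (4, 6), (5, -6), (6, -2)],
   [(0, 3/320), (1, -1/2), (4, 1), (5, -5/2), (6, 1/2), (7, 2), (8, -2), (9, 1)],
   [(0, 1/1440), (1, -1/2), (3, -1), (4, 1), (5, -3/2), (6, 1/2), (7, 1/2), (8, -1)],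
   [(0, -1/576), (4, 1), (5, -1), (7, -1/2)], [], [], [],
   [(0, -7/2880), (1, -1/2), (4, 1), (5, 1/2), (6, -1/2), (7, -1), (8, 1), (9, -1)], [(1, 1)],
  -- entries 101 to 110
  [(2, 1)], [(3, 1)], [(4, 1)], [(5, 1)], [(0, -1/160)], [(0, 13/1440)], [(6, 1)], [(7, 1)],
   [(8, 1)], [(0, -1/288), (4, -2), (5, 2), (7, -1), (8, 1)],
  -- entries 111 to 120
  [(0, -17/2880), (1, -1/2), (4, -2), (5, 5/2), (6, -1/2), (7, -1), (8, 1)],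
   [(0, -7/576), (4, -4), (5, 4), (7, -2), (8, 2)],
   [(0, -1/192), (4, -2), (5, 2), (7, -1), (8, 1)], [(0, 1/360), (7, 1)],
   [(0, 23/5760), (1, -1/2), (4, 1), (7, 3/4)], [], [(0, -19/2880), (1, 1), (4, -2), (7, -1)],
   [(0, -31/1440), (4, -12), (5, 12), (6, 4)], [(9, 1)],
   [(0, -1/96), (1, -1), (3, -1), (4, 2), (7, -2), (8, 1)],
  -- entries 121 to 130
  [(0, -1/288), (4, 2), (5, -2), (7, -1)], [(4, -2)],
   [(0, -7/2880), (1, 1/2), (4, -1), (5, 1/2), (6, -1/2), (7, -1), (8, 1)],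
   [(0, 1/144), (1, 1), (4, 1), (5, -2), (7, 1), (8, -1)], [(10, 1)],
   [(0, 29/5760), (1, 1/2), (4, -1), (7, 5/4), (8, -1), (10, -1)],
   [(0, -1/640), (4, 1), (5, 1/2), (7, -3/4), (8, 1/2), (10, 1)],
   [(0, -1/144), (2, 1), (4, -2), (5, 3), (7, -1), (8, 1)],
   [(0, 1/144), (2, 1), (4, 2), (5, -3), (7, 1), (8, -1)],
   [(0, 7/1920), (1, -1/2), (4, 1), (6, 1/2), (7, 3/4), (8, -1/2), (9, 1), (10, 1)],
  -- entries 131 to 140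
   [(0, 23/5760), (1, -1/4), (2, 1/2), (3, -1/2), (4, 1/2), (5, -5/4), (6, 1/4), (7, 1), (8, -1), (9, 1/2), (10, -1)],
   [(0, -1/240), (2, 1/2), (4, 1/2), (7, -1), (8, 1/2), (10, 1)], [(5, 2)], [],
   [(0, -1/360), (1, -1/4), (3, -1/2), (5, 1/4), (6, 1/4), (7, -1/4), (9, 1/2)],
   [(0, -7/1440), (1, -1/2), (3, -1), (4, 1), (5, -1/2), (7, -1), (8, 1/2)], [],
   [(0, -1/144), (4, -2), (5, 2), (7, -1), (8, 1)],
   [(0, 1/1920), (4, 1), (5, -3/2), (7, 1/4), (8, -1/2)],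
   [(0, -1/1440), (1, 1), (4, 2), (5, -5), (8, -1)],
  -- entries 141 to 149
   [(1, -1/4), (2, -1/2), (3, -1/2), (4, -1/2), (5, 1/4), (6, 1/4), (7, 1/4), (8, -1/2), (9, 1/2)],
   [(0, 1/5760), (3, -1), (4, 2), (5, -3), (8, -1)],
   [(0, 7/1440), (2, 1/2), (4, 5/2), (5, -5/2), (7, 3/4), (8, -1)], [], [],
   [(0, 13/5760), (1, 1/2), (2, -1/2), (4, 3/2), (5, -2), (7, 1/4), (8, -1/2)],
   [(0, 1/320), (2, -1/2), (4, 3/2), (5, -1), (7, 1/2), (8, -1/2)],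
   [(0, 11/1920), (4, 2), (5, -1), (7, 1), (8, -1)],
   [(0, -11/2880), (1, 1/2), (5, 1/2), (6, -1/2), (7, -1), (8, 1), (9, -1)]]

/-- The prime graphs of the star-product with four internal vertices; the entry `(l, c, k)` is the
graph with targets `l` and coefficient `c * wₖ`. -/
def starPrime : List (List ℕ × ℚ × ℕ) :=
  [([0,1,0,1,0,2,2,3], 16, 1), ([0,1,0,1,1,2,2,3], 16, 1), ([0,1,0,1,0,2,3,4], 16, 2),
   ([0,1,0,1,1,2,3,4], 16, 2), ([0,1,0,1,2,3,2,3], 4, 3), ([0,1,0,1,2,3,2,4], 16, 4),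
   ([0,1,0,1,2,5,3,4], 8, 5), ([0,1,0,2,0,2,0,2], 8/3, 6), ([0,1,1,2,1,2,1,2], -8/3, 6),
   ([0,1,0,2,0,2,0,3], 16, 7), ([0,1,1,2,1,2,1,3], -16, 7), ([0,1,0,2,0,2,1,2], 8, 8),
   ([0,1,0,2,1,2,1,2], -8, 8), ([0,1,0,2,0,2,1,3], 16, 9), ([0,1,0,4,1,2,1,2], -16, 9),
   ([0,1,0,2,0,2,2,3], 16, 10), ([0,1,1,2,1,2,2,3], -16, 10), ([0,1,0,2,0,3,0,3], 8, 11),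
   ([0,1,1,2,1,3,1,3], -8, 11), ([0,1,0,2,0,3,0,4], 16, 12), ([0,1,1,2,1,3,1,4], -16, 12),
   ([0,1,0,2,0,3,1,2], 16, 13), ([0,1,0,2,1,2,1,4], -16, 13), ([0,1,0,2,0,3,1,3], 16, 14),
   ([0,1,0,4,1,2,1,4], -16, 14), ([0,1,0,2,0,3,1,4], 16, 15), ([0,1,0,4,1,5,1,2], -16, 15),
   ([0,1,0,2,0,3,2,3], 16, 16), ([0,1,1,2,1,3,2,3], -16, 16), ([0,1,0,2,0,3,2,4], 16, 17),
   ([0,1,1,2,1,3,2,4], -16, 17), ([0,1,0,2,0,3,3,4], 16, 18), ([0,1,1,2,1,3,3,4], -16, 18),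
   ([0,1,0,2,0,5,1,2], 16, 19), ([0,1,0,2,1,2,1,3], -16, 19), ([0,1,0,2,0,5,1,3], 16, 20),
   ([0,1,0,4,1,2,1,3], -16, 20), ([0,1,0,2,0,5,2,3], 16, 21), ([0,1,1,2,1,5,2,3], -16, 21),
   ([0,1,0,2,0,5,2,4], 16, 22), ([0,1,1,2,1,5,2,4], -16, 22), ([0,1,0,2,0,5,3,4], 16, 23),
   ([0,1,1,2,1,5,3,4], -16, 23), ([0,1,0,2,1,2,2,3], 16, 24), ([0,1,0,2,1,2,2,4], -16, 24),
   ([0,1,0,2,1,2,3,4], 16, 25), ([0,1,0,2,1,3,1,3], 8, 26), ([0,1,0,4,1,2,0,4], -8, 26),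
   ([0,1,0,2,1,3,1,4], 16, 27), ([0,1,0,4,0,5,1,2], -16, 27), ([0,1,0,2,1,3,2,3], 16, 28),
   ([0,1,0,4,1,2,2,4], -16, 28), ([0,1,0,2,1,3,2,4], 16, 29), ([0,1,0,4,1,2,2,3], -16, 29),
   ([0,1,0,2,1,3,3,4], 16, 30), ([0,1,0,4,1,2,3,4], 16, 30), ([0,1,0,2,1,5,2,3], 16, 31),
   ([0,1,0,4,2,5,1,2], -16, 31), ([0,1,0,2,1,5,2,4], 16, 32), ([0,1,0,4,2,3,1,2], -16, 32),
   ([0,1,0,2,1,5,3,4], 16, 33), ([0,1,0,4,3,5,1,2], 16, 33), ([0,1,0,2,2,3,2,3], 8, 34),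
   ([0,1,1,2,2,3,2,3], -8, 34), ([0,1,0,2,2,3,2,4], 16, 35), ([0,1,1,2,2,3,2,4], -16, 35),
   ([0,1,0,2,2,3,3,4], 16, 36), ([0,1,1,2,2,3,3,4], -16, 36), ([0,1,0,2,2,5,2,4], 8, 37),
   ([0,1,1,2,2,5,2,4], -8, 37), ([0,1,0,2,2,5,3,4], 16, 38), ([0,1,1,2,2,5,3,4], -16, 38),
   ([0,1,0,2,3,5,3,4], 8, 39), ([0,1,1,2,3,5,3,4], -8, 39), ([0,1,0,4,0,3,2,3], 16, 40),
   ([0,1,1,4,1,3,2,3], -16, 40), ([0,1,0,4,0,5,2,3], 16, 41), ([0,1,1,4,1,5,2,3], -16, 41),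
   ([0,1,0,4,0,5,2,4], 16, 42), ([0,1,1,4,1,5,2,4], -16, 42), ([0,1,0,4,1,3,2,3], 16, 43),
   ([0,1,0,4,1,3,2,4], -16, 43), ([0,1,0,4,1,5,2,3], 16, 44), ([0,1,0,4,2,5,1,3], -16, 44),
   ([0,1,0,4,1,5,2,4], 16, 45), ([0,1,0,4,2,3,1,3], -16, 45), ([0,1,0,4,2,3,0,4], 16, 46),
   ([0,1,1,4,2,3,1,4], -16, 46), ([0,1,0,4,2,3,1,4], 16, 47), ([0,1,0,4,2,5,1,4], -16, 47),
   ([0,1,0,4,2,3,2,3], 16, 48), ([0,1,1,4,2,3,2,3], -16, 48), ([0,1,0,4,2,3,2,4], 16, 49),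
   ([0,1,1,4,2,3,2,4], -16, 49), ([0,1,0,4,2,3,3,4], 16, 50), ([0,1,1,4,2,3,3,4], -16, 50),
   ([0,1,0,4,2,5,2,3], 16, 51), ([0,1,1,4,2,5,2,3], -16, 51), ([0,1,0,4,2,5,2,4], 16, 52),
   ([0,1,1,4,2,5,2,4], -16, 52), ([0,1,0,4,2,5,3,4], 16, 53), ([0,1,1,4,2,5,3,4], -16, 53),
   ([0,1,0,4,3,5,2,3], 16, 54), ([0,1,1,4,3,5,2,3], -16, 54), ([0,1,0,4,3,5,2,4], 16, 55),
   ([0,1,1,4,3,5,2,4], -16, 55), ([0,1,2,4,2,3,2,3], 16, 56), ([0,1,2,4,2,5,2,3], 16/3, 57),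
   ([0,1,2,4,2,5,3,4], 16, 58), ([0,1,2,4,3,5,3,4], 16, 59), ([0,3,0,2,0,2,1,2], 16, 60),
   ([0,3,1,4,1,3,1,3], 16, 60), ([0,3,0,2,0,2,1,3], 16, 61), ([0,3,1,4,1,3,1,4], 16, 61),
   ([0,3,0,2,0,2,1,4], 16, 62), ([0,3,1,4,1,5,1,4], 16, 62), ([0,3,0,2,0,5,1,2], 16, 63),
   ([0,3,1,4,1,3,1,2], 16, 63), ([0,3,0,2,1,2,1,2], 8, 64), ([0,3,1,4,1,3,0,3], 8, 64),
   ([0,3,0,2,1,2,1,3], 8, 65), ([0,3,1,4,1,3,0,4], 8, 65), ([0,3,0,2,1,2,1,4], 16, 66),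
   ([0,3,0,4,1,5,1,4], 16, 66), ([0,3,0,2,1,2,2,3], 16, 67), ([0,3,1,4,1,3,3,4], 16, 67),
   ([0,3,0,2,1,2,2,4], 16, 68), ([0,3,1,4,1,3,2,3], -16, 68), ([0,3,0,2,1,2,3,4], 16, 69),
   ([0,3,1,4,1,3,2,4], -16, 69), ([0,3,0,2,1,5,2,4], 16, 70), ([0,3,2,4,1,5,1,4], -16, 70),
   ([0,3,0,4,0,2,1,2], 16, 71), ([0,3,1,4,1,5,1,3], 16, 71), ([0,3,0,4,0,5,1,2], 16, 72),
   ([0,3,1,4,1,5,1,2], 16, 72), ([0,3,0,4,0,5,1,3], 16, 73), ([0,3,1,4,1,2,1,3], 16, 73),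
   ([0,3,0,4,0,5,1,4], 16, 74), ([0,3,1,2,1,3,1,4], 16, 74), ([0,3,0,4,1,2,0,3], 16, 75),
   ([0,3,1,4,1,2,1,4], 16, 75), ([0,3,0,4,1,2,0,4], 16, 76), ([0,3,1,4,1,2,1,2], 16, 76),
   ([0,3,0,4,1,2,1,2], 16, 77), ([0,3,1,4,1,2,0,3], 16, 77), ([0,3,0,4,1,2,1,3], 16, 78),
   ([0,3,1,4,0,5,1,3], 16, 78), ([0,3,0,4,1,2,1,4], 16, 79), ([0,3,0,4,1,5,1,3], 16, 79),
   ([0,3,0,4,1,2,2,3], 16, 80), ([0,3,1,4,1,2,3,4], 16, 80), ([0,3,0,4,1,2,2,4], 16, 81),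
   ([0,3,1,4,1,2,2,3], -16, 81), ([0,3,0,4,1,2,3,4], 16, 82), ([0,3,1,4,1,2,2,4], -16, 82),
   ([0,3,0,4,1,3,0,3], 8, 83), ([0,3,1,2,1,3,1,3], 8, 83), ([0,3,0,4,1,3,0,4], 16, 84),
   ([0,3,1,2,1,2,1,3], 16, 84), ([0,3,0,4,1,3,1,2], 16, 85), ([0,3,1,2,0,5,1,3], 16, 85),
   ([0,3,0,4,1,3,1,3], 16, 86), ([0,3,1,2,0,3,1,3], 16, 86), ([0,3,0,4,1,3,1,4], 16, 87),
   ([0,3,0,4,1,3,2,3], 16, 88), ([0,3,1,2,1,3,3,4], -16, 88), ([0,3,0,4,1,3,2,4], 16, 89),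
   ([0,3,1,2,1,3,2,4], -16, 89), ([0,3,0,4,1,3,3,4], 16, 90), ([0,3,1,2,1,3,2,3], -16, 90),
   ([0,3,0,4,1,5,0,4], 16, 91), ([0,3,1,2,1,2,1,4], 16, 91), ([0,3,0,4,1,5,1,2], 16, 92),
   ([0,3,0,4,1,5,2,3], 16, 93), ([0,3,4,5,1,2,1,4], -16, 93), ([0,3,0,4,1,5,2,4], 16, 94),
   ([0,3,2,4,1,5,1,2], -16, 94), ([0,3,0,4,1,5,3,4], 16, 95), ([0,3,2,4,1,2,1,4], -16, 95),
   ([0,3,0,4,2,3,1,2], 16, 96), ([0,3,1,4,1,5,3,4], 16, 96), ([0,3,0,4,2,3,1,3], 16, 97),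
   ([0,3,1,4,3,5,1,3], -16, 97), ([0,3,0,4,2,3,1,4], 16, 98), ([0,3,4,5,1,3,1,4], -16, 98),
   ([0,3,0,4,2,5,1,2], 16, 99), ([0,3,1,4,1,5,2,3], -16, 99), ([0,3,0,4,2,5,1,3], 16, 100),
   ([0,3,1,4,2,5,1,3], -16, 100), ([0,3,0,4,2,5,1,4], 16, 101), ([0,3,2,4,1,5,1,3], -16, 101),
   ([0,3,0,4,3,5,1,2], 16, 102), ([0,3,1,4,1,5,2,4], -16, 102), ([0,3,0,4,3,5,1,3], 16, 103),
   ([0,3,1,4,2,3,1,3], -16, 103), ([0,3,0,4,3,5,1,4], 16, 104), ([0,3,2,4,1,3,1,4], -16, 104),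
   ([0,3,1,2,0,3,0,3], 8, 105), ([0,3,1,2,1,2,1,2], 8, 105), ([0,3,1,2,0,3,1,2], 16, 106),
   ([0,3,1,2,0,3,1,4], 16, 107), ([0,3,1,2,0,5,1,2], 16, 107), ([0,3,1,2,0,3,2,3], 16, 108),
   ([0,3,1,2,1,2,2,3], -16, 108), ([0,3,1,2,0,3,2,4], 16, 109), ([0,3,1,2,1,2,3,4], 16, 109),
   ([0,3,1,2,0,3,3,4], 16, 110), ([0,3,1,2,1,2,2,4], 16, 110), ([0,3,1,2,0,5,2,3], 16, 111),
   ([0,3,1,2,1,5,2,3], -16, 111), ([0,3,1,2,0,5,2,4], 16, 112), ([0,3,1,2,1,5,3,4], 16, 112),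
   ([0,3,1,2,0,5,3,4], 16, 113), ([0,3,1,2,1,5,2,4], 16, 113), ([0,3,1,2,2,3,2,3], 8, 114),
   ([0,3,1,2,2,3,2,4], 16, 115), ([0,3,1,2,2,3,3,4], -16, 115), ([0,3,1,2,2,5,2,4], 8, 116),
   ([0,3,1,2,3,5,3,4], 8, 116), ([0,3,1,2,2,5,3,4], 16, 117), ([0,3,1,4,0,5,1,2], 8, 118),
   ([0,3,1,4,0,5,2,3], 16, 119), ([0,3,1,4,2,5,1,2], -16, 119), ([0,3,1,4,0,5,2,4], 16, 120),
   ([0,3,1,4,3,5,1,2], -16, 120), ([0,3,1,4,0,5,3,4], 16, 121), ([0,3,1,4,2,3,1,2], 16, 121),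
   ([0,3,1,4,2,3,0,3], 16, 122), ([0,3,2,4,1,2,1,2], -16, 122), ([0,3,1,4,2,3,0,4], 16, 123),
   ([0,3,2,4,1,2,1,3], -16, 123), ([0,3,1,4,2,3,1,4], 16, 124), ([0,3,2,4,1,2,0,3], -16, 124),
   ([0,3,1,4,2,3,2,3], 16, 125), ([0,3,2,4,1,2,2,4], 16, 125), ([0,3,1,4,2,3,2,4], 16, 126),
   ([0,3,2,4,1,2,3,4], 16, 126), ([0,3,1,4,2,3,3,4], 16, 127), ([0,3,2,4,1,2,2,3], -16, 127),
   ([0,3,1,4,2,5,0,4], 16, 128), ([0,3,4,5,1,2,1,3], 16, 128), ([0,3,1,4,2,5,1,4], 16, 129),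
   ([0,3,2,4,1,5,0,3], -16, 129), ([0,3,1,4,2,5,2,3], 16, 130), ([0,3,4,5,1,2,2,4], -16, 130),
   ([0,3,1,4,2,5,2,4], 16, 131), ([0,3,4,5,1,2,3,4], -16, 131), ([0,3,1,4,2,5,3,4], 16, 132),
   ([0,3,4,5,1,2,2,3], 16, 132), ([0,3,1,4,3,5,0,4], 16, 133), ([0,3,2,4,1,3,1,2], 16, 133),
   ([0,3,1,4,3,5,1,4], 16, 134), ([0,3,2,4,0,3,1,2], 16, 134), ([0,3,1,4,3,5,2,3], 16, 135),
   ([0,3,2,4,2,5,1,2], -16, 135), ([0,3,1,4,3,5,2,4], 16, 136), ([0,3,2,4,3,5,1,2], -16, 136),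
   ([0,3,1,4,3,5,3,4], 16, 137), ([0,3,2,4,2,3,1,2], 16, 137), ([0,3,2,4,1,3,0,3], 16, 138),
   ([0,3,2,4,1,3,1,3], -16, 138), ([0,3,2,4,1,3,2,3], 16, 139), ([0,3,2,4,1,3,3,4], 16, 139),
   ([0,3,2,4,1,3,2,4], 16, 140), ([0,3,2,4,1,5,2,3], 16, 141), ([0,3,4,5,1,5,2,4], -16, 141),
   ([0,3,2,4,1,5,2,4], 16, 142), ([0,3,2,4,1,5,3,4], 16, 143), ([0,3,2,4,2,5,1,4], 16, 143),
   ([0,3,2,4,2,3,1,3], 16, 144), ([0,3,4,5,1,3,3,4], -16, 144), ([0,3,2,4,2,3,1,4], 16, 145),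
   ([0,3,4,5,1,5,3,4], -16, 145), ([0,3,2,4,2,5,1,3], 16, 146), ([0,3,4,5,1,3,2,4], -16, 146),
   ([0,3,2,4,3,5,1,3], 16, 147), ([0,3,4,5,1,3,2,3], -16, 147), ([0,3,2,4,3,5,1,4], 16, 148),
   ([0,3,4,5,1,5,2,3], 16, 149)]

/-- The weight `wₖ` at the values `p 0, …, p 9` of the parameters `p₁, …, p₁₀`. -/
def weight (p : Fin 10 → ℝ) (k : ℕ) : ℝ :=
  ((weightTable.getD (k - 1) []).map fun e => (e.2 : ℝ) * (Fin.cons 1 p : Fin 11 → ℝ) e.1).sum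

/-- The star-product modulo `o(ℏ⁴)`, as a sum of graphs on two sinks. -/
def star4 (p : Fin 10 → ℝ) : GraphSum 2 :=
  (starConst.map fun e => Finsupp.single (KGraph.ofTargets e.1) (e.2 : ℝ)).sum +
  (starPrime.map fun e =>
    Finsupp.single (KGraph.ofTargets e.1) ((e.2.1 : ℝ) * weight p e.2.2)).sum

/-- The associator `(f ⋆ g) ⋆ h - f ⋆ (g ⋆ h)` modulo `o(ℏ⁴)`, as a sum of graphs on three
sinks. -/
def assoc4 (p : Fin 10 → ℝ) : GraphSum 3 :=
  (star4 p).sum fun Γ a => (star4 p).sum fun Δ b =>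
    if Γ.n + Δ.n ≤ 4 then (a * b) • (KGraph.insert 0 Γ Δ - KGraph.insert 1 Γ Δ) else 0

/-- The components `S⁽⁰⁾, S⁽¹⁾, …, S⁽¹⁰⁾` of the associator. -/
def assocComponent : Fin 11 → GraphSum 3 :=
  Fin.cases (assoc4 0) fun i => assoc4 (Pi.single i 1) - assoc4 0

/-! ## Leibniz graphs -/

/-- A Leibniz graph on `m` sinks: it has `b` vertices with two outgoing edges and `l ≥ 1` Jacobiator
vertices with three outgoing edges; the three edges of a Jacobiator land on three distinct
vertices, none of which is that Jacobiator. -/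
structure LeibnizGraph (m : ℕ) where
  b : ℕ
  l : ℕ
  l_pos : 0 < l
  wedge : Fin b → Fin 2 → Fin m ⊕ (Fin b ⊕ Fin l)
  jac : Fin l → Fin 3 → Fin m ⊕ (Fin b ⊕ Fin l)
  jac_injective : ∀ j, Function.Injective (jac j)
  jac_ne : ∀ j i, jac j i ≠ .inr (.inr j)

/-- The number of edges that land on the `j`-th Jacobiator, that is, the order of the
differential operator that acts on it. -/
def LeibnizGraph.jacIndegree {m : ℕ} (Λ : LeibnizGraph m) (j : Fin Λ.l) : ℕ :=
  (Finset.univ.filter fun e : Fin Λ.b × Fin 2 => Λ.wedge e.1 e.2 = .inr (.inr j)).card +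
  (Finset.univ.filter fun e : Fin Λ.l × Fin 3 => Λ.jac e.1 e.2 = .inr (.inr j)).card

/-- The `e`-th internal vertex (`e = 0, 1`) of the `j`-th Jacobiator, in the expansion. -/
def LeibnizGraph.jacVertex {m : ℕ} (Λ : LeibnizGraph m) (j : Fin Λ.l) (e : Fin 2) :
    Fin m ⊕ Fin (Λ.b + Λ.l * 2) :=
  .inr (Fin.natAdd Λ.b (finProdFinEquiv (j, e)))

/-- Where an edge lands in the expansion of a Leibniz graph: an edge to a Jacobiator acts by the
Leibniz rule on the two internal vertices in it. -/
def LeibnizGraph.targets {m : ℕ} (Λ : LeibnizGraph m) :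
    Fin m ⊕ (Fin Λ.b ⊕ Fin Λ.l) → Finset (Fin m ⊕ Fin (Λ.b + Λ.l * 2))
  | .inl s => {.inl s}
  | .inr (.inl v) => {.inr (Fin.castAdd (Λ.l * 2) v)}
  | .inr (.inr j) => Finset.univ.image (Λ.jacVertex j)

/-- The expansion of a Leibniz graph into Kontsevich graphs. A Jacobiator with targets `1, 2, 3` is
the sum over the cyclic permutations `(i, j, k)` of `(1, 2, 3)` of two internal vertices, the first
one with the targets `i, j` and the second one with the first one and `k` as its targets. -/
def LeibnizGraph.expand {m : ℕ} (Λ : LeibnizGraph m) : GraphSum m :=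
  ∑ c : Fin Λ.l → Fin 3,
    ∑ τ ∈ Fintype.piFinset (fun v => Fintype.piFinset fun i => Λ.targets (Λ.wedge v i)),
      ∑ θ ∈ Fintype.piFinset (fun j => Fintype.piFinset fun i => Λ.targets (Λ.jac j i)),
        Finsupp.single
          ⟨Λ.b + Λ.l * 2, Fin.append τ fun u =>
            let j := (finProdFinEquiv.symm u).1
            if (finProdFinEquiv.symm u).2 = 0 then ![θ j (c j), θ j (c j + 1)]
            else ![Λ.jacVertex j 0, θ j (c j + 2)]⟩ 1

/-- Finite formal sums of Leibniz graphs. -/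
abbrev LeibnizSum (m : ℕ) := LeibnizGraph m →₀ ℝ

/-- The expansion of a sum of Leibniz graphs into Kontsevich graphs. -/
def LeibnizSum.expand {m : ℕ} (D : LeibnizSum m) : GraphSum m :=
  D.sum fun Λ a => a • Λ.expand

/-! ## Polydifferential operators in one chart -/

/-- The partial derivative along the `i`-th coordinate. -/
def pderiv' {d : ℕ} (i : Fin d) (F : (Fin d → ℝ) → ℝ) (x : Fin d → ℝ) : ℝ :=
  fderiv ℝ F x (Pi.single i 1)

/-- The iterated partial derivative along the coordinates in a list. -/
def pderivs {d : ℕ} (L : List (Fin d)) (F : (Fin d → ℝ) → ℝ) : (Fin d → ℝ) → ℝ :=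
  L.foldr pderiv' F

/-- The components of `Jac(P)` for a matrix `P` of functions. -/
def jacobiator {d : ℕ} (P : Fin d → Fin d → (Fin d → ℝ) → ℝ) (i j k : Fin d)
    (x : Fin d → ℝ) : ℝ :=
  ∑ l, (pderiv' l (P i j) x * P l k x + pderiv' l (P j k) x * P l i x +
    pderiv' l (P k i) x * P l j x)

/-- The indices on the edges that land on the vertex `y`, when the edges carry the indices `I`. -/
def edgeLabels {n r d : ℕ} {V : Type} [DecidableEq V] (tgt : Fin n → Fin r → V)
    (I : Fin n → Fin r → Fin d) (y : V) : List (Fin d) :=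
  ((List.finRange n ×ˢ List.finRange r).filter fun e => tgt e.1 e.2 = y).map fun e => I e.1 e.2

/-- The polydifferential operator of a Kontsevich graph in one chart: every edge with index `i` is
`∂ᵢ` acting on its target, every internal vertex with indices `i, j` on its edges is `P i j`, the
sinks are the arguments, and one sums over all indices. -/
def KGraph.localOp {m d : ℕ} (Γ : KGraph m) (P : Fin d → Fin d → (Fin d → ℝ) → ℝ)
    (f : Fin m → (Fin d → ℝ) → ℝ) (x : Fin d → ℝ) : ℝ :=
  ∑ I : Fin Γ.n → Fin 2 → Fin d,
    (∏ v, pderivs (edgeLabels Γ.tgt I (.inr v)) (P (I v 0) (I v 1)) x) *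
    ∏ s, pderivs (edgeLabels Γ.tgt I (.inl s)) (f s) x

/-- The polydifferential operator of a Leibniz graph in one chart, at a matrix `P` and an array `J`
of functions which are placed in its two- and three-edge vertices. -/
def LeibnizGraph.localOp {m d : ℕ} (Λ : LeibnizGraph m) (P : Fin d → Fin d → (Fin d → ℝ) → ℝ)
    (J : Fin d → Fin d → Fin d → (Fin d → ℝ) → ℝ) (f : Fin m → (Fin d → ℝ) → ℝ)
    (x : Fin d → ℝ) : ℝ :=
  ∑ I : Fin Λ.b → Fin 2 → Fin d, ∑ K : Fin Λ.l → Fin 3 → Fin d,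
    (∏ v, pderivs (edgeLabels Λ.wedge I (.inr (.inl v)) ++ edgeLabels Λ.jac K (.inr (.inl v)))
      (P (I v 0) (I v 1)) x) *
    (∏ j, pderivs (edgeLabels Λ.wedge I (.inr (.inr j)) ++ edgeLabels Λ.jac K (.inr (.inr j)))
      (J (K j 0) (K j 1) (K j 2)) x) *
    ∏ s, pderivs (edgeLabels Λ.wedge I (.inl s) ++ edgeLabels Λ.jac K (.inl s)) (f s) x

/-! ## Affine manifolds, bi-vectors, and the operators on them -/

/-- The charts of the atlas form an affine atlas: the changes of coordinates are locally affine. -/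
class AffineManifold (d : ℕ) (N : Type*) [TopologicalSpace N] [ChartedSpace (Fin d → ℝ) N] :
    Prop where
  locally_affine : ∀ φ ∈ atlas (Fin d → ℝ) N, ∀ ψ ∈ atlas (Fin d → ℝ) N,
    ∀ x ∈ φ.source ∩ ψ.source, ∃ A : (Fin d → ℝ) →ᵃ[ℝ] (Fin d → ℝ),
      ∀ᶠ y in nhds (φ x), ψ (φ.symm y) = A y

/-- A function is smooth when it is smooth in all charts of the atlas. -/
def SmoothFun (d : ℕ) {N : Type*} [TopologicalSpace N] [ChartedSpace (Fin d → ℝ) N]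
    (f : N → ℝ) : Prop :=
  ∀ φ ∈ atlas (Fin d → ℝ) N, ContDiffOn ℝ ∞ (f ∘ φ.symm) φ.target

/-- A smooth bi-vector field, by its components in the charts of the atlas. -/
structure Bivector (d : ℕ) (N : Type*) [TopologicalSpace N] [ChartedSpace (Fin d → ℝ) N] where
  comp : OpenPartialHomeomorph N (Fin d → ℝ) → Fin d → Fin d → (Fin d → ℝ) → ℝ
  smooth : ∀ φ ∈ atlas (Fin d → ℝ) N, ∀ i j, ContDiffOn ℝ ∞ (comp φ i j) φ.target
  skew : ∀ φ ∈ atlas (Fin d → ℝ) N, ∀ i j, ∀ x ∈ φ.target, comp φ i j x = - comp φ j i x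
  transform : ∀ φ ∈ atlas (Fin d → ℝ) N, ∀ ψ ∈ atlas (Fin d → ℝ) N,
    ∀ x ∈ φ.source ∩ ψ.source, ∀ i j, comp ψ i j (ψ x) =
      ∑ a, ∑ b, pderiv' a (fun y => ψ (φ.symm y) i) (φ x) *
        pderiv' b (fun y => ψ (φ.symm y) j) (φ x) * comp φ a b (φ x)

section Operators

variable {d : ℕ} {N : Type*} [TopologicalSpace N] [ChartedSpace (Fin d → ℝ) N]

/-- A Poisson bi-vector: its Jacobiator vanishes. -/
def Bivector.IsPoisson (P : Bivector d N) : Prop :=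
  ∀ φ ∈ atlas (Fin d → ℝ) N, ∀ i j k, ∀ x ∈ φ.target, jacobiator (P.comp φ) i j k x = 0

/-- The polydifferential operator of a Kontsevich graph; its value at `x` is computed in the
preferred chart at `x`. -/
def KGraph.op {m : ℕ} (Γ : KGraph m) (P : Bivector d N) (f : Fin m → N → ℝ) (x : N) : ℝ :=
  Γ.localOp (P.comp (chartAt (Fin d → ℝ) x)) (fun s => f s ∘ (chartAt (Fin d → ℝ) x).symm)
    (chartAt (Fin d → ℝ) x x)

/-- The polydifferential operator of a Leibniz graph at `P` and `Jac(P)`. -/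
def LeibnizGraph.op {m : ℕ} (Λ : LeibnizGraph m) (P : Bivector d N) (f : Fin m → N → ℝ)
    (x : N) : ℝ :=
  Λ.localOp (P.comp (chartAt (Fin d → ℝ) x)) (jacobiator (P.comp (chartAt (Fin d → ℝ) x)))
    (fun s => f s ∘ (chartAt (Fin d → ℝ) x).symm) (chartAt (Fin d → ℝ) x x)

/-- The coefficient of `ℏᵏ` in the operator of a graph sum. -/
def GraphSum.op {m : ℕ} (A : GraphSum m) (k : ℕ) (P : Bivector d N) (f : Fin m → N → ℝ) :
    N → ℝ :=
  A.sum fun Γ a => if Γ.n = k then a • Γ.op P f else 0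

/-- The coefficient of `ℏᵏ` in the operator of a sum of Leibniz graphs. -/
def LeibnizSum.op {m : ℕ} (D : LeibnizSum m) (k : ℕ) (P : Bivector d N) (f : Fin m → N → ℝ) :
    N → ℝ :=
  D.sum fun Λ a => if Λ.b + Λ.l * 2 = k then a • Λ.op P f else 0

/-- The star-product (truncated after `ℏ⁴`) of formal power series in `ℏ` of functions. -/
def starMul (p : Fin 10 → ℝ) (P : Bivector d N) (F G : PowerSeries (N → ℝ)) :
    PowerSeries (N → ℝ) :=
  PowerSeries.mk fun k => ∑ a ∈ Finset.HasAntidiagonal.antidiagonal k, ∑ b ∈ Finset.HasAntidiagonal.antidiagonal a.2,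
    GraphSum.op (star4 p) a.1 P ![PowerSeries.coeff b.1 F, PowerSeries.coeff b.2 G]

end Operators

end

/-! Three facts translate between graphs and operators. First, relabelling reindexes the sum over
edge labels, and a swap of Left and Right exchanges the indices of a skew matrix; hence graph sums
that agree modulo `skewRel` have equal operators (`GraphSum.op_eq_of_sub_mem_skewRel`). Second, all
uses of the Leibniz rule are instances of one statement, `prod_pdM_prod`: if the content of every
vertex is a product of factors, then letting the edges act amounts to summing over all choices of a
factor for each edge. With the vertices of an inserted graph as factors this shows that insertion of
graphs is composition of operators (`KGraph.localOp_insert`); with the two halves of a summand of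
the Jacobiator as factors it shows that a Leibniz graph acts as its expansion
(`LeibnizGraph.localOp_expand`). Third, under an affine change of coordinates every edge contributes
a constant matrix at its head and the inverse matrix at its tail, and these cancel
(`KGraph.localOp_affine`). So the operators do not depend on the chart, and iterated products may be
computed in a single one (`coeff_associator`).

A prime graph already has four internal vertices. Modulo higher orders it can therefore only be
composed with the empty graph, which makes the associator affine in the parameters (`assoc4_eq`,
`assoc4_eq_sum`). Each of its eleven components thus poses a finite linear problem in the quotient
of graph sums by skew-symmetry.

The factorization is a certificate, `leibnizTable`: Leibniz graphs with one Jacobiator, and their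
coefficients in every component. To verify it, all graphs in a component and in the expansion of its
proposed factorization are enumerated as lists of numbers. Each graph is renumbered by a permutation
suggested in the tables, its edges are sorted at every vertex, and its signed coefficient is added
to a search tree. Any renumbering represents the same class (`graphClass_eq_keyClass`), so the
suggestions need no justification: bad ones could only make the check fail. In the end every
coefficient must vanish, except at graphs which an automorphism maps to their own negatives; these
are zero modulo skew-symmetry. This yields `sub_assocFactor_mem`, and with it the first part of the
theorem. The second part follows at once: when the Jacobiator is zero, so is every Leibniz operator.

The third part is detected by one number. For the bi-vector `∂₀ ∧ ∂₁ - x₀³ ∂₀ ∧ ∂₂` the Jacobiator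
is `3 x₀²` times the Levi-Civita symbol. At the origin it survives only under exactly two
derivatives, so an operator of order at most one in the Jacobiator gives zero. On the arguments `x₀
x₁²`, `x₁`, `x₂` only the sink degrees 3, 1, 1 survive, and just one graph of the table passes both
tests. Its coefficient is `24/180` in the constant component and zero in the ten others, and its
value is 12. The associator at `ℏ⁴` therefore takes the value `8/5`, whatever the parameters are
(`testValueL_assocLeibniz`). -/

noncomputable section

/-! ### Iterated partial derivatives of functions that are smooth on an open set -/

section Calculus

variable {d : ℕ} {U : Set (Fin d → ℝ)} {F G : (Fin d → ℝ) → ℝ}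

lemma ContDiffOn.pderiv' (hU : IsOpen U) (hF : ContDiffOn ℝ ∞ F U) (i : Fin d) :
    ContDiffOn ℝ ∞ (pderiv' i F) U :=
  (hF.fderiv_of_isOpen hU (by simp)).clm_apply contDiffOn_const

lemma ContDiffOn.differentiableAt_of_isOpen (hU : IsOpen U) (hF : ContDiffOn ℝ ∞ F U)
    {x : Fin d → ℝ} (hx : x ∈ U) : DifferentiableAt ℝ F x :=
  (hF.contDiffAt (hU.mem_nhds hx)).differentiableAt (by simp)

lemma Set.EqOn.pderiv' (hU : IsOpen U) (h : Set.EqOn F G U) (i : Fin d) :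
    Set.EqOn (pderiv' i F) (pderiv' i G) U := fun x hx => by
  have : F =ᶠ[nhds x] G := Filter.eventuallyEq_of_mem (hU.mem_nhds hx) h
  simp only [_root_.pderiv', this.fderiv_eq]

/-- Symmetry of the second derivative. It is what allows the list of labels on the edges to a vertex
to be replaced by a multiset. -/
lemma pderiv'_comm (hU : IsOpen U) (hF : ContDiffOn ℝ ∞ F U) (i j : Fin d) :
    Set.EqOn (pderiv' i (pderiv' j F)) (pderiv' j (pderiv' i F)) U := fun x hx => by
  have hs : IsSymmSndFDerivAt ℝ F x :=
    (hF.contDiffAt (hU.mem_nhds hx)).isSymmSndFDerivAt (by simpa using WithTop.coe_le_coe.2 (le_top (a := (2 : ℕ∞))))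
  have hd : DifferentiableAt ℝ (fderiv ℝ F) x :=
    ((hF.fderiv_of_isOpen hU (m := ∞) (by simp)).contDiffAt (hU.mem_nhds hx)).differentiableAt
      (by simp)
  have key : ∀ a b : Fin d, pderiv' a (pderiv' b F) x =
      fderiv ℝ (fderiv ℝ F) x (Pi.single a 1) (Pi.single b 1) := fun a b => by
    have : fderiv ℝ (pderiv' b F) x = (fderiv ℝ (fderiv ℝ F) x).flip (Pi.single b 1) := by
      change fderiv ℝ (fun y => fderiv ℝ F y (Pi.single b 1)) x = _
      rw [fderiv_clm_apply hd (differentiableAt_const _)]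
      simp
    rw [_root_.pderiv', this]; rfl
  rw [key, key, hs.eq]

lemma ContDiffOn.pderivs (hU : IsOpen U) (hF : ContDiffOn ℝ ∞ F U) (L : List (Fin d)) :
    ContDiffOn ℝ ∞ (pderivs L F) U := by
  induction L with
  | nil => exact hF
  | cons i L ih => exact ih.pderiv' hU i

lemma Set.EqOn.pderivs (hU : IsOpen U) (h : Set.EqOn F G U) (L : List (Fin d)) :
    Set.EqOn (pderivs L F) (pderivs L G) U := by
  induction L with
  | nil => exact h
  | cons i L ih => exact ih.pderiv' hU i

lemma pderivs_perm (hU : IsOpen U) (hF : ContDiffOn ℝ ∞ F U) {L L' : List (Fin d)}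
    (h : L.Perm L') : Set.EqOn (pderivs L F) (pderivs L' F) U := by
  induction h with
  | nil => exact fun _ _ => rfl
  | cons a _ ih => exact ih.pderiv' hU a
  | swap a b L => exact pderiv'_comm hU (hF.pderivs hU L) b a
  | trans _ _ h1 h2 => exact h1.trans h2

/-- The iterated partial derivative along a multiset of coordinates. -/
def pdM (M : Multiset (Fin d)) (F : (Fin d → ℝ) → ℝ) : (Fin d → ℝ) → ℝ :=
  pderivs M.toList F

/-- The order of the labels in `edgeLabels` depends on the numbering of the internal vertices.
Multisets forget it, and they add up when sets of edges are united. -/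
lemma pderivs_eq_pdM (hU : IsOpen U) (hF : ContDiffOn ℝ ∞ F U) (L : List (Fin d)) :
    Set.EqOn (pderivs L F) (pdM (L : Multiset (Fin d)) F) U :=
  pderivs_perm hU hF (Multiset.coe_eq_coe.1 (Multiset.coe_toList _).symm)

lemma ContDiffOn.pdM (hU : IsOpen U) (hF : ContDiffOn ℝ ∞ F U) (M : Multiset (Fin d)) :
    ContDiffOn ℝ ∞ (pdM M F) U := hF.pderivs hU _

lemma Set.EqOn.pdM (hU : IsOpen U) (h : Set.EqOn F G U) (M : Multiset (Fin d)) :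
    Set.EqOn (pdM M F) (pdM M G) U := h.pderivs hU _

@[simp] lemma pdM_zero : pdM (0 : Multiset (Fin d)) F = F := by
  simp [pdM, pderivs]

lemma pdM_singleton (i : Fin d) : pdM {i} F = pderiv' i F := by
  simp [pdM, pderivs]

/-- `Multiset.toList` makes an arbitrary choice of order, so this is an identity only up to
commuting derivatives, hence only on `U` and for smooth `F`. -/
lemma pdM_add (hU : IsOpen U) (hF : ContDiffOn ℝ ∞ F U) (M M' : Multiset (Fin d)) :
    Set.EqOn (pdM (M + M') F) (pdM M (pdM M' F)) U := by
  have h : (M + M').toList.Perm (M.toList ++ M'.toList) := by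
    rw [← Multiset.coe_eq_coe, ← Multiset.coe_add]; simp
  have e : pderivs (M.toList ++ M'.toList) F = pdM M (pdM M' F) := by
    simp [pdM, pderivs, List.foldr_append]
  rw [← e]
  exact pderivs_perm hU hF h

lemma pderiv'_sum (hU : IsOpen U) {ι : Type*} (s : Finset ι) {f : ι → (Fin d → ℝ) → ℝ}
    (hf : ∀ i ∈ s, ContDiffOn ℝ ∞ (f i) U) (a : Fin d) :
    Set.EqOn (pderiv' a (fun y => ∑ i ∈ s, f i y)) (fun y => ∑ i ∈ s, pderiv' a (f i) y) U :=
  fun x hx => by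
    have : fderiv ℝ (fun y => ∑ i ∈ s, f i y) x = ∑ i ∈ s, fderiv ℝ (f i) x :=
      fderiv_fun_sum fun i hi => (hf i hi).differentiableAt_of_isOpen hU hx
    simp [pderiv', this]

lemma pderiv'_const_mul (c : ℝ) (hU : IsOpen U) (hF : ContDiffOn ℝ ∞ F U) (a : Fin d) :
    Set.EqOn (pderiv' a (fun y => c * F y)) (fun y => c * pderiv' a F y) U := fun x hx => by
  simp [pderiv', fderiv_const_mul (hF.differentiableAt_of_isOpen hU hx)]

lemma pderivs_sum (hU : IsOpen U) {ι : Type*} (s : Finset ι) {f : ι → (Fin d → ℝ) → ℝ}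
    (hf : ∀ i ∈ s, ContDiffOn ℝ ∞ (f i) U) (L : List (Fin d)) :
    Set.EqOn (pderivs L (fun y => ∑ i ∈ s, f i y)) (fun y => ∑ i ∈ s, pderivs L (f i) y) U := by
  induction L with
  | nil => exact fun _ _ => rfl
  | cons a L ih =>
    exact (ih.pderiv' hU a).trans (pderiv'_sum hU s (fun i hi => (hf i hi).pderivs hU L) a)

lemma pderivs_const_mul (c : ℝ) (hU : IsOpen U) (hF : ContDiffOn ℝ ∞ F U) (L : List (Fin d)) :
    Set.EqOn (pderivs L (fun y => c * F y)) (fun y => c * pderivs L F y) U := by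
  induction L with
  | nil => exact fun _ _ => rfl
  | cons a L ih =>
    exact (ih.pderiv' hU a).trans (pderiv'_const_mul c hU (hF.pderivs hU L) a)

lemma pdM_sum (hU : IsOpen U) {ι : Type*} (s : Finset ι) {f : ι → (Fin d → ℝ) → ℝ}
    (hf : ∀ i ∈ s, ContDiffOn ℝ ∞ (f i) U) (M : Multiset (Fin d)) :
    Set.EqOn (pdM M (fun y => ∑ i ∈ s, f i y)) (fun y => ∑ i ∈ s, pdM M (f i) y) U :=
  pderivs_sum hU s hf _

lemma pdM_const_mul (c : ℝ) (hU : IsOpen U) (hF : ContDiffOn ℝ ∞ F U) (M : Multiset (Fin d)) :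
    Set.EqOn (pdM M (fun y => c * F y)) (fun y => c * pdM M F y) U :=
  pderivs_const_mul c hU hF _

lemma pderivs_zero (L : List (Fin d)) : pderivs L (fun _ => 0) = fun _ => 0 := by
  induction L with
  | nil => rfl
  | cons a L ih =>
    change pderiv' a (pderivs L _) = _
    rw [ih]; funext x; simp [pderiv']

lemma pdM_neg (hU : IsOpen U) (hF : ContDiffOn ℝ ∞ F U) (M : Multiset (Fin d)) :
    Set.EqOn (pdM M (fun y => - F y)) (fun y => - pdM M F y) U := by
  simpa using pdM_const_mul (-1) hU hF M

/-- Writing the differentiated factor by `Function.update` keeps every summand a product over the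
same index set, so that the next edge can act on it in the same way. -/
lemma pderiv'_prod (hU : IsOpen U) {ι : Type*} [DecidableEq ι] (s : Finset ι)
    {f : ι → (Fin d → ℝ) → ℝ} (hf : ∀ i ∈ s, ContDiffOn ℝ ∞ (f i) U) (a : Fin d) :
    Set.EqOn (pderiv' a (fun y => ∏ i ∈ s, f i y))
      (fun y => ∑ i ∈ s, ∏ j ∈ s, Function.update f i (pderiv' a (f i)) j y) U := fun x hx => by
  have := fderiv_finsetProd (𝕜 := ℝ) (u := s) (g := f) (x := x)
    fun i hi => (hf i hi).differentiableAt_of_isOpen hU hx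
  simp only [pderiv', this, sum_apply, smul_apply,
    smul_eq_mul]
  refine Finset.sum_congr rfl fun i hi => ?_
  rw [← Finset.prod_erase_mul _ _ hi]
  congr 1
  · exact Finset.prod_congr rfl fun j hj => by
      rw [Function.update_of_ne (Finset.ne_of_mem_erase hj)]
  · simp [pderiv']

end Calculus

/-! ### Labels on edges, and the Leibniz rule for edges that act on products -/

section Edges

variable {d : ℕ} {V W : Type} [DecidableEq V] [DecidableEq W]

/-- The multiset of the indices on the edges that land on the vertex `y`. -/
def edgeM {ε : Type} [Fintype ε] (t : ε → V) (I : ε → Fin d) (y : V) : Multiset (Fin d) :=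
  ∑ e, if t e = y then {I e} else 0

/-- As a sum over all edges, the collection of labels at a vertex is visibly additive and invariant
under a renumbering of the edges. -/
lemma coe_edgeLabels {n r : ℕ} (tgt : Fin n → Fin r → V) (I : Fin n → Fin r → Fin d) (y : V) :
    (edgeLabels tgt I y : Multiset (Fin d)) =
      edgeM (fun e : Fin n × Fin r => tgt e.1 e.2) (fun e => I e.1 e.2) y := by
  have h : ∀ L : List (Fin n × Fin r),
      (((L.filter fun e => tgt e.1 e.2 = y).map fun e => I e.1 e.2 : List (Fin d)) :
        Multiset (Fin d)) =
      (L.map fun e => if tgt e.1 e.2 = y then ({I e.1 e.2} : Multiset (Fin d)) else 0).sum := by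
    intro L
    induction L with
    | nil => rfl
    | cons e L ih =>
      by_cases he : tgt e.1 e.2 = y
      · simp [he, ← ih]
      · simp [he, ← ih]
  have h2 : ∀ (f : Fin n × Fin r → Multiset (Fin d)),
      ((List.finRange n ×ˢ List.finRange r).map f).sum = ∑ e, f e := by
    intro f
    rw [← List.sum_toFinset _ (List.Nodup.product (List.nodup_finRange n) (List.nodup_finRange r))]
    congr 1
    ext e; simp [List.product, SProd.sprod]
  rw [edgeLabels, h, h2, edgeM]

lemma edgeM_comp_injective {ε : Type} [Fintype ε] {φ : V → W} (hφ : Function.Injective φ)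
    (t : ε → V) (I : ε → Fin d) (y : V) :
    edgeM (fun e => φ (t e)) I (φ y) = edgeM t I y := by
  simp [edgeM, hφ.eq_iff]

lemma edgeM_equiv {ε ε' : Type} [Fintype ε] [Fintype ε'] (q : ε ≃ ε') (t : ε' → V)
    (I : ε' → Fin d) (y : V) : edgeM (t ∘ q) (I ∘ q) y = edgeM t I y :=
  Equiv.sum_comp q fun e => if t e = y then ({I e} : Multiset (Fin d)) else 0

/-- The Leibniz rule for several functions which are products: the functions `F w` with `π w = v`
are the factors at the vertex `v`, and an edge to `v` acts on one of these factors. -/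
lemma prod_pdM_prod_fin {U : Set (Fin d → ℝ)} (hU : IsOpen U) [Fintype V] [Fintype W]
    (π : W → V) (n : ℕ) (t : Fin n → V) (I : Fin n → Fin d) (F : W → (Fin d → ℝ) → ℝ)
    (hF : ∀ w, ContDiffOn ℝ ∞ (F w) U) {x : Fin d → ℝ} (hx : x ∈ U) :
    ∏ v, pdM (edgeM t I v) (fun y => ∏ w with π w = v, F w y) x =
      ∑ τ ∈ Fintype.piFinset fun e => Finset.univ.filter fun w => π w = t e,
        ∏ w, pdM (edgeM τ I w) (F w) x := by
  induction n generalizing F with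
  | zero =>
    simp only [edgeM, Finset.univ_eq_empty, Finset.sum_empty, pdM_zero]
    rw [Finset.prod_fiberwise, Fintype.piFinset_of_isEmpty]
    simp
  | succ n ih =>
    have hsmooth : ∀ v, ContDiffOn ℝ ∞ (fun y => ∏ w with π w = v, F w y) U := fun v =>
      contDiffOn_prod fun w _ => hF w
    have hupd : ∀ w w', ContDiffOn ℝ ∞ (Function.update F w (pderiv' (I 0) (F w)) w') U := by
      intro w w'
      by_cases h : w' = w
      · subst h; rw [Function.update_self]; exact (hF _).pderiv' hU _
      · rw [Function.update_of_ne h]; exact hF _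
    have hE : ∀ {Y : Type} [DecidableEq Y] (t : Fin (n + 1) → Y) (y : Y), edgeM t I y =
        edgeM (fun e => t (Fin.succ e)) (fun e => I (Fin.succ e)) y +
          if t 0 = y then {I 0} else 0 := by
      intro Y _ t y; rw [edgeM, Fin.sum_univ_succ, add_comm]; rfl
    -- The edge `0` is taken to act first. It affects only the product at `t 0`, where it turns one
    -- factor `F w0` into its derivative; the other edges then act on the updated family, to which
    -- the induction hypothesis applies.
    have hL : ∏ v, pdM (edgeM t I v) (fun y => ∏ w with π w = v, F w y) x =
        ∑ w0 with π w0 = t 0, ∏ v, pdM (edgeM (fun e => t (Fin.succ e)) (fun e => I (Fin.succ e)) v)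
          (fun y => ∏ w with π w = v, Function.update F w0 (pderiv' (I 0) (F w0)) w y) x := by
      have h0 : pdM (edgeM t I (t 0)) (fun y => ∏ w with π w = t 0, F w y) x =
          ∑ w0 with π w0 = t 0, pdM (edgeM (fun e => t (Fin.succ e)) (fun e => I (Fin.succ e)) (t 0))
            (fun y => ∏ w with π w = t 0, Function.update F w0 (pderiv' (I 0) (F w0)) w y) x := by
        rw [hE t, if_pos rfl, pdM_add hU (hsmooth _) _ _ hx, pdM_singleton]
        rw [(pderiv'_prod hU _ (fun w _ => hF w) (I 0)).pdM hU _ hx]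
        rw [pdM_sum hU _ (fun w _ => contDiffOn_prod fun w' _ => hupd w w') _ hx]
      rw [← Finset.mul_prod_erase _ _ (Finset.mem_univ (t 0)), h0, Finset.sum_mul]
      refine Finset.sum_congr rfl fun w0 hw0 => ?_
      rw [← Finset.mul_prod_erase _ _ (Finset.mem_univ (t 0))]
      congr 1
      refine Finset.prod_congr rfl fun v hv => ?_
      have hv' : v ≠ t 0 := Finset.ne_of_mem_erase hv
      rw [hE t, if_neg (Ne.symm hv'), add_zero]
      congr 1
      funext y
      refine Finset.prod_congr rfl fun w hw => ?_
      rw [Function.update_of_ne]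
      rintro rfl
      simp only [Finset.mem_filter, Finset.mem_univ, true_and] at hw hw0
      exact hv' (hw.symm.trans hw0)
    rw [hL]
    -- The derivative stored in the updated family is put back as the edge `0`, now landing on `w0`.
    have hR : ∀ w0, ∏ v, pdM (edgeM (fun e => t (Fin.succ e)) (fun e => I (Fin.succ e)) v)
          (fun y => ∏ w with π w = v, Function.update F w0 (pderiv' (I 0) (F w0)) w y) x =
        ∑ τ ∈ Fintype.piFinset fun e : Fin n => Finset.univ.filter fun w => π w = t (Fin.succ e),
          ∏ w, pdM (edgeM (Fin.cons w0 τ : Fin (n + 1) → W) I w) (F w) x := by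
      intro w0
      rw [ih _ _ _ (hupd w0)]
      refine Finset.sum_congr rfl fun τ _ => Finset.prod_congr rfl fun w _ => ?_
      rw [hE (Fin.cons w0 τ)]
      simp only [Fin.cons_succ, Fin.cons_zero]
      by_cases h : w0 = w
      · subst h
        rw [if_pos rfl, pdM_add hU (hF _) _ _ hx, pdM_singleton, Function.update_self]
      · rw [if_neg h, add_zero, Function.update_of_ne (Ne.symm h)]
    simp only [hR]
    rw [← Finset.sum_product']
    refine Finset.sum_bij' (fun p _ => Fin.cons p.1 p.2) (fun τ _ => (τ 0, fun e => τ e.succ))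
      ?_ ?_ ?_ ?_ ?_
    · rintro ⟨w, τ⟩ h
      simp only [Finset.mem_product, Fintype.mem_piFinset] at h ⊢
      exact Fin.cases h.1 h.2
    · intro τ h
      simp only [Finset.mem_product, Fintype.mem_piFinset] at h ⊢
      exact ⟨h 0, fun e => h e.succ⟩
    · rintro ⟨w, τ⟩ _; simp
    · intro τ _; exact Fin.cons_self_tail τ
    · intros; rfl

lemma prod_pdM_prod {U : Set (Fin d → ℝ)} (hU : IsOpen U) [Fintype V] [Fintype W]
    {ε : Type} [Fintype ε] [DecidableEq ε]
    (π : W → V) (t : ε → V) (I : ε → Fin d) (F : W → (Fin d → ℝ) → ℝ)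
    (hF : ∀ w, ContDiffOn ℝ ∞ (F w) U) {x : Fin d → ℝ} (hx : x ∈ U) :
    ∏ v, pdM (edgeM t I v) (fun y => ∏ w with π w = v, F w y) x =
      ∑ τ ∈ Fintype.piFinset fun e => Finset.univ.filter fun w => π w = t e,
        ∏ w, pdM (edgeM τ I w) (F w) x := by
  let q := (Fintype.equivFin ε).symm
  have h := prod_pdM_prod_fin hU π _ (t ∘ q) (I ∘ q) F hF hx
  simp only [edgeM_equiv] at h
  rw [h]
  refine Finset.sum_equiv (Equiv.arrowCongr q (Equiv.refl W)) ?_ ?_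
  · intro τ
    simp only [Fintype.mem_piFinset, Equiv.arrowCongr_apply, Function.comp]
    exact ⟨fun h e => by simpa using h (q.symm e), fun h e => by simpa using h (q e)⟩
  · intro τ _
    refine Finset.prod_congr rfl fun w _ => ?_
    rw [← edgeM_equiv q]
    congr 2
    funext e; simp

end Edges

/-! ### Operators of graphs in one chart: skew-symmetry, insertion, expansion of Jacobiators -/

section LocalOperators

variable {d m : ℕ} {U : Set (Fin d → ℝ)} {P : Fin d → Fin d → (Fin d → ℝ) → ℝ}
  {f : Fin m → (Fin d → ℝ) → ℝ} {x : Fin d → ℝ}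

/-- The functions in the vertices of a Kontsevich graph whose edges carry the indices `I`. -/
def vertexContent {m n d : ℕ} (P : Fin d → Fin d → (Fin d → ℝ) → ℝ)
    (f : Fin m → (Fin d → ℝ) → ℝ) (I : Fin n → Fin 2 → Fin d) :
    Fin m ⊕ Fin n → (Fin d → ℝ) → ℝ :=
  Sum.elim f fun v => P (I v 0) (I v 1)

/-- The indices on the edges to a vertex, for edges that form a matrix. -/
abbrev edgeM₂ {n r d : ℕ} {V : Type} [DecidableEq V] (t : Fin n → Fin r → V)
    (I : Fin n → Fin r → Fin d) (y : V) : Multiset (Fin d) :=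
  edgeM (fun e : Fin n × Fin r => t e.1 e.2) (fun e => I e.1 e.2) y

lemma contDiffOn_vertexContent (hP : ∀ i j, ContDiffOn ℝ ∞ (P i j) U)
    (hf : ∀ s, ContDiffOn ℝ ∞ (f s) U) {n : ℕ} (I : Fin n → Fin 2 → Fin d) (y : Fin m ⊕ Fin n) :
    ContDiffOn ℝ ∞ (vertexContent P f I y) U := by
  rcases y with s | v
  · exact hf s
  · exact hP _ _

lemma KGraph.localOp_eq (hU : IsOpen U) (hP : ∀ i j, ContDiffOn ℝ ∞ (P i j) U)
    (hf : ∀ s, ContDiffOn ℝ ∞ (f s) U) (hx : x ∈ U) (Γ : KGraph m) :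
    Γ.localOp P f x = ∑ I : Fin Γ.n → Fin 2 → Fin d,
      ∏ y, pdM (edgeM₂ Γ.tgt I y) (vertexContent P f I y) x := by
  refine Finset.sum_congr rfl fun I _ => ?_
  rw [Fintype.prod_sum_type, mul_comm]
  congr 1
  · refine Finset.prod_congr rfl fun s _ => ?_
    rw [pderivs_eq_pdM hU (hf s) _ hx, coe_edgeLabels]; rfl
  · refine Finset.prod_congr rfl fun s _ => ?_
    rw [pderivs_eq_pdM hU (hP _ _) _ hx, coe_edgeLabels]; rfl

lemma KGraph.contDiffOn_localOp (hU : IsOpen U) (hP : ∀ i j, ContDiffOn ℝ ∞ (P i j) U)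
    (hf : ∀ s, ContDiffOn ℝ ∞ (f s) U) (Γ : KGraph m) : ContDiffOn ℝ ∞ (Γ.localOp P f) U :=
  ContDiffOn.sum fun _ _ => (contDiffOn_prod fun _ _ => (hP _ _).pderivs hU _).mul
    (contDiffOn_prod fun s _ => (hf s).pderivs hU _)

lemma KGraph.localOp_mk (hU : IsOpen U) (hP : ∀ i j, ContDiffOn ℝ ∞ (P i j) U)
    (hf : ∀ s, ContDiffOn ℝ ∞ (f s) U) (hx : x ∈ U) (n : ℕ) (t : Fin n → Fin 2 → Fin m ⊕ Fin n) :
    KGraph.localOp ⟨n, t⟩ P f x = ∑ I : Fin n → Fin 2 → Fin d,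
      ∏ y, pdM (edgeM₂ t I y) (vertexContent P f I y) x :=
  KGraph.localOp_eq hU hP hf hx ⟨n, t⟩

lemma edgeM₂_comp_injective {n r : ℕ} {V W : Type} [DecidableEq V] [DecidableEq W] {φ : V → W}
    (hφ : Function.Injective φ) (t : Fin n → Fin r → V) (I : Fin n → Fin r → Fin d) (y : V) :
    edgeM₂ (fun v j => φ (t v j)) I (φ y) = edgeM₂ t I y :=
  edgeM_comp_injective hφ _ _ y

/-- Permuting the summation indices along with the internal vertices leaves the labels that arrive
at corresponding vertices, and the contents of these, unchanged. -/
lemma KGraph.localOp_relabel (hU : IsOpen U) (hP : ∀ i j, ContDiffOn ℝ ∞ (P i j) U)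
    (hf : ∀ s, ContDiffOn ℝ ∞ (f s) U) (hx : x ∈ U) (Γ : KGraph m) (σ : Equiv.Perm (Fin Γ.n)) :
    (Γ.relabel σ).localOp P f x = Γ.localOp P f x := by
  obtain ⟨n, t⟩ := Γ
  change Equiv.Perm (Fin n) at σ
  rw [KGraph.localOp_mk hU hP hf hx, KGraph.relabel, KGraph.localOp_mk hU hP hf hx]
  rw [← Equiv.sum_comp (Equiv.arrowCongr σ (Equiv.refl (Fin 2 → Fin d)))]
  refine Finset.sum_congr rfl fun I _ => ?_
  rw [← Equiv.prod_comp (Equiv.sumCongr (Equiv.refl (Fin m)) σ)]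
  refine Finset.prod_congr rfl fun y _ => ?_
  have h1 : edgeM₂ (fun v j => Sum.map id σ (t (σ.symm v) j))
      (Equiv.arrowCongr σ (Equiv.refl (Fin 2 → Fin d)) I)
      (Equiv.sumCongr (Equiv.refl (Fin m)) σ y) = edgeM₂ t I y := by
    rw [← edgeM₂_comp_injective (Equiv.sumCongr (Equiv.refl (Fin m)) σ).injective t I y, edgeM₂,
      ← edgeM_equiv (Equiv.prodCongr σ (Equiv.refl (Fin 2)))]
    simp only [edgeM, Function.comp, Equiv.prodCongr_apply, Prod.map, Equiv.symm_apply_apply,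
      Equiv.refl_apply, Equiv.arrowCongr_apply, Equiv.sumCongr_apply, Equiv.coe_refl]
  have h2 : vertexContent P f (Equiv.arrowCongr σ (Equiv.refl (Fin 2 → Fin d)) I)
      (Equiv.sumCongr (Equiv.refl (Fin m)) σ y) = vertexContent P f I y := by
    rcases y with s | v
    · rfl
    · simp [vertexContent]
  rw [h1, h2]

/-- Exchanging the two labels at `v` in the sum over labels compensates the swap of the edges, since
the same label then goes to the same target. Only the content of `v` changes, by the transposition
of its two indices. -/
lemma KGraph.localOp_swap (hU : IsOpen U) (hP : ∀ i j, ContDiffOn ℝ ∞ (P i j) U)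
    (hs : ∀ i j, ∀ y ∈ U, P i j y = - P j i y)
    (hf : ∀ s, ContDiffOn ℝ ∞ (f s) U) (hx : x ∈ U) (Γ : KGraph m) (v : Fin Γ.n) :
    (Γ.swap v).localOp P f x = - Γ.localOp P f x := by
  obtain ⟨n, t⟩ := Γ
  change Fin n at v
  rw [KGraph.localOp_mk hU hP hf hx, KGraph.swap, KGraph.localOp_mk hU hP hf hx,
    ← Finset.sum_neg_distrib]
  let q : (Fin n → Fin 2 → Fin d) ≃ (Fin n → Fin 2 → Fin d) :=
    Equiv.piCongrRight fun u =>
      if u = v then Equiv.arrowCongr Fin.revPerm (Equiv.refl (Fin d)) else Equiv.refl _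
  have hq : ∀ I u j, q I u j = if u = v then I u j.rev else I u j := by
    intro I u j
    by_cases h : u = v <;> simp [q, h]
  rw [← Equiv.sum_comp q]
  refine Finset.sum_congr rfl fun I _ => ?_
  have hE : ∀ y, edgeM₂ (fun u j => if u = v then t u j.rev else t u j) (q I) y =
      edgeM₂ t I y := by
    intro y
    simp only [edgeM₂, edgeM, Fintype.sum_prod_type, hq]
    refine Finset.sum_congr rfl fun u _ => ?_
    by_cases h : u = v
    · subst h
      rw [Fin.sum_univ_two, Fin.sum_univ_two, add_comm]
      simp
    · simp [h]
  simp only [hE]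
  rw [← Finset.mul_prod_erase _ _ (Finset.mem_univ (.inr v)),
    ← Finset.mul_prod_erase _ (fun y => pdM (edgeM₂ t I y) (vertexContent P f I y) x)
      (Finset.mem_univ (.inr v)), ← neg_mul]
  congr 1
  · have : Set.EqOn (vertexContent P f (q I) (.inr v))
        (fun y => - vertexContent P f I (.inr v) y) U := by
      intro y hy
      simp only [vertexContent, Sum.elim_inr, hq, if_true]
      exact hs _ _ y hy
    rw [this.pdM hU _ hx]
    exact pdM_neg hU (hP _ _) _ hx
  · refine Finset.prod_congr rfl fun y hy => ?_
    congr 1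
    rcases y with s | u
    · rfl
    · have hu : u ≠ v := fun h => Finset.ne_of_mem_erase hy (by rw [h])
      simp [vertexContent, hq, hu]

lemma edgeM₂_append {a b r : ℕ} {V : Type} [DecidableEq V] (t : Fin a → Fin r → V)
    (t' : Fin b → Fin r → V) (I : Fin a → Fin r → Fin d) (I' : Fin b → Fin r → Fin d) (y : V) :
    edgeM₂ (Fin.append t t') (Fin.append I I') y = edgeM₂ t I y + edgeM₂ t' I' y := by
  simp [edgeM, Fintype.sum_prod_type, Fin.sum_univ_add]

lemma sum_piFinset_curry {n r : ℕ} {V M : Type*} [DecidableEq V] [AddCommMonoid M]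
    (A : Fin n → Fin r → Finset V) (g : (Fin n → Fin r → V) → M) :
    ∑ τ ∈ Fintype.piFinset (fun v => Fintype.piFinset fun j => A v j), g τ =
      ∑ τ ∈ Fintype.piFinset (fun e : Fin n × Fin r => A e.1 e.2), g fun v j => τ (v, j) := by
  refine (Finset.sum_equiv (Equiv.curry _ _ _) ?_ ?_).symm
  · intro τ
    simp only [Fintype.mem_piFinset, Equiv.curry_apply, Function.curry]
    exact ⟨fun h v j => h (v, j), fun h e => h e.1 e.2⟩
  · intros; rfl

/-- The projection of the vertices of a composite graph to those of the outer graph. -/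
def insertProj (s : Fin 2) (a b : ℕ) : Fin 3 ⊕ Fin (b + a) → Fin 2 ⊕ Fin a :=
  Sum.elim (fun r => if r = outerSink s.rev then .inl s.rev else .inl s)
    (Fin.addCases (fun _ => .inl s) fun v => .inr v)

/-- The Leibniz expansion of an insertion is hereby a sum over lifts of edges through a projection
of vertices, which is the form of `prod_pdM_prod`. -/
lemma insertTargets_eq (s : Fin 2) (Γ Δ : KGraph 2) (z : Fin 2 ⊕ Fin Γ.n) :
    insertTargets s Γ Δ z = Finset.univ.filter fun w => insertProj s Γ.n Δ.n w = z := by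
  have hin : ∀ y, insertProj s Γ.n Δ.n (innerVertex s Δ Γ.n y) = .inl s := by
    rintro (i | u)
    · have : innerSink s i ≠ outerSink s.rev := by revert s i; decide
      simp [innerVertex, insertProj, this]
    · simp [innerVertex, insertProj]
  have hsink : ∀ r : Fin 3, r ≠ outerSink s.rev → ∃ i, innerSink s i = r := by
    clear hin; revert s; decide
  ext w
  simp only [Finset.mem_filter, Finset.mem_univ, true_and]
  rcases z with t | v
  · by_cases hts : t = s
    · subst hts
      simp only [insertTargets, if_true, Finset.mem_image, Finset.mem_univ, true_and]
      constructor
      · rintro ⟨y, rfl⟩; exact hin y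
      · rcases w with r | u
        · intro h
          by_cases hr : r = outerSink t.rev
          · subst hr
            exfalso
            simp only [insertProj, Sum.elim_inl, if_true, Sum.inl.injEq] at h
            clear hin hsink; revert t; decide
          · obtain ⟨i, hi⟩ := hsink r hr
            exact ⟨.inl i, by simp [innerVertex, hi]⟩
        · induction u using Fin.addCases with
          | left u => exact fun _ => ⟨.inr u, rfl⟩
          | right u => intro h; simp [insertProj] at h
    · have ht : t = s.rev := by clear hin hsink; revert t s; decide
      subst ht
      simp only [insertTargets, if_neg hts, Finset.mem_singleton]
      constructor
      · rintro rfl; simp [insertProj]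
      · rcases w with r | u
        · intro h
          by_cases hr : r = outerSink s.rev
          · rw [hr]
          · simp only [insertProj, Sum.elim_inl, if_neg hr, Sum.inl.injEq] at h
            exact absurd h.symm hts
        · induction u using Fin.addCases with
          | left u =>
            intro h; simp only [insertProj, Sum.elim_inr, Fin.addCases_left, Sum.inl.injEq] at h
            exact absurd h.symm hts
          | right u => intro h; simp [insertProj] at h
  · simp only [insertTargets, Finset.mem_singleton]
    constructor
    · rintro rfl; simp [insertProj]
    · rcases w with r | u
      · intro h; by_cases hr : r = outerSink s.rev <;> simp [insertProj, hr] at h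
      · induction u using Fin.addCases with
        | left u => intro h; simp [insertProj] at h
        | right u => intro h; simp [insertProj] at h; simp [h]

lemma innerVertex_injective (s : Fin 2) (Δ : KGraph 2) (a : ℕ) :
    Function.Injective (innerVertex s Δ a) := by
  refine Function.Injective.sumMap ?_ (Fin.castAdd_injective _ _)
  revert s; decide

/-- The arguments of a graph of the outer star-product, when `G` is placed in its sink `s`. -/
def insertArgs (s : Fin 2) {X : Type*} (G : X) (f : Fin 3 → X) (t : Fin 2) : X :=
  if t = s then G else f (outerSink t)

/-- Composition of operators is insertion of graphs. The content of the sink `s` is a sum, over the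
labels of `Δ`, of products over the vertices of `Δ`; an outer edge to `s` picks one of these
vertices, while all other vertices of `Γ` are products of a single factor. -/
theorem KGraph.localOp_insert (hU : IsOpen U) (hP : ∀ i j, ContDiffOn ℝ ∞ (P i j) U)
    {f : Fin 3 → (Fin d → ℝ) → ℝ} (hf : ∀ s, ContDiffOn ℝ ∞ (f s) U) (hx : x ∈ U)
    (s : Fin 2) (Γ Δ : KGraph 2) :
    Γ.localOp P (insertArgs s (Δ.localOp P fun i => f (innerSink s i)) f) x =
      ∑ τ ∈ Fintype.piFinset (fun v => Fintype.piFinset fun j => insertTargets s Γ Δ (Γ.tgt v j)),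
        KGraph.localOp
          ⟨Δ.n + Γ.n, Fin.append (fun u j => innerVertex s Δ Γ.n (Δ.tgt u j)) τ⟩ P f x := by
  have hfi : ∀ i, ContDiffOn ℝ ∞ (f (innerSink s i)) U := fun i => hf _
  have hargs : ∀ t, ContDiffOn ℝ ∞
      (insertArgs s (Δ.localOp P fun i => f (innerSink s i)) f t) U := by
    intro t
    by_cases h : t = s
    · simpa [insertArgs, h] using Δ.contDiffOn_localOp hU hP hfi
    · simpa [insertArgs, h] using hf _
  let inner : Fin Δ.n → Fin 2 → Fin 3 ⊕ Fin (Δ.n + Γ.n) :=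
    fun u j => innerVertex s Δ Γ.n (Δ.tgt u j)
  -- The factor at `w` as the outer edges find it: the edges of the inner graph have already acted.
  let F (I : Fin Γ.n → Fin 2 → Fin d) (J : Fin Δ.n → Fin 2 → Fin d)
      (w : Fin 3 ⊕ Fin (Δ.n + Γ.n)) : (Fin d → ℝ) → ℝ :=
    pdM (edgeM₂ inner J w) (vertexContent P f (Fin.append J I) w)
  have hF : ∀ I J w, ContDiffOn ℝ ∞ (F I J w) U := fun I J w =>
    (contDiffOn_vertexContent hP hf _ w).pdM hU _
  rw [KGraph.localOp_eq hU hP hargs hx]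
  -- the products of the contents over the fibers of the projection
  have hfib_s : ∀ I J, ∀ y ∈ U, ∏ w with insertProj s Γ.n Δ.n w = .inl s, F I J w y =
      ∏ z, pdM (edgeM₂ Δ.tgt J z) (vertexContent P (fun i => f (innerSink s i)) J z) y := by
    intro I J y _
    rw [← insertTargets_eq, insertTargets, if_pos rfl,
      Finset.prod_image (innerVertex_injective s Δ Γ.n).injOn]
    refine Finset.prod_congr rfl fun z _ => ?_
    simp only [F, inner]
    rw [edgeM₂_comp_injective (innerVertex_injective s Δ Γ.n)]
    rcases z with i | u
    · rfl
    · simp [vertexContent, innerVertex]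
  -- Edges of the inner graph never land outside it.
  have hE0 : ∀ (J : Fin Δ.n → Fin 2 → Fin d) w, (∀ y, innerVertex s Δ Γ.n y ≠ w) → edgeM₂ inner J w = 0 := by
    intro J w h
    simp [edgeM, inner, h]
  have hfib_o : ∀ I J z, z ≠ .inl s → ∀ y ∈ U, ∏ w with insertProj s Γ.n Δ.n w = z, F I J w y =
      vertexContent P (insertArgs s (Δ.localOp P fun i => f (innerSink s i)) f) I z y := by
    intro I J z hz y _
    rw [← insertTargets_eq]
    rcases z with t | v
    · have hts : t ≠ s := fun h => hz (by rw [h])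
      rw [insertTargets, if_neg hts, Finset.prod_singleton]
      simp only [F]
      rw [hE0]
      · simp [vertexContent, insertArgs, hts]
      · rintro (i | u) <;> simp [innerVertex]
        have key : ∀ s t i : Fin 2, t ≠ s → ¬ innerSink s i = outerSink t := by decide
        exact key s t i hts
    · rw [insertTargets, Finset.prod_singleton]
      simp only [F]
      rw [hE0]
      · simp [vertexContent]
      · rintro (i | u) <;> simp [innerVertex, Fin.ext_iff]
        omega
  have hI : ∀ I : Fin Γ.n → Fin 2 → Fin d, ∏ z, pdM (edgeM₂ Γ.tgt I z) (vertexContent P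
      (insertArgs s (Δ.localOp P fun i => f (innerSink s i)) f) I z) x =
      ∑ J : Fin Δ.n → Fin 2 → Fin d, ∏ z, pdM (edgeM₂ Γ.tgt I z)
        (fun y => ∏ w with insertProj s Γ.n Δ.n w = z, F I J w y) x := by
    intro I
    have hs' : Set.EqOn (vertexContent P
        (insertArgs s (Δ.localOp P fun i => f (innerSink s i)) f) I (.inl s))
        (fun y => ∑ J : Fin Δ.n → Fin 2 → Fin d,
          ∏ w with insertProj s Γ.n Δ.n w = .inl s, F I J w y) U := by
      intro y hy
      simp only [vertexContent, Sum.elim_inl, insertArgs, if_true]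
      rw [KGraph.localOp_eq hU hP hfi hy]
      exact Finset.sum_congr rfl fun J _ => (hfib_s I J y hy).symm
    rw [← Finset.mul_prod_erase _ _ (Finset.mem_univ (.inl s)), hs'.pdM hU _ hx,
      pdM_sum hU _ (fun J _ => contDiffOn_prod fun w _ => hF I J w) _ hx, Finset.sum_mul]
    refine Finset.sum_congr rfl fun J _ => ?_
    rw [← Finset.mul_prod_erase _ _ (Finset.mem_univ (.inl s))]
    congr 1
    refine Finset.prod_congr rfl fun z hz => ?_
    exact Set.EqOn.pdM hU (fun y hy => (hfib_o I J z (Finset.ne_of_mem_erase hz) y hy).symm) _ hx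
  simp only [hI]
  have hL : ∀ I J, ∏ z, pdM (edgeM₂ Γ.tgt I z)
        (fun y => ∏ w with insertProj s Γ.n Δ.n w = z, F I J w y) x =
      ∑ τ ∈ Fintype.piFinset (fun v => Fintype.piFinset fun j => insertTargets s Γ Δ (Γ.tgt v j)),
        ∏ w, pdM (edgeM₂ (Fin.append inner τ) (Fin.append J I) w)
          (vertexContent P f (Fin.append J I) w) x := by
    intro I J
    rw [prod_pdM_prod hU _ _ _ _ (hF I J) hx, sum_piFinset_curry]
    refine Finset.sum_congr (by simp only [insertTargets_eq]) fun τ _ => ?_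
    refine Finset.prod_congr rfl fun w _ => ?_
    -- The outer labels at `w` are joined to the inner ones, which act first.
    rw [edgeM₂_append, add_comm (edgeM₂ inner J w), pdM_add hU (contDiffOn_vertexContent hP hf _ w) _ _ hx]
  simp only [hL]
  rw [Finset.sum_comm]
  simp_rw [Finset.sum_comm (s := Finset.univ)
    (t := Fintype.piFinset fun v => Fintype.piFinset fun j => insertTargets s Γ Δ (Γ.tgt v j))]
  refine Finset.sum_congr rfl fun τ _ => ?_
  rw [KGraph.localOp_eq hU hP hf hx, ← Equiv.sum_comp (Fin.appendEquiv Δ.n Γ.n),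
    Fintype.sum_prod_type]
  rfl

/-- The projection of the vertices of the expansion of a Leibniz graph to its vertices. -/
def LeibnizGraph.proj (Λ : LeibnizGraph m) : Fin m ⊕ Fin (Λ.b + Λ.l * 2) → Fin m ⊕ (Fin Λ.b ⊕ Fin Λ.l) :=
  Sum.elim .inl (Fin.addCases (fun v => .inr (.inl v)) fun u => .inr (.inr (finProdFinEquiv.symm u).1))

lemma LeibnizGraph.targets_eq (Λ : LeibnizGraph m) (z : Fin m ⊕ (Fin Λ.b ⊕ Fin Λ.l)) :
    Λ.targets z = Finset.univ.filter fun w => Λ.proj w = z := by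
  ext w
  simp only [Finset.mem_filter, Finset.mem_univ, true_and]
  rcases z with s | v | j
  · simp only [targets, Finset.mem_singleton]
    constructor
    · rintro rfl; rfl
    · rcases w with r | u
      · intro h; simpa [proj] using h
      · induction u using Fin.addCases <;> simp [proj]
  · simp only [targets, Finset.mem_singleton]
    constructor
    · rintro rfl; simp [proj]
    · rcases w with r | u
      · simp [proj]
      · induction u using Fin.addCases <;> simp [proj]
  · simp only [targets, Finset.mem_image, Finset.mem_univ, true_and]
    constructor
    · rintro ⟨e, rfl⟩
      simp only [proj, jacVertex, Sum.elim_inr, Fin.addCases_right, Equiv.symm_apply_apply]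
    · rcases w with r | u
      · simp [proj]
      · induction u using Fin.addCases with
        | left u => simp [proj]
        | right u =>
          obtain ⟨⟨j', e⟩, rfl⟩ := finProdFinEquiv.surjective u
          intro h
          simp only [proj, Sum.elim_inr, Fin.addCases_right, Equiv.symm_apply_apply,
            Sum.inr.injEq] at h
          exact ⟨e, by rw [← h, jacVertex]⟩

lemma sum_piFinset_sum {ε ε' V M : Type*} [Fintype ε] [DecidableEq ε] [Fintype ε']
    [DecidableEq ε'] [DecidableEq V] [AddCommMonoid M]
    (A : ε → Finset V) (B : ε' → Finset V) (g : (ε → V) → (ε' → V) → M) :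
    ∑ τ ∈ Fintype.piFinset A, ∑ θ ∈ Fintype.piFinset B, g τ θ =
      ∑ τ ∈ Fintype.piFinset (Sum.elim A B), g (fun e => τ (.inl e)) fun e => τ (.inr e) := by
  rw [← Finset.sum_product']
  refine Finset.sum_equiv (Equiv.sumArrowEquivProdArrow _ _ _).symm ?_ ?_
  · rintro ⟨τ, θ⟩
    simp [Fintype.mem_piFinset]
  · rintro ⟨τ, θ⟩ _
    rfl

/-- The indices on the edges of the expansion of a Leibniz graph. -/
def expandLabels {l : ℕ} {X : Type*} (c : Fin l → Fin 3) (K : Fin l → Fin 3 → X) (r : Fin l → X) :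
    Fin (l * 2) → Fin 2 → X := fun u =>
  if (finProdFinEquiv.symm u).2 = 0 then
    ![K (finProdFinEquiv.symm u).1 (c (finProdFinEquiv.symm u).1),
      K (finProdFinEquiv.symm u).1 (c (finProdFinEquiv.symm u).1 + 1)]
  else ![r (finProdFinEquiv.symm u).1,
    K (finProdFinEquiv.symm u).1 (c (finProdFinEquiv.symm u).1 + 2)]

/-- Since `c`, `c + 1`, `c + 2` exhaust `Fin 3`, the four labels in a split Jacobiator are its three
outer labels and one label `r` for the edge between its two halves. This holds for every choice of
the cyclic permutations, with no constraint relating the labels. -/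
lemma expandLabels_bijective {l : ℕ} {X : Type*} (c : Fin l → Fin 3) :
    Function.Bijective fun p : (Fin l → Fin 3 → X) × (Fin l → X) => expandLabels c p.1 p.2 := by
  have h3 : ∀ c i : Fin 3, i = c ∨ i = c + 1 ∨ i = c + 2 := by decide
  have h01 : ∀ c : Fin 3, c + 1 ≠ c ∧ c + 2 ≠ c ∧ c + 2 ≠ c + 1 := by decide
  constructor
  · rintro ⟨K, r⟩ ⟨K', r'⟩ h
    have h0 := fun j => congrFun (congrFun h (finProdFinEquiv (j, 0))) 0
    have h1 := fun j => congrFun (congrFun h (finProdFinEquiv (j, 0))) 1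
    have h2 := fun j => congrFun (congrFun h (finProdFinEquiv (j, 1))) 0
    have h4 := fun j => congrFun (congrFun h (finProdFinEquiv (j, 1))) 1
    simp only [expandLabels, Equiv.symm_apply_apply] at h0 h1 h2 h4
    refine Prod.ext (funext fun j => funext fun i => ?_) (funext h2)
    rcases h3 (c j) i with rfl | rfl | rfl
    · exact h0 j
    · exact h1 j
    · exact h4 j
  · intro I
    refine ⟨⟨fun j i => if i = c j then I (finProdFinEquiv (j, 0)) 0
      else if i = c j + 1 then I (finProdFinEquiv (j, 0)) 1 else I (finProdFinEquiv (j, 1)) 1,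
      fun j => I (finProdFinEquiv (j, 1)) 0⟩, ?_⟩
    funext u
    obtain ⟨⟨j, e⟩, rfl⟩ := finProdFinEquiv.surjective u
    funext a
    fin_cases e <;> fin_cases a <;> simp [expandLabels, h01]

/-- The expanded Jacobiators have their former outgoing edges and, in addition, one internal edge
each. -/
lemma edgeM₂_expandLabels {l : ℕ} {V : Type} [DecidableEq V] (c : Fin l → Fin 3)
    (θ : Fin l → Fin 3 → V) (a : Fin l → V) (K : Fin l → Fin 3 → Fin d) (r : Fin l → Fin d)
    (y : V) : edgeM₂ (expandLabels c θ a) (expandLabels c K r) y =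
      edgeM₂ θ K y + edgeM a r y := by
  have h3 : ∀ (c : Fin 3) (g : Fin 3 → Multiset (Fin d)),
      ∑ i, g i = g c + g (c + 1) + g (c + 2) := by
    intro c g
    fin_cases c
    · exact Fin.sum_univ_three g
    · rw [Fin.sum_univ_three]; change _ = g 1 + g 2 + g 0; abel
    · rw [Fin.sum_univ_three]; change _ = g 2 + g 0 + g 1; abel
  simp only [edgeM₂, edgeM, Fintype.sum_prod_type]
  rw [← Finset.sum_add_distrib, ← Equiv.sum_comp finProdFinEquiv, Fintype.sum_prod_type]
  refine Finset.sum_congr rfl fun j _ => ?_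
  rw [h3 (c j)]
  simp [expandLabels, Fin.sum_univ_two]
  abel

lemma jacobiator_eq (P : Fin d → Fin d → (Fin d → ℝ) → ℝ) (K : Fin 3 → Fin d) (y : Fin d → ℝ) :
    jacobiator P (K 0) (K 1) (K 2) y = ∑ c : Fin 3, ∑ r,
      pderiv' r (P (K c) (K (c + 1))) y * P r (K (c + 2)) y := by
  rw [jacobiator, Fin.sum_univ_three, ← Finset.sum_add_distrib, ← Finset.sum_add_distrib]
  rfl

/-- The functions in the vertices of a Leibniz graph whose edges carry the indices `I`, `K`. -/
def leibnizContent {m b l d : ℕ} (P : Fin d → Fin d → (Fin d → ℝ) → ℝ)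
    (J : Fin d → Fin d → Fin d → (Fin d → ℝ) → ℝ) (f : Fin m → (Fin d → ℝ) → ℝ)
    (I : Fin b → Fin 2 → Fin d) (K : Fin l → Fin 3 → Fin d) :
    Fin m ⊕ (Fin b ⊕ Fin l) → (Fin d → ℝ) → ℝ :=
  Sum.elim f (Sum.elim (fun v => P (I v 0) (I v 1)) fun j => J (K j 0) (K j 1) (K j 2))

lemma LeibnizGraph.localOp_eq {J : Fin d → Fin d → Fin d → (Fin d → ℝ) → ℝ}
    (hU : IsOpen U) (hP : ∀ i j, ContDiffOn ℝ ∞ (P i j) U)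
    (hJ : ∀ i j k, ContDiffOn ℝ ∞ (J i j k) U)
    (hf : ∀ s, ContDiffOn ℝ ∞ (f s) U) (hx : x ∈ U) (Λ : LeibnizGraph m) :
    Λ.localOp P J f x = ∑ I : Fin Λ.b → Fin 2 → Fin d, ∑ K : Fin Λ.l → Fin 3 → Fin d,
      ∏ y, pdM (edgeM₂ Λ.wedge I y + edgeM₂ Λ.jac K y) (leibnizContent P J f I K y) x := by
  refine Finset.sum_congr rfl fun I _ => Finset.sum_congr rfl fun K _ => ?_
  rw [Fintype.prod_sum_type, Fintype.prod_sum_type, mul_comm]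
  congr 1
  · refine Finset.prod_congr rfl fun s _ => ?_
    rw [pderivs_eq_pdM hU (hf s) _ hx, ← Multiset.coe_add, coe_edgeLabels, coe_edgeLabels]; rfl
  congr 1
  · refine Finset.prod_congr rfl fun s _ => ?_
    rw [pderivs_eq_pdM hU (hP _ _) _ hx, ← Multiset.coe_add, coe_edgeLabels, coe_edgeLabels]; rfl
  · refine Finset.prod_congr rfl fun s _ => ?_
    rw [pderivs_eq_pdM hU (hJ _ _ _) _ hx, ← Multiset.coe_add, coe_edgeLabels, coe_edgeLabels]; rfl

lemma contDiffOn_jacobiator (hU : IsOpen U) (hP : ∀ i j, ContDiffOn ℝ ∞ (P i j) U) (i j k : Fin d) :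
    ContDiffOn ℝ ∞ (jacobiator P i j k) U :=
  ContDiffOn.sum fun _ _ => ((((hP _ _).pderiv' hU _).mul (hP _ _)).add
    (((hP _ _).pderiv' hU _).mul (hP _ _))).add (((hP _ _).pderiv' hU _).mul (hP _ _))

/-- The Jacobiator is a sum over cyclic permutations and one internal index of products of two
functions. Edges that fall on it choose one of the two by the Leibniz rule, and this is exactly how
the expansion of graphs is defined. -/
lemma LeibnizGraph.localOp_expand (hU : IsOpen U) (hP : ∀ i j, ContDiffOn ℝ ∞ (P i j) U)
    (hf : ∀ s, ContDiffOn ℝ ∞ (f s) U) (hx : x ∈ U) (Λ : LeibnizGraph m) :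
    Λ.localOp P (jacobiator P) f x =
    ∑ c : Fin Λ.l → Fin 3,
      ∑ τ ∈ Fintype.piFinset (fun v => Fintype.piFinset fun i => Λ.targets (Λ.wedge v i)),
        ∑ θ ∈ Fintype.piFinset (fun j => Fintype.piFinset fun i => Λ.targets (Λ.jac j i)),
          KGraph.localOp ⟨Λ.b + Λ.l * 2,
            Fin.append τ (expandLabels c θ fun j => Λ.jacVertex j 0)⟩ P f x := by
  rw [Λ.localOp_eq hU hP (contDiffOn_jacobiator hU hP) hf hx]
  -- The factors before the remaining edges act: the internal edge of every Jacobiator, labelled by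
  -- `r`, has already differentiated the first half.
  let F (I : Fin Λ.b → Fin 2 → Fin d) (K : Fin Λ.l → Fin 3 → Fin d)
      (c : Fin Λ.l → Fin 3) (r : Fin Λ.l → Fin d) (w : Fin m ⊕ Fin (Λ.b + Λ.l * 2)) :
      (Fin d → ℝ) → ℝ :=
    pdM (edgeM (fun j => Λ.jacVertex j 0) r w)
      (vertexContent P f (Fin.append I (expandLabels c K r)) w)
  have hF : ∀ I K c r w, ContDiffOn ℝ ∞ (F I K c r w) U := fun I K c r w =>
    (contDiffOn_vertexContent hP hf _ w).pdM hU _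
  have hE0 : ∀ (r : Fin Λ.l → Fin d) w, (∀ j, Λ.jacVertex j 0 ≠ w) →
      edgeM (fun j => Λ.jacVertex j 0) r w = 0 := by
    intro r w h
    simp [edgeM, h]
  have hfib_s : ∀ I K c r s, (fun y => ∏ w with Λ.proj w = .inl s, F I K c r w y) = f s := by
    intro I K c r s
    funext y
    rw [← targets_eq, targets, Finset.prod_singleton]
    simp only [F]
    rw [hE0 _ _ (by simp [jacVertex])]
    simp [vertexContent]
  have hfib_w : ∀ I K c r v, (fun y => ∏ w with Λ.proj w = .inr (.inl v), F I K c r w y) =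
      P (I v 0) (I v 1) := by
    intro I K c r v
    funext y
    rw [← targets_eq, targets, Finset.prod_singleton]
    simp only [F]
    rw [hE0 _ _ (by simp [jacVertex, Fin.ext_iff]; omega)]
    simp [vertexContent]
  have hinj : ∀ j, Function.Injective (Λ.jacVertex j) := by
    intro j e e' h
    simpa [jacVertex] using h
  have hfib_j : ∀ I K c r j, (fun y => ∏ w with Λ.proj w = .inr (.inr j), F I K c r w y) =
      fun y => pderiv' (r j) (P (K j (c j)) (K j (c j + 1))) y * P (r j) (K j (c j + 2)) y := by
    intro I K c r j
    funext y
    rw [← targets_eq, targets, Finset.prod_image (hinj j).injOn, Fin.prod_univ_two]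
    congr 1
    · simp only [F]
      have : edgeM (fun j => Λ.jacVertex j 0) r (Λ.jacVertex j 0) = {r j} := by
        simp [edgeM, jacVertex]
      rw [this, pdM_singleton]
      simp [vertexContent, jacVertex, expandLabels]
    · simp only [F]
      rw [hE0 _ _ (by simp [jacVertex])]
      simp [vertexContent, jacVertex, expandLabels]
  have hjac : ∀ (I : Fin Λ.b → Fin 2 → Fin d) (K : Fin Λ.l → Fin 3 → Fin d),
      ∏ z, pdM (edgeM₂ Λ.wedge I z + edgeM₂ Λ.jac K z)
        (leibnizContent P (jacobiator P) f I K z) x =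
      ∑ c : Fin Λ.l → Fin 3, ∑ r : Fin Λ.l → Fin d,
        ∏ z, pdM (edgeM₂ Λ.wedge I z + edgeM₂ Λ.jac K z)
          (fun y => ∏ w with Λ.proj w = z, F I K c r w y) x := by
    intro I K
    have h1 : ∀ j, pdM (edgeM₂ Λ.wedge I (.inr (.inr j)) + edgeM₂ Λ.jac K (.inr (.inr j)))
        (leibnizContent P (jacobiator P) f I K (.inr (.inr j))) x =
        ∑ q : Fin 3 × Fin d,
          pdM (edgeM₂ Λ.wedge I (.inr (.inr j)) + edgeM₂ Λ.jac K (.inr (.inr j)))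
            (fun y => pderiv' q.2 (P (K j q.1) (K j (q.1 + 1))) y * P q.2 (K j (q.1 + 2)) y) x := by
      intro j
      have : leibnizContent P (jacobiator P) f I K (.inr (.inr j)) = fun y => ∑ q : Fin 3 × Fin d,
          pderiv' q.2 (P (K j q.1) (K j (q.1 + 1))) y * P q.2 (K j (q.1 + 2)) y := by
        funext y
        rw [Fintype.sum_prod_type, ← jacobiator_eq]; rfl
      rw [this]
      exact pdM_sum hU _ (fun q _ => ((hP _ _).pderiv' hU _).mul (hP _ _)) _ hx
    -- The product over the Jacobiators of sums over a permutation and an index becomes a sum over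
    -- independent choices `c` and `r` for all of them.
    rw [Fintype.prod_sum_type, Fintype.prod_sum_type, Finset.prod_congr rfl fun j _ => h1 j,
      Finset.prod_univ_sum, Fintype.piFinset_univ, Finset.mul_sum, Finset.mul_sum,
      ← Equiv.sum_comp (Equiv.arrowProdEquivProdArrow (Fin Λ.l) (fun _ => Fin 3)
        fun _ => Fin d).symm, Fintype.sum_prod_type]
    refine Finset.sum_congr rfl fun c _ => Finset.sum_congr rfl fun r _ => ?_
    rw [Fintype.prod_sum_type, Fintype.prod_sum_type]
    simp only [hfib_s, hfib_w, hfib_j]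
    rfl
  simp only [hjac]
  have hE : ∀ {Y : Type} [DecidableEq Y] (t : Fin Λ.b → Fin 2 → Y) (t' : Fin Λ.l → Fin 3 → Y)
      (I : Fin Λ.b → Fin 2 → Fin d) (K : Fin Λ.l → Fin 3 → Fin d) (y : Y),
      edgeM₂ t I y + edgeM₂ t' K y = edgeM
        (Sum.elim (fun e : Fin Λ.b × Fin 2 => t e.1 e.2) (fun e : Fin Λ.l × Fin 3 => t' e.1 e.2))
        (Sum.elim (fun e : Fin Λ.b × Fin 2 => I e.1 e.2) (fun e : Fin Λ.l × Fin 3 => K e.1 e.2)) y := by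
    intro Y _ t t' I K y
    simp only [edgeM, Fintype.sum_sum_type]; rfl
  have hL : ∀ I K c r, ∏ z, pdM (edgeM₂ Λ.wedge I z + edgeM₂ Λ.jac K z)
          (fun y => ∏ w with Λ.proj w = z, F I K c r w y) x =
      ∑ τ ∈ Fintype.piFinset (fun v => Fintype.piFinset fun i => Λ.targets (Λ.wedge v i)),
        ∑ θ ∈ Fintype.piFinset (fun j => Fintype.piFinset fun i => Λ.targets (Λ.jac j i)),
          ∏ w, pdM (edgeM₂ (Fin.append τ (expandLabels c θ fun j => Λ.jacVertex j 0))
            (Fin.append I (expandLabels c K r)) w)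
            (vertexContent P f (Fin.append I (expandLabels c K r)) w) x := by
    intro I K c r
    simp only [hE]
    rw [prod_pdM_prod hU _ _ _ _ (hF I K c r) hx]
    simp only [sum_piFinset_curry]
    rw [sum_piFinset_sum]
    refine Finset.sum_congr ?_ fun τ _ => Finset.prod_congr rfl fun w _ => ?_
    · congr 1
      funext e
      rcases e with e | e <;> ext w <;> simp only [Sum.elim_inl, Sum.elim_inr, targets_eq] <;>
        exact ⟨fun h => Finset.mem_filter.2 ⟨Finset.mem_univ _, (Finset.mem_filter.1 h).2⟩,
          fun h => Finset.mem_filter.2 ⟨Finset.mem_univ _, (Finset.mem_filter.1 h).2⟩⟩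
    · rw [edgeM₂_append, edgeM₂_expandLabels, ← add_assoc, hE,
        pdM_add hU (contDiffOn_vertexContent hP hf _ w) _ _ hx]
      simp only [F]
      congr 2
      funext e
      rcases e with e | e <;> rfl
  simp only [hL]
  have hR : ∀ c τ θ, KGraph.localOp ⟨Λ.b + Λ.l * 2,
            Fin.append τ (expandLabels c θ fun j => Λ.jacVertex j 0)⟩ P f x =
      ∑ I : Fin Λ.b → Fin 2 → Fin d, ∑ K : Fin Λ.l → Fin 3 → Fin d, ∑ r : Fin Λ.l → Fin d,
          ∏ w, pdM (edgeM₂ (Fin.append τ (expandLabels c θ fun j => Λ.jacVertex j 0))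
            (Fin.append I (expandLabels c K r)) w)
            (vertexContent P f (Fin.append I (expandLabels c K r)) w) x := by
    intro c τ θ
    rw [KGraph.localOp_eq hU hP hf hx, ← Equiv.sum_comp (Fin.appendEquiv Λ.b (Λ.l * 2)),
      Fintype.sum_prod_type]
    refine Finset.sum_congr rfl fun I _ => ?_
    rw [← Fintype.sum_prod_type' (f := fun K r => ∏ w, pdM (edgeM₂ (Fin.append τ
      (expandLabels c θ fun j => Λ.jacVertex j 0)) (Fin.append I (expandLabels c K r)) w)
            (vertexContent P f (Fin.append I (expandLabels c K r)) w) x)]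
    exact (Function.Bijective.sum_comp (expandLabels_bijective c) fun I' => ∏ w, pdM (edgeM₂ (Fin.append τ
      (expandLabels c θ fun j => Λ.jacVertex j 0)) (Fin.append I I') w)
            (vertexContent P f (Fin.append I I') w) x).symm
  simp only [hR]
  simp_rw [Finset.sum_comm (t := (Finset.univ : Finset (Fin Λ.l → Fin 3)))]
  refine Finset.sum_congr rfl fun c _ => ?_
  simp_rw [Finset.sum_comm (s := Finset.univ) (t := Fintype.piFinset _)]

end LocalOperators

/-! ### Independence of affine coordinates -/

section Affine

variable {d m : ℕ} {U V : Set (Fin d → ℝ)} {L : (Fin d → ℝ) →L[ℝ] (Fin d → ℝ)} {c : Fin d → ℝ}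

/-- The entries of the matrix of `L` are constants. Further derivatives do not see them, and this is
why affine changes of coordinates are admissible where general ones are not. -/
lemma pderiv'_comp_affine (hV : IsOpen V) (hUV : ∀ y ∈ U, L y + c ∈ V)
    {G : (Fin d → ℝ) → ℝ} (hG : ContDiffOn ℝ ∞ G V) (a : Fin d) :
    Set.EqOn (pderiv' a fun y => G (L y + c))
      (fun y => ∑ i, L (Pi.single a 1) i * pderiv' i G (L y + c)) U := fun x hx => by
  have hA : HasFDerivAt (fun y => L y + c) L x := L.hasFDerivAt.add_const c
  have hd := (hG.differentiableAt_of_isOpen hV (hUV x hx)).hasFDerivAt.comp x hA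
  have : fderiv ℝ (fun y => G (L y + c)) x = (fderiv ℝ G (L x + c)).comp L := hd.fderiv
  simp only [pderiv', this, ContinuousLinearMap.comp_apply]
  conv_lhs => rw [pi_eq_sum_univ' (L (Pi.single a 1))]
  rw [map_sum]
  refine Finset.sum_congr rfl fun i _ => ?_
  rw [map_smul, smul_eq_mul]

lemma contDiffOn_comp_affine (hUV : ∀ y ∈ U, L y + c ∈ V) {G : (Fin d → ℝ) → ℝ}
    (hG : ContDiffOn ℝ ∞ G V) : ContDiffOn ℝ ∞ (fun y => G (L y + c)) U :=
  hG.comp (L.contDiff.add contDiff_const).contDiffOn hUV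

/-- The chain rule, one edge at a time: an edge with the old label `I e` acquires a new label `K e`
and the corresponding matrix entry. -/
lemma prod_pdM_comp_affine {Y : Type} [Fintype Y] [DecidableEq Y] (hU : IsOpen U) (hV : IsOpen V)
    (hUV : ∀ y ∈ U, L y + c ∈ V) {x : Fin d → ℝ} (hx : x ∈ U) (n : ℕ) (t : Fin n → Y)
    (I : Fin n → Fin d) (G : Y → (Fin d → ℝ) → ℝ) (hG : ∀ y, ContDiffOn ℝ ∞ (G y) V) :
    ∏ y, pdM (edgeM t I y) (fun z => G y (L z + c)) x =
      ∑ K : Fin n → Fin d, (∏ e, L (Pi.single (I e) 1) (K e)) *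
        ∏ y, pdM (edgeM t K y) (G y) (L x + c) := by
  induction n generalizing G with
  | zero => simp [edgeM]
  | succ n ih =>
    have hE : ∀ (I : Fin (n + 1) → Fin d) (y : Y), edgeM t I y =
        edgeM (fun e => t (Fin.succ e)) (fun e => I (Fin.succ e)) y +
          if t 0 = y then {I 0} else 0 := by
      intro I y; rw [edgeM, Fin.sum_univ_succ, add_comm]; rfl
    have hupd : ∀ i y, ContDiffOn ℝ ∞ (Function.update G (t 0) (pderiv' i (G (t 0))) y) V := by
      intro i y
      by_cases h : y = t 0
      · subst h; rw [Function.update_self]; exact (hG _).pderiv' hV _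
      · rw [Function.update_of_ne h]; exact hG _
    have h0 : pdM (edgeM t I (t 0)) (fun z => G (t 0) (L z + c)) x =
        ∑ i, L (Pi.single (I 0) 1) i *
          pdM (edgeM (fun e => t (Fin.succ e)) (fun e => I (Fin.succ e)) (t 0))
            (fun z => pderiv' i (G (t 0)) (L z + c)) x := by
      have hs : ∀ i, ContDiffOn ℝ ∞ (fun z => pderiv' i (G (t 0)) (L z + c)) U := fun i =>
        contDiffOn_comp_affine hUV ((hG _).pderiv' hV i)
      rw [hE, if_pos rfl, pdM_add hU (contDiffOn_comp_affine hUV (hG _)) _ _ hx, pdM_singleton,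
        (pderiv'_comp_affine hV hUV (hG _) (I 0)).pdM hU _ hx,
        pdM_sum hU _ (fun i _ => contDiffOn_const.mul (hs i)) _ hx]
      exact Finset.sum_congr rfl fun i _ => pdM_const_mul _ hU (hs i) _ hx
    rw [← Finset.mul_prod_erase _ _ (Finset.mem_univ (t 0)), h0, Finset.sum_mul]
    have h1 : ∀ i, L (Pi.single (I 0) 1) i *
          pdM (edgeM (fun e => t (Fin.succ e)) (fun e => I (Fin.succ e)) (t 0))
            (fun z => pderiv' i (G (t 0)) (L z + c)) x *
        ∏ y ∈ Finset.univ.erase (t 0), pdM (edgeM t I y) (fun z => G y (L z + c)) x =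
        L (Pi.single (I 0) 1) i *
        ∑ K : Fin n → Fin d, (∏ e, L (Pi.single (I (Fin.succ e)) 1) (K e)) *
          ∏ y, pdM (edgeM t (Fin.cons i K : Fin (n + 1) → Fin d) y) (G y) (L x + c) := by
      intro i
      have h2 := ih (fun e => t (Fin.succ e)) (fun e => I (Fin.succ e)) _ (hupd i)
      rw [← Finset.mul_prod_erase _ _ (Finset.mem_univ (t 0)), Function.update_self] at h2
      rw [mul_assoc]
      congr 1
      refine Eq.trans ?_ (h2.trans ?_)
      · congr 1
        refine Finset.prod_congr rfl fun y hy => ?_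
        have hy' := Finset.ne_of_mem_erase hy
        rw [hE, if_neg (Ne.symm hy'), add_zero, Function.update_of_ne hy']
      · refine Finset.sum_congr rfl fun K _ => ?_
        congr 1
        refine Finset.prod_congr rfl fun y _ => ?_
        rw [hE]
        simp only [Fin.cons_succ, Fin.cons_zero]
        by_cases h : t 0 = y
        · subst h
          rw [if_pos rfl, pdM_add hV (hG _) _ _ (hUV x hx), pdM_singleton, Function.update_self]
        · rw [if_neg h, add_zero, Function.update_of_ne (Ne.symm h)]
    rw [Finset.sum_congr rfl fun i _ => h1 i,
      ← Equiv.sum_comp (Fin.consEquiv fun _ => Fin d), Fintype.sum_prod_type]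
    refine Finset.sum_congr rfl fun i _ => ?_
    rw [Finset.mul_sum]
    refine Finset.sum_congr rfl fun K _ => ?_
    rw [← mul_assoc, Fin.prod_univ_succ]
    rfl

lemma prod_pdM_comp_affine₂ {Y : Type} [Fintype Y] [DecidableEq Y] (hU : IsOpen U) (hV : IsOpen V)
    (hUV : ∀ y ∈ U, L y + c ∈ V) {x : Fin d → ℝ} (hx : x ∈ U) {n r : ℕ} (t : Fin n → Fin r → Y)
    (I : Fin n → Fin r → Fin d) (G : Y → (Fin d → ℝ) → ℝ) (hG : ∀ y, ContDiffOn ℝ ∞ (G y) V) :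
    ∏ y, pdM (edgeM₂ t I y) (fun z => G y (L z + c)) x =
      ∑ K : Fin n → Fin r → Fin d, (∏ v, ∏ j, L (Pi.single (I v j) 1) (K v j)) *
        ∏ y, pdM (edgeM₂ t K y) (G y) (L x + c) := by
  let q : Fin (n * r) ≃ Fin n × Fin r := finProdFinEquiv.symm
  have h := prod_pdM_comp_affine hU hV hUV hx (n * r) ((fun e : Fin n × Fin r => t e.1 e.2) ∘ q)
    ((fun e : Fin n × Fin r => I e.1 e.2) ∘ q) G hG
  simp only [edgeM_equiv] at h
  refine h.trans ?_
  rw [← Equiv.sum_comp ((Equiv.curry (Fin n) (Fin r) (Fin d)).symm.trans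
    (Equiv.arrowCongr q.symm (Equiv.refl _)))]
  refine Finset.sum_congr rfl fun K _ => ?_
  congr 1
  · rw [← Fintype.prod_prod_type' (f := fun v j => L (Pi.single (I v j) 1) (K v j)),
      ← Equiv.prod_comp q]
    rfl
  · refine Finset.prod_congr rfl fun y _ => ?_
    rw [edgeM₂, ← edgeM_equiv q (fun e : Fin n × Fin r => t e.1 e.2)]
    rfl

/-- The polydifferential operator of a graph does not depend on the affine coordinates. -/
theorem KGraph.localOp_affine (hU : IsOpen U) (hV : IsOpen V) (hUV : ∀ y ∈ U, L y + c ∈ V)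
    {x : Fin d → ℝ} (hx : x ∈ U) {M : Fin d → Fin d → ℝ}
    (hLM : ∀ i j, ∑ a, L (Pi.single a 1) i * M a j = if i = j then 1 else 0)
    {P Q : Fin d → Fin d → (Fin d → ℝ) → ℝ} (hP : ∀ i j, ContDiffOn ℝ ∞ (P i j) U)
    (hQ : ∀ i j, ContDiffOn ℝ ∞ (Q i j) V)
    (hPQ : ∀ a b, ∀ y ∈ U, P a b y = ∑ i, ∑ j, M a i * M b j * Q i j (L y + c))
    {f g : Fin m → (Fin d → ℝ) → ℝ} (hf : ∀ s, ContDiffOn ℝ ∞ (f s) U)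
    (hg : ∀ s, ContDiffOn ℝ ∞ (g s) V) (hfg : ∀ s, ∀ y ∈ U, f s y = g s (L y + c))
    (Γ : KGraph m) : Γ.localOp P f x = Γ.localOp Q g (L x + c) := by
  rw [Γ.localOp_eq hU hP hf hx, Γ.localOp_eq hV hQ hg (hUV x hx)]
  -- The tails of the edges: every bi-vector is expressed in the new coordinates by two copies of
  -- `M`.
  have h1 : ∀ I : Fin Γ.n → Fin 2 → Fin d,
      ∏ y, pdM (edgeM₂ Γ.tgt I y) (vertexContent P f I y) x =
      ∑ K : Fin Γ.n → Fin 2 → Fin d, (∏ v, ∏ j, M (I v j) (K v j)) *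
        ∏ y, pdM (edgeM₂ Γ.tgt I y) (fun z => vertexContent Q g K y (L z + c)) x := by
    intro I
    have hs : ∀ s, pdM (edgeM₂ Γ.tgt I (.inl s)) (vertexContent P f I (.inl s)) x =
        pdM (edgeM₂ Γ.tgt I (.inl s)) (fun z => g s (L z + c)) x := fun s =>
      Set.EqOn.pdM hU (fun y hy => hfg s y hy) _ hx
    have hv : ∀ v, pdM (edgeM₂ Γ.tgt I (.inr v)) (vertexContent P f I (.inr v)) x =
        ∑ k : Fin 2 → Fin d, (∏ j, M (I v j) (k j)) *
          pdM (edgeM₂ Γ.tgt I (.inr v)) (fun z => Q (k 0) (k 1) (L z + c)) x := by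
      intro v
      have he : Set.EqOn (vertexContent P f I (.inr v))
          (fun y => ∑ k : Fin 2 → Fin d, (∏ j, M (I v j) (k j)) * Q (k 0) (k 1) (L y + c)) U := by
        intro y hy
        simp only [vertexContent, Sum.elim_inr]
        rw [hPQ _ _ y hy, ← Equiv.sum_comp (finTwoArrowEquiv (Fin d)).symm, Fintype.sum_prod_type]
        simp [Fin.prod_univ_two]
      have hQ' : ∀ k : Fin 2 → Fin d, ContDiffOn ℝ ∞ (fun y => Q (k 0) (k 1) (L y + c)) U :=
        fun k => contDiffOn_comp_affine hUV (hQ _ _)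
      rw [he.pdM hU _ hx, pdM_sum hU _ (fun k _ => contDiffOn_const.mul (hQ' k)) _ hx]
      exact Finset.sum_congr rfl fun k _ => pdM_const_mul _ hU (hQ' k) _ hx
    rw [Fintype.prod_sum_type, Finset.prod_congr rfl fun s _ => hs s,
      Finset.prod_congr rfl fun v _ => hv v, Finset.prod_univ_sum, Fintype.piFinset_univ,
      Finset.mul_sum]
    refine Finset.sum_congr rfl fun K _ => ?_
    rw [Finset.prod_mul_distrib, Fintype.prod_sum_type, mul_left_comm]
    rfl
  -- The heads of the edges: every derivative is expressed in the new coordinates by a copy of `L`.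
  have h2 : ∀ I K : Fin Γ.n → Fin 2 → Fin d,
      ∏ y, pdM (edgeM₂ Γ.tgt I y) (fun z => vertexContent Q g K y (L z + c)) x =
      ∑ R : Fin Γ.n → Fin 2 → Fin d, (∏ v, ∏ j, L (Pi.single (I v j) 1) (R v j)) *
        ∏ y, pdM (edgeM₂ Γ.tgt R y) (vertexContent Q g K y) (L x + c) := fun I K =>
    prod_pdM_comp_affine₂ hU hV hUV hx _ I _ fun y => contDiffOn_vertexContent hQ hg K y
  -- Summing over the old labels contracts `L` with its inverse on each edge separately, which
  -- forces the new labels at head and tail to coincide.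
  have h3 : ∀ K R : Fin Γ.n → Fin 2 → Fin d, ∑ I : Fin Γ.n → Fin 2 → Fin d,
      (∏ v, ∏ j, M (I v j) (K v j)) * (∏ v, ∏ j, L (Pi.single (I v j) 1) (R v j)) =
      if R = K then 1 else 0 := by
    intro K R
    have : ∀ v, ∑ k : Fin 2 → Fin d, ∏ j, (L (Pi.single (k j) 1) (R v j) * M (k j) (K v j)) =
        ∏ j, if R v j = K v j then 1 else 0 := by
      intro v
      rw [← Fintype.piFinset_univ, ← Finset.prod_univ_sum (fun _ => Finset.univ)
        fun j a => L (Pi.single a 1) (R v j) * M a (K v j)]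
      exact Finset.prod_congr rfl fun j _ => hLM _ _
    have h4 : ∏ v, ∑ k : Fin 2 → Fin d,
        ∏ j, (L (Pi.single (k j) 1) (R v j) * M (k j) (K v j)) = if R = K then 1 else 0 := by
      rw [Finset.prod_congr rfl fun v _ => this v]
      by_cases h : R = K
      · simp [h]
      · rw [if_neg h]
        obtain ⟨v, hv⟩ := Function.ne_iff.1 h
        obtain ⟨j, hj⟩ := Function.ne_iff.1 hv
        exact Finset.prod_eq_zero (Finset.mem_univ v)
          (Finset.prod_eq_zero (Finset.mem_univ j) (if_neg hj))
    rw [← h4, Finset.prod_univ_sum, Fintype.piFinset_univ]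
    refine Finset.sum_congr rfl fun I _ => ?_
    simp only [Finset.prod_mul_distrib]
    rw [mul_comm]
  simp only [h1, h2, Finset.mul_sum, ← mul_assoc]
  rw [Finset.sum_comm]
  refine Finset.sum_congr rfl fun K _ => ?_
  rw [Finset.sum_comm]
  simp only [← Finset.sum_mul, h3]
  simp

end Affine

/-! ### Operators on affine manifolds, computed in an arbitrary chart -/

section Manifold

variable {d m : ℕ} {N : Type*} [TopologicalSpace N] [ChartedSpace (Fin d → ℝ) N]

lemma affineMap_apply_eq (A : (Fin d → ℝ) →ᵃ[ℝ] (Fin d → ℝ)) (y : Fin d → ℝ) :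
    A y = LinearMap.toContinuousLinearMap A.linear y + A 0 := by
  have := congrFun A.decomp y
  simpa using this

lemma hasFDerivAt_affineMap (A : (Fin d → ℝ) →ᵃ[ℝ] (Fin d → ℝ)) (y : Fin d → ℝ) :
    HasFDerivAt A (LinearMap.toContinuousLinearMap A.linear) y := by
  have h : (A : (Fin d → ℝ) → (Fin d → ℝ)) =
      fun y => LinearMap.toContinuousLinearMap A.linear y + A 0 :=
    funext (affineMap_apply_eq A)
  rw [h]
  exact (ContinuousLinearMap.hasFDerivAt _).add_const _

/-- Near `x` both changes of coordinates agree with affine maps `A` and `B`, so the claim reduces to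
`KGraph.localOp_affine` on a small neighbourhood `U` of `φ x`. -/
theorem KGraph.localOp_chart [AffineManifold d N] (P : Bivector d N) {f : Fin m → N → ℝ}
    (hf : ∀ s, SmoothFun d (f s)) (Γ : KGraph m) {φ ψ : OpenPartialHomeomorph N (Fin d → ℝ)}
    (hφ : φ ∈ atlas (Fin d → ℝ) N) (hψ : ψ ∈ atlas (Fin d → ℝ) N) {x : N}
    (hx : x ∈ φ.source ∩ ψ.source) :
    Γ.localOp (P.comp φ) (fun s => f s ∘ φ.symm) (φ x) =
      Γ.localOp (P.comp ψ) (fun s => f s ∘ ψ.symm) (ψ x) := by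
  obtain ⟨A, hA⟩ := AffineManifold.locally_affine φ hφ ψ hψ x hx
  obtain ⟨B, hB⟩ := AffineManifold.locally_affine ψ hψ φ hφ x hx.symm
  have hφx := φ.map_source hx.1
  have hψx := ψ.map_source hx.2
  have hcφ : Filter.Tendsto φ.symm (nhds (φ x)) (nhds x) := by
    have := φ.continuousAt_symm hφx
    rwa [ContinuousAt, φ.left_inv hx.1] at this
  have hcψ : Filter.Tendsto ψ.symm (nhds (ψ x)) (nhds x) := by
    have := ψ.continuousAt_symm hψx
    rwa [ContinuousAt, ψ.left_inv hx.2] at this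
  -- The law of transformation of the bi-vector at a point near `x` contains derivatives of the
  -- change of coordinates there; so the identity with `B` is needed on a neighbourhood of each
  -- nearby point.
  have h4 : ∀ᶠ y in nhds (φ x), ∀ᶠ w in nhds (ψ (φ.symm y)), φ (ψ.symm w) = B w :=
    ((ψ.continuousAt hx.2).tendsto.comp hcφ).eventually (eventually_eventually_nhds.2 hB)
  have h1 : ∀ᶠ y in nhds (φ x), y ∈ φ.target := φ.open_target.mem_nhds hφx
  have h2 : ∀ᶠ y in nhds (φ x), φ.symm y ∈ ψ.source :=
    hcφ.eventually (ψ.open_source.mem_nhds hx.2)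
  obtain ⟨U, hU, hUo, hxU⟩ := eventually_nhds_iff.1 (h1.and (h2.and (hA.and h4)))
  -- By uniqueness of the derivative, since `A ∘ B` is the identity near `ψ x`.
  have hAB : (LinearMap.toContinuousLinearMap A.linear).comp
      (LinearMap.toContinuousLinearMap B.linear) = ContinuousLinearMap.id ℝ (Fin d → ℝ) := by
    have he : (fun w => A (B w)) =ᶠ[nhds (ψ x)] id := by
      filter_upwards [hB, ((φ.continuousAt hx.1).tendsto.comp hcψ).eventually hA,
        hcψ.eventually (φ.open_source.mem_nhds hx.1), ψ.open_target.mem_nhds hψx] with w h1 h2 h3 h4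
      rw [← h1]
      simp only [Function.comp] at h2
      rw [← h2, φ.left_inv h3, ψ.right_inv h4]; rfl
    exact ((hasFDerivAt_affineMap A _).comp (ψ x) (hasFDerivAt_affineMap B (ψ x))).unique
      ((hasFDerivAt_id _).congr_of_eventuallyEq he)
  have hAx : ψ x = LinearMap.toContinuousLinearMap A.linear (φ x) + A 0 := by
    rw [← affineMap_apply_eq, ← (hU _ hxU).2.2.1, φ.left_inv hx.1]
  rw [hAx]
  -- `M` is the matrix of the inverse change `B`, because the components in `φ` are to be expressed
  -- by those in `ψ`.
  refine KGraph.localOp_affine (M := fun a i => B.linear (Pi.single i 1) a) hUo ψ.open_target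
    ?_ hxU ?_ ?_ (P.smooth ψ hψ) ?_ ?_ ?_ ?_ Γ
  · intro y hy
    obtain ⟨h1, h2, h3, h4⟩ := hU y hy
    rw [← affineMap_apply_eq, ← h3]
    exact ψ.map_source h2
  · intro i j
    have h := congrFun (DFunLike.congr_fun hAB (Pi.single j 1)) i
    rw [ContinuousLinearMap.comp_apply, pi_eq_sum_univ'
      (LinearMap.toContinuousLinearMap B.linear (Pi.single j 1)), map_sum] at h
    simp only [map_smul, Finset.sum_apply, Pi.smul_apply, smul_eq_mul] at h
    simp only [mul_comm (LinearMap.toContinuousLinearMap A.linear _ i)]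
    refine h.trans ?_
    simp [Pi.single_apply]
  · exact fun i j => (P.smooth φ hφ i j).mono fun y hy => (hU y hy).1
  · intro a b y hy
    obtain ⟨h1, h2, h3, h4⟩ := hU y hy
    have ht := P.transform ψ hψ φ hφ (φ.symm y) ⟨h2, φ.map_target h1⟩ a b
    rw [φ.right_inv h1] at ht
    have hd : ∀ i a, pderiv' i (fun w => φ (ψ.symm w) a) (ψ (φ.symm y)) =
        B.linear (Pi.single i 1) a := by
      intro i a
      have he : (fun w => φ (ψ.symm w) a) =ᶠ[nhds (ψ (φ.symm y))] fun w => B w a := by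
        filter_upwards [h4] with w hw; rw [hw]
      have := (hasFDerivAt_pi'.1 (hasFDerivAt_affineMap B (ψ (φ.symm y))) a)
      rw [pderiv', he.fderiv_eq, this.fderiv]
      rfl
    rw [ht]
    simp only [hd]
    rw [h3, affineMap_apply_eq]
  · exact fun s => (hf s φ hφ).mono fun y hy => (hU y hy).1
  · exact fun s => hf s ψ hψ
  · intro s y hy
    obtain ⟨h1, h2, h3, h4⟩ := hU y hy
    rw [← affineMap_apply_eq, ← h3]
    simp [ψ.left_inv h2]

/-- The definition of `KGraph.op` uses another chart at every point. To differentiate its value as a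
function, it must first be written in one fixed chart. -/
lemma KGraph.op_eq_localOp [AffineManifold d N] (P : Bivector d N) {f : Fin m → N → ℝ}
    (hf : ∀ s, SmoothFun d (f s)) (Γ : KGraph m) {φ : OpenPartialHomeomorph N (Fin d → ℝ)}
    (hφ : φ ∈ atlas (Fin d → ℝ) N) {x : N} (hx : x ∈ φ.source) :
    Γ.op P f x = Γ.localOp (P.comp φ) (fun s => f s ∘ φ.symm) (φ x) :=
  Γ.localOp_chart P hf (chart_mem_atlas _ x) hφ ⟨mem_chart_source _ x, hx⟩

lemma KGraph.smoothFun_op [AffineManifold d N] (P : Bivector d N) {f : Fin m → N → ℝ}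
    (hf : ∀ s, SmoothFun d (f s)) (Γ : KGraph m) : SmoothFun d (Γ.op P f) := by
  intro φ hφ
  refine (Γ.contDiffOn_localOp φ.open_target (P.smooth φ hφ) fun s => hf s φ hφ).congr ?_
  intro y hy
  simp only [Function.comp]
  rw [Γ.op_eq_localOp P hf hφ (φ.map_target hy), φ.right_inv hy]

end Manifold

/-! ### Operators of graph sums as linear functionals -/

section GraphSums

lemma KGraph.localOp_congr {d m : ℕ} {U : Set (Fin d → ℝ)} (hU : IsOpen U)
    {P : Fin d → Fin d → (Fin d → ℝ) → ℝ} {f g : Fin m → (Fin d → ℝ) → ℝ} {x : Fin d → ℝ}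
    (hx : x ∈ U) (Γ : KGraph m) (h : ∀ s, Set.EqOn (f s) (g s) U) :
    Γ.localOp P f x = Γ.localOp P g x :=
  Finset.sum_congr rfl fun _ _ => congrArg _ <| Finset.prod_congr rfl fun s _ =>
    (h s).pderivs hU _ hx

variable {d m : ℕ} {U : Set (Fin d → ℝ)} {P : Fin d → Fin d → (Fin d → ℝ) → ℝ}
  {f : Fin m → (Fin d → ℝ) → ℝ} {x : Fin d → ℝ}

/-- The coefficient of `ℏᵏ` in the operator of a graph sum in one chart, as a linear functional of
the graph sum. -/
def GraphSum.localOpL (k : ℕ) (P : Fin d → Fin d → (Fin d → ℝ) → ℝ)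
    (f : Fin m → (Fin d → ℝ) → ℝ) (x : Fin d → ℝ) : GraphSum m →ₗ[ℝ] ℝ :=
  Finsupp.linearCombination ℝ fun Γ => if Γ.n = k then Γ.localOp P f x else 0

lemma GraphSum.localOpL_single (k : ℕ) (Γ : KGraph m) (a : ℝ) :
    GraphSum.localOpL k P f x (Finsupp.single Γ a) =
      a * if Γ.n = k then Γ.localOp P f x else 0 := by
  simp [GraphSum.localOpL]

/-- A linear functional vanishes on the span as soon as it vanishes on the generators, which are
relabellings and swaps. -/
lemma GraphSum.localOpL_skewRel (hU : IsOpen U) (hP : ∀ i j, ContDiffOn ℝ ∞ (P i j) U)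
    (hs : ∀ i j, ∀ y ∈ U, P i j y = - P j i y)
    (hf : ∀ s, ContDiffOn ℝ ∞ (f s) U) (hx : x ∈ U) (k : ℕ) {A : GraphSum m}
    (hA : A ∈ skewRel m) : GraphSum.localOpL k P f x A = 0 := by
  have : skewRel m ≤ LinearMap.ker (GraphSum.localOpL k P f x) := by
    refine Submodule.span_le.2 ?_
    rintro A (⟨Γ, σ, rfl⟩ | ⟨Γ, v, rfl⟩)
    · have h1 : (Γ.relabel σ).n = Γ.n := rfl
      simp only [SetLike.mem_coe, LinearMap.mem_ker, map_sub, GraphSum.localOpL_single,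
        Γ.localOp_relabel hU hP hf hx, h1, sub_self]
    · have h1 : (Γ.swap v).n = Γ.n := rfl
      simp only [SetLike.mem_coe, LinearMap.mem_ker, map_add, GraphSum.localOpL_single,
        Γ.localOp_swap hU hP hs hf hx, h1]
      split_ifs <;> ring
  exact this hA

lemma GraphSum.localOpL_insert (hU : IsOpen U) (hP : ∀ i j, ContDiffOn ℝ ∞ (P i j) U)
    {f : Fin 3 → (Fin d → ℝ) → ℝ} (hf : ∀ s, ContDiffOn ℝ ∞ (f s) U) (hx : x ∈ U) (k : ℕ)
    (s : Fin 2) (Γ Δ : KGraph 2) :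
    GraphSum.localOpL k P f x (KGraph.insert s Γ Δ) = if Δ.n + Γ.n = k then
      Γ.localOp P (insertArgs s (Δ.localOp P fun i => f (innerSink s i)) f) x else 0 := by
  rw [KGraph.insert, map_sum]
  simp only [GraphSum.localOpL_single, one_mul]
  split_ifs with h
  · rw [Γ.localOp_insert hU hP hf hx]
  · simp

lemma GraphSum.localOpL_expand (hU : IsOpen U) (hP : ∀ i j, ContDiffOn ℝ ∞ (P i j) U)
    (hf : ∀ s, ContDiffOn ℝ ∞ (f s) U) (hx : x ∈ U) (k : ℕ) (Λ : LeibnizGraph m) :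
    GraphSum.localOpL k P f x Λ.expand =
      if Λ.b + Λ.l * 2 = k then Λ.localOp P (jacobiator P) f x else 0 := by
  rw [LeibnizGraph.expand]
  simp only [map_sum, GraphSum.localOpL_single, one_mul]
  split_ifs with h
  · rw [Λ.localOp_expand hU hP hf hx]; rfl
  · simp

end GraphSums

/-! ### From graph identities to identities of operators on manifolds -/

section Operators

variable {d m : ℕ} {N : Type*} [TopologicalSpace N] [ChartedSpace (Fin d → ℝ) N]

lemma GraphSum.op_apply (A : GraphSum m) (k : ℕ) (P : Bivector d N) (f : Fin m → N → ℝ) (x : N) :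
    GraphSum.op A k P f x = GraphSum.localOpL k (P.comp (chartAt (Fin d → ℝ) x))
      (fun s => f s ∘ (chartAt (Fin d → ℝ) x).symm) (chartAt (Fin d → ℝ) x x) A := by
  rw [GraphSum.op, GraphSum.localOpL, Finsupp.linearCombination_apply, Finsupp.sum, Finsupp.sum,
    Finset.sum_apply]
  refine Finset.sum_congr rfl fun Γ _ => ?_
  split_ifs <;> simp [KGraph.op]

lemma LeibnizSum.op_apply (D : LeibnizSum m) (k : ℕ) (P : Bivector d N) (f : Fin m → N → ℝ)
    (x : N) : LeibnizSum.op D k P f x =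
      D.sum fun Λ a => a * if Λ.b + Λ.l * 2 = k then Λ.op P f x else 0 := by
  rw [LeibnizSum.op, Finsupp.sum, Finsupp.sum, Finset.sum_apply]
  refine Finset.sum_congr rfl fun Γ _ => ?_
  split_ifs <;> simp

/-- The operator of a Leibniz sum is that of its expansion. -/
theorem LeibnizSum.op_eq_op_expand (D : LeibnizSum m) (k : ℕ) (P : Bivector d N)
    {f : Fin m → N → ℝ} (hf : ∀ s, SmoothFun d (f s)) :
    GraphSum.op D.expand k P f = LeibnizSum.op D k P f := by
  funext x
  have hφ := chart_mem_atlas (Fin d → ℝ) x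
  rw [GraphSum.op_apply, LeibnizSum.op_apply, LeibnizSum.expand, Finsupp.sum, Finsupp.sum, map_sum]
  refine Finset.sum_congr rfl fun Λ _ => ?_
  rw [map_smul, GraphSum.localOpL_expand (chartAt (Fin d → ℝ) x).open_target (P.smooth _ hφ)
    (fun s => hf s _ hφ) (mem_chart_target _ x)]
  rfl

/-- Pointwise, in the preferred chart at each point, this is the vanishing of `GraphSum.localOpL` on
`skewRel`. -/
theorem GraphSum.op_eq_of_sub_mem_skewRel {A B : GraphSum m} (h : A - B ∈ skewRel m) (k : ℕ)
    (P : Bivector d N) {f : Fin m → N → ℝ} (hf : ∀ s, SmoothFun d (f s)) :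
    GraphSum.op A k P f = GraphSum.op B k P f := by
  funext x
  have hφ := chart_mem_atlas (Fin d → ℝ) x
  rw [GraphSum.op_apply, GraphSum.op_apply, ← sub_eq_zero, ← map_sub]
  exact GraphSum.localOpL_skewRel (chartAt (Fin d → ℝ) x).open_target (P.smooth _ hφ)
    (P.skew _ hφ) (fun s => hf s _ hφ) (mem_chart_target _ x) k h

lemma SmoothFun.sum {ι : Type*} (s : Finset ι) {F : ι → N → ℝ} (hF : ∀ i ∈ s, SmoothFun d (F i)) :
    SmoothFun d (∑ i ∈ s, F i) := by
  intro φ hφ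
  have : (∑ i ∈ s, F i) ∘ φ.symm = fun y => ∑ i ∈ s, (F i ∘ φ.symm) y := by
    funext y; simp
  rw [this]
  exact ContDiffOn.sum fun i hi => hF i hi φ hφ

lemma SmoothFun.smul (a : ℝ) {F : N → ℝ} (hF : SmoothFun d F) : SmoothFun d (a • F) := by
  intro φ hφ
  exact (hF φ hφ).const_smul a

lemma SmoothFun.zero : SmoothFun d (0 : N → ℝ) := fun _ _ => contDiffOn_const

lemma GraphSum.smoothFun_op [AffineManifold d N] (A : GraphSum m) (k : ℕ) (P : Bivector d N)
    {f : Fin m → N → ℝ} (hf : ∀ s, SmoothFun d (f s)) : SmoothFun d (GraphSum.op A k P f) := by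
  refine SmoothFun.sum _ fun Γ _ => ?_
  dsimp only
  split_ifs
  · exact (Γ.smoothFun_op P hf).smul _
  · exact SmoothFun.zero

end Operators

/-! ### The associator of power series and its graph sum -/

section Composition

variable {d : ℕ} {N : Type*} [TopologicalSpace N] [ChartedSpace (Fin d → ℝ) N]

/-- Exactly one factor of each term contains the argument in the sink `s`, so the operator is linear
in it. This lets the inner star-product, a sum, be inserted graph by graph. -/
lemma KGraph.localOp_insertArgs_sum {U : Set (Fin d → ℝ)} (hU : IsOpen U)
    {P : Fin d → Fin d → (Fin d → ℝ) → ℝ} {f : Fin 3 → (Fin d → ℝ) → ℝ} {x : Fin d → ℝ}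
    (hx : x ∈ U) {ι : Type*} (S : Finset ι) (a : ι → ℝ) {G : ι → (Fin d → ℝ) → ℝ}
    (hG : ∀ j ∈ S, ContDiffOn ℝ ∞ (G j) U) (s : Fin 2) (Γ : KGraph 2) :
    Γ.localOp P (insertArgs s (fun y => ∑ j ∈ S, a j * G j y) f) x =
      ∑ j ∈ S, a j * Γ.localOp P (insertArgs s (G j) f) x := by
  simp only [KGraph.localOp, Finset.mul_sum]
  rw [Finset.sum_comm]
  refine Finset.sum_congr rfl fun I _ => ?_
  have h1 : ∀ (L : List (Fin d)), pderivs L (fun y => ∑ j ∈ S, a j * G j y) x =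
      ∑ j ∈ S, a j * pderivs L (G j) x := by
    intro L
    rw [pderivs_sum hU S (fun j hj => contDiffOn_const.mul (hG j hj)) L hx]
    exact Finset.sum_congr rfl fun j hj => pderivs_const_mul _ hU (hG j hj) L hx
  have h2 : ∀ X, ∏ t, pderivs (edgeLabels Γ.tgt I (.inl t)) (insertArgs s X f t) x =
      pderivs (edgeLabels Γ.tgt I (.inl s)) X x *
        pderivs (edgeLabels Γ.tgt I (.inl s.rev)) (f (outerSink s.rev)) x := by
    intro X
    fin_cases s
    · rw [Fin.prod_univ_two]; rfl
    · rw [Fin.prod_univ_two, mul_comm]; rfl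
  simp only [h2, h1, Finset.sum_mul, Finset.mul_sum]
  exact Finset.sum_congr rfl fun j _ => by ring

lemma KGraph.op_insertArgs_sum (P : Bivector d N) (f : Fin 3 → N → ℝ) (x : N)
    {ι : Type*} (S : Finset ι) (a : ι → ℝ) {G : ι → N → ℝ}
    (hG : ∀ j ∈ S, SmoothFun d (G j)) (s : Fin 2) (Γ : KGraph 2) :
    Γ.op P (insertArgs s (∑ j ∈ S, a j • G j) f) x =
      ∑ j ∈ S, a j * Γ.op P (insertArgs s (G j) f) x := by
  have h : ∀ X : N → ℝ, (fun t => insertArgs s X f t ∘ (chartAt (Fin d → ℝ) x).symm) =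
      insertArgs s (X ∘ (chartAt (Fin d → ℝ) x).symm)
        fun t => f t ∘ (chartAt (Fin d → ℝ) x).symm := by
    intro X; funext t; simp only [insertArgs]; split_ifs <;> rfl
  simp only [KGraph.op, h]
  rw [← KGraph.localOp_insertArgs_sum (chartAt (Fin d → ℝ) x).open_target
    (mem_chart_target _ x) S a fun j hj => hG j hj _ (chart_mem_atlas _ x)]
  congr 2
  funext y
  simp

lemma GraphSum.op_insertArgs_sum (A : GraphSum 2) (k : ℕ) (P : Bivector d N) (f : Fin 3 → N → ℝ)
    {ι : Type*} (S : Finset ι) {G : ι → N → ℝ}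
    (hG : ∀ j ∈ S, SmoothFun d (G j)) (s : Fin 2) :
    GraphSum.op A k P (insertArgs s (∑ j ∈ S, G j) f) =
      ∑ j ∈ S, GraphSum.op A k P (insertArgs s (G j) f) := by
  simp only [GraphSum.op, Finsupp.sum]
  rw [Finset.sum_comm]
  refine Finset.sum_congr rfl fun Γ _ => ?_
  split_ifs
  · rw [← Finset.smul_sum]
    congr 1
    funext x
    have := Γ.op_insertArgs_sum P f x S (fun _ => 1) hG s
    simpa using this
  · simp

lemma GraphSum.op_insertArgs_op [AffineManifold d N] (A B : GraphSum 2) (a b : ℕ)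
    (P : Bivector d N) {f : Fin 3 → N → ℝ} (hf : ∀ s, SmoothFun d (f s)) (s : Fin 2) (x : N) :
    GraphSum.op A a P (insertArgs s (GraphSum.op B b P fun i => f (innerSink s i)) f) x =
      A.sum fun Γ u => B.sum fun Δ v => if Γ.n = a ∧ Δ.n = b then
        u * v * GraphSum.localOpL (a + b) (P.comp (chartAt (Fin d → ℝ) x))
          (fun s => f s ∘ (chartAt (Fin d → ℝ) x).symm) (chartAt (Fin d → ℝ) x x)
          (KGraph.insert s Γ Δ) else 0 := by
  -- The selection of the order `b` is moved into the coefficients, so that the sum has the shape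
  -- required for linearity.
  have hB : (GraphSum.op B b P fun i => f (innerSink s i)) =
      ∑ Δ ∈ B.support, (if Δ.n = b then B Δ else 0) • Δ.op P fun i => f (innerSink s i) := by
    refine Finset.sum_congr rfl fun Δ _ => ?_
    dsimp only
    split_ifs <;> simp
  rw [GraphSum.op, Finsupp.sum, Finset.sum_apply, Finsupp.sum]
  refine Finset.sum_congr rfl fun Γ _ => ?_
  by_cases hΓ : Γ.n = a
  · rw [if_pos hΓ, hB, Pi.smul_apply, Γ.op_insertArgs_sum P f x _ _
      fun Δ _ => Δ.smoothFun_op P fun i => hf _, Finsupp.sum, smul_eq_mul, Finset.mul_sum]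
    refine Finset.sum_congr rfl fun Δ _ => ?_
    by_cases hΔ : Δ.n = b
    · rw [if_pos hΔ, if_pos ⟨hΓ, hΔ⟩, ← mul_assoc, GraphSum.localOpL_insert
        (chartAt (Fin d → ℝ) x).open_target (P.smooth _ (chart_mem_atlas _ x))
        (fun s => hf s _ (chart_mem_atlas _ x)) (mem_chart_target _ x), if_pos (by omega)]
      refine congrArg _ (Γ.localOp_congr (chartAt (Fin d → ℝ) x).open_target (mem_chart_target _ x) ?_)
      intro t y hy
      by_cases ht : t = s
      · simp only [insertArgs, if_pos ht, Function.comp]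
        -- The inner operator at `y` is defined in the chart preferred at `y`; it is rewritten in
        -- the one preferred at `x`, where the outer operator differentiates.
        rw [Δ.op_eq_localOp P (fun i => hf _) (chart_mem_atlas _ x)
          ((chartAt (Fin d → ℝ) x).map_target hy), (chartAt (Fin d → ℝ) x).right_inv hy]
      · simp [insertArgs, ht]
    · simp [hΔ]
  · simp [hΓ]

/-- The order of a composite graph is the sum of the two orders. For `k ≤ 4` the truncation in
`assoc4` discards nothing of order `k`. -/
theorem op_assoc4 [AffineManifold d N] (p : Fin 10 → ℝ) (P : Bivector d N) {f : Fin 3 → N → ℝ}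
    (hf : ∀ s, SmoothFun d (f s)) {k : ℕ} (hk : k ≤ 4) :
    GraphSum.op (assoc4 p) k P f = ∑ a ∈ Finset.HasAntidiagonal.antidiagonal k,
      (GraphSum.op (star4 p) a.1 P (insertArgs 0
          (GraphSum.op (star4 p) a.2 P fun i => f (innerSink 0 i)) f) -
        GraphSum.op (star4 p) a.1 P (insertArgs 1
          (GraphSum.op (star4 p) a.2 P fun i => f (innerSink 1 i)) f)) := by
  funext x
  simp only [Finset.sum_apply, Pi.sub_apply, GraphSum.op_insertArgs_op _ _ _ _ P hf]
  rw [GraphSum.op_apply, assoc4, Finsupp.sum, map_sum]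
  simp only [Finsupp.sum, map_sum, ← Finset.sum_sub_distrib]
  refine Eq.trans ?_ (Finset.sum_comm (s := (star4 p).support)
    (t := Finset.HasAntidiagonal.antidiagonal k))
  refine Finset.sum_congr rfl fun Γ _ => ?_
  refine Eq.trans ?_ (Finset.sum_comm (s := (star4 p).support)
    (t := Finset.HasAntidiagonal.antidiagonal k))
  refine Finset.sum_congr rfl fun Δ _ => ?_
  have hz : ∀ s, Δ.n + Γ.n ≠ k → GraphSum.localOpL k (P.comp (chartAt (Fin d → ℝ) x))
      (fun s => f s ∘ (chartAt (Fin d → ℝ) x).symm) (chartAt (Fin d → ℝ) x x)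
      (KGraph.insert s Γ Δ) = 0 := by
    intro s h
    rw [GraphSum.localOpL_insert
        (chartAt (Fin d → ℝ) x).open_target (P.smooth _ (chart_mem_atlas _ x))
        (fun s => hf s _ (chart_mem_atlas _ x)) (mem_chart_target _ x), if_neg h]
  by_cases h : Γ.n + Δ.n = k
  · rw [if_pos (by omega), Finset.sum_eq_single (Γ.n, Δ.n)]
    · simp [h, mul_sub]
    · intro q _ hq
      rw [if_neg, if_neg, sub_zero]
      all_goals exact fun hh => hq (Prod.ext hh.1.symm hh.2.symm)
    · intro hq
      exact absurd (Finset.HasAntidiagonal.mem_antidiagonal.2 h) hq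
  · rw [Finset.sum_eq_zero]
    · split_ifs
      · rw [map_smul, map_sub, hz 0 (by omega), hz 1 (by omega)]; simp
      · simp
    · intro q hq
      rw [Finset.HasAntidiagonal.mem_antidiagonal] at hq
      rw [if_neg, if_neg, sub_zero]
      all_goals rintro ⟨h1, h2⟩; omega

/-- Both sides sum over all ways to write `k` as the orders of the outer and inner graph plus the
exponents of the three series. The right-hand side groups the two graph orders together, as is
needed to recognize the associator. -/
lemma sum_antidiagonal_left {M : Type*} [AddCommMonoid M] (k : ℕ) (g : ℕ → ℕ → ℕ → ℕ → ℕ → M) :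
    ∑ a ∈ Finset.HasAntidiagonal.antidiagonal k, ∑ b ∈ Finset.HasAntidiagonal.antidiagonal a.2,
      ∑ r ∈ Finset.HasAntidiagonal.antidiagonal b.1,
      ∑ t ∈ Finset.HasAntidiagonal.antidiagonal r.2, g a.1 r.1 t.1 t.2 b.2 =
    ∑ a ∈ Finset.HasAntidiagonal.antidiagonal k, ∑ b ∈ Finset.HasAntidiagonal.antidiagonal a.2,
      ∑ t ∈ Finset.HasAntidiagonal.antidiagonal b.1,
      ∑ r ∈ Finset.HasAntidiagonal.antidiagonal a.1, g r.1 r.2 t.1 t.2 b.2 := by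
  simp only [Finset.sum_sigma']
  refine Finset.sum_nbij'
    (fun z => ⟨(z.1.1 + z.2.2.1.1, z.2.2.2.1 + z.2.2.2.2 + z.2.1.2),
      ⟨(z.2.2.2.1 + z.2.2.2.2, z.2.1.2), ⟨z.2.2.2, (z.1.1, z.2.2.1.1)⟩⟩⟩)
    (fun z => ⟨(z.2.2.2.1, z.2.2.2.2 + z.2.2.1.1 + z.2.2.1.2 + z.2.1.2),
      ⟨(z.2.2.2.2 + z.2.2.1.1 + z.2.2.1.2, z.2.1.2),
        ⟨(z.2.2.2.2, z.2.2.1.1 + z.2.2.1.2), z.2.2.1⟩⟩⟩) ?_ ?_ ?_ ?_ ?_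
  · rintro ⟨⟨a, a'⟩, ⟨b, b'⟩, ⟨r, r'⟩, ⟨t, t'⟩⟩
    simp only [Finset.mem_sigma, Finset.HasAntidiagonal.mem_antidiagonal]
    rintro ⟨h1, h2, h3, h4⟩
    refine ⟨?_, ?_, ?_, ?_⟩ <;> (try dsimp only at *) <;> omega
  · rintro ⟨⟨a, a'⟩, ⟨b, b'⟩, ⟨r, r'⟩, ⟨t, t'⟩⟩
    simp only [Finset.mem_sigma, Finset.HasAntidiagonal.mem_antidiagonal]
    rintro ⟨h1, h2, h3, h4⟩
    refine ⟨?_, ?_, ?_, ?_⟩ <;> (try dsimp only at *) <;> omega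
  · rintro ⟨⟨a, a'⟩, ⟨b, b'⟩, ⟨r, r'⟩, ⟨t, t'⟩⟩
    simp only [Finset.mem_sigma, Finset.HasAntidiagonal.mem_antidiagonal]
    rintro ⟨rfl, rfl, rfl, rfl⟩
    simp [add_assoc]
  · rintro ⟨⟨a, a'⟩, ⟨b, b'⟩, ⟨r, r'⟩, ⟨t, t'⟩⟩
    simp only [Finset.mem_sigma, Finset.HasAntidiagonal.mem_antidiagonal]
    rintro ⟨rfl, rfl, rfl, rfl⟩
    simp [add_assoc]
  · intros; rfl

/-- The analogous regrouping for the other bracketing, with the same right-hand side, so that the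
two sums can be subtracted term by term. -/
lemma sum_antidiagonal_right {M : Type*} [AddCommMonoid M] (k : ℕ) (g : ℕ → ℕ → ℕ → ℕ → ℕ → M) :
    ∑ a ∈ Finset.HasAntidiagonal.antidiagonal k, ∑ b ∈ Finset.HasAntidiagonal.antidiagonal a.2,
      ∑ r ∈ Finset.HasAntidiagonal.antidiagonal b.2,
      ∑ t ∈ Finset.HasAntidiagonal.antidiagonal r.2, g a.1 r.1 b.1 t.1 t.2 =
    ∑ a ∈ Finset.HasAntidiagonal.antidiagonal k, ∑ b ∈ Finset.HasAntidiagonal.antidiagonal a.2,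
      ∑ t ∈ Finset.HasAntidiagonal.antidiagonal b.1,
      ∑ r ∈ Finset.HasAntidiagonal.antidiagonal a.1, g r.1 r.2 t.1 t.2 b.2 := by
  simp only [Finset.sum_sigma']
  refine Finset.sum_nbij'
    (fun z => ⟨(z.1.1 + z.2.2.1.1, z.2.1.1 + z.2.2.2.1 + z.2.2.2.2),
      ⟨(z.2.1.1 + z.2.2.2.1, z.2.2.2.2), ⟨(z.2.1.1, z.2.2.2.1), (z.1.1, z.2.2.1.1)⟩⟩⟩)
    (fun z => ⟨(z.2.2.2.1, z.2.2.1.1 + (z.2.2.2.2 + (z.2.2.1.2 + z.2.1.2))),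
      ⟨(z.2.2.1.1, z.2.2.2.2 + (z.2.2.1.2 + z.2.1.2)),
        ⟨(z.2.2.2.2, z.2.2.1.2 + z.2.1.2), (z.2.2.1.2, z.2.1.2)⟩⟩⟩) ?_ ?_ ?_ ?_ ?_
  · rintro ⟨⟨a, a'⟩, ⟨b, b'⟩, ⟨r, r'⟩, ⟨t, t'⟩⟩
    simp only [Finset.mem_sigma, Finset.HasAntidiagonal.mem_antidiagonal]
    rintro ⟨h1, h2, h3, h4⟩
    refine ⟨?_, ?_, ?_, ?_⟩ <;> (try dsimp only at *) <;> omega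
  · rintro ⟨⟨a, a'⟩, ⟨b, b'⟩, ⟨r, r'⟩, ⟨t, t'⟩⟩
    simp only [Finset.mem_sigma, Finset.HasAntidiagonal.mem_antidiagonal]
    rintro ⟨h1, h2, h3, h4⟩
    refine ⟨?_, ?_, ?_, ?_⟩ <;> (try dsimp only at *) <;> omega
  · rintro ⟨⟨a, a'⟩, ⟨b, b'⟩, ⟨r, r'⟩, ⟨t, t'⟩⟩
    simp only [Finset.mem_sigma, Finset.HasAntidiagonal.mem_antidiagonal]
    rintro ⟨rfl, rfl, rfl, rfl⟩
    simp
  · rintro ⟨⟨a, a'⟩, ⟨b, b'⟩, ⟨r, r'⟩, ⟨t, t'⟩⟩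
    simp only [Finset.mem_sigma, Finset.HasAntidiagonal.mem_antidiagonal]
    rintro ⟨rfl, rfl, rfl, rfl⟩
    simp [add_assoc]
  · intros; rfl

/-- The coefficients of the associator of formal power series are those of the graph sum
`assoc4`. -/
theorem coeff_associator [AffineManifold d N] (p : Fin 10 → ℝ) (P : Bivector d N)
    {F G H : PowerSeries (N → ℝ)} (hF : ∀ k, SmoothFun d (PowerSeries.coeff k F))
    (hG : ∀ k, SmoothFun d (PowerSeries.coeff k G))
    (hH : ∀ k, SmoothFun d (PowerSeries.coeff k H)) {k : ℕ} (hk : k ≤ 4) :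
    PowerSeries.coeff k (starMul p P (starMul p P F G) H) -
      PowerSeries.coeff k (starMul p P F (starMul p P G H)) =
    ∑ a ∈ Finset.HasAntidiagonal.antidiagonal k, ∑ b ∈ Finset.HasAntidiagonal.antidiagonal a.2,
      ∑ t ∈ Finset.HasAntidiagonal.antidiagonal b.1,
      GraphSum.op (assoc4 p) a.1 P
        ![PowerSeries.coeff t.1 F, PowerSeries.coeff t.2 G, PowerSeries.coeff b.2 H] := by
  have hs2 : ∀ k {X Y : N → ℝ}, SmoothFun d X → SmoothFun d Y →
      SmoothFun d (GraphSum.op (star4 p) k P ![X, Y]) := fun k X Y hX hY =>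
    GraphSum.smoothFun_op _ _ P (Fin.forall_fin_two.2 ⟨hX, hY⟩)
  -- `insertArgs 0` reads only the last of the three entries; the filler `Z` is arbitrary, and zero
  -- is used below.
  have hl : ∀ X Y Z : N → ℝ, (![X, Y] : Fin 2 → N → ℝ) = insertArgs 0 X ![Z, Z, Y] := by
    intro X Y Z; funext t; fin_cases t <;> rfl
  have hr : ∀ X Y Z : N → ℝ, (![X, Y] : Fin 2 → N → ℝ) = insertArgs 1 Y ![X, Z, Z] := by
    intro X Y Z; funext t; fin_cases t <;> rfl
  have hls : ∀ k (S : Finset (ℕ × ℕ)) {X : ℕ × ℕ → N → ℝ} (Y : N → ℝ),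
      (∀ j ∈ S, SmoothFun d (X j)) → GraphSum.op (star4 p) k P ![∑ j ∈ S, X j, Y] =
        ∑ j ∈ S, GraphSum.op (star4 p) k P ![X j, Y] := by
    intro k S X Y hX
    rw [hl _ Y 0, GraphSum.op_insertArgs_sum _ _ _ _ _ hX]
    exact Finset.sum_congr rfl fun j _ => by rw [← hl]
  have hrs : ∀ k (S : Finset (ℕ × ℕ)) {X : ℕ × ℕ → N → ℝ} (Y : N → ℝ),
      (∀ j ∈ S, SmoothFun d (X j)) → GraphSum.op (star4 p) k P ![Y, ∑ j ∈ S, X j] =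
        ∑ j ∈ S, GraphSum.op (star4 p) k P ![Y, X j] := by
    intro k S X Y hX
    rw [hr Y _ 0, GraphSum.op_insertArgs_sum _ _ _ _ _ hX]
    exact Finset.sum_congr rfl fun j _ => by rw [← hr]
  have e1 : PowerSeries.coeff k (starMul p P (starMul p P F G) H) =
      ∑ a ∈ Finset.HasAntidiagonal.antidiagonal k, ∑ b ∈ Finset.HasAntidiagonal.antidiagonal a.2,
        ∑ r ∈ Finset.HasAntidiagonal.antidiagonal b.1,
        ∑ t ∈ Finset.HasAntidiagonal.antidiagonal r.2, GraphSum.op (star4 p) a.1 P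
          ![GraphSum.op (star4 p) r.1 P ![PowerSeries.coeff t.1 F, PowerSeries.coeff t.2 G],
            PowerSeries.coeff b.2 H] := by
    rw [starMul, PowerSeries.coeff_mk]
    refine Finset.sum_congr rfl fun a _ => Finset.sum_congr rfl fun b _ => ?_
    rw [starMul, PowerSeries.coeff_mk]
    rw [hls _ _ _ fun r _ => SmoothFun.sum _ fun t _ => hs2 _ (hF _) (hG _)]
    exact Finset.sum_congr rfl fun r _ => hls _ _ _ fun t _ => hs2 _ (hF _) (hG _)
  have e2 : PowerSeries.coeff k (starMul p P F (starMul p P G H)) =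
      ∑ a ∈ Finset.HasAntidiagonal.antidiagonal k, ∑ b ∈ Finset.HasAntidiagonal.antidiagonal a.2,
        ∑ r ∈ Finset.HasAntidiagonal.antidiagonal b.2,
        ∑ t ∈ Finset.HasAntidiagonal.antidiagonal r.2, GraphSum.op (star4 p) a.1 P
          ![PowerSeries.coeff b.1 F,
            GraphSum.op (star4 p) r.1 P ![PowerSeries.coeff t.1 G, PowerSeries.coeff t.2 H]] := by
    rw [starMul, PowerSeries.coeff_mk]
    refine Finset.sum_congr rfl fun a _ => Finset.sum_congr rfl fun b _ => ?_
    rw [starMul, PowerSeries.coeff_mk]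
    rw [hrs _ _ _ fun r _ => SmoothFun.sum _ fun t _ => hs2 _ (hG _) (hH _)]
    exact Finset.sum_congr rfl fun r _ => hrs _ _ _ fun t _ => hs2 _ (hG _) (hH _)
  rw [e1, e2, sum_antidiagonal_left k fun a a' i j c => GraphSum.op (star4 p) a P
      ![GraphSum.op (star4 p) a' P ![PowerSeries.coeff i F, PowerSeries.coeff j G],
        PowerSeries.coeff c H],
    sum_antidiagonal_right k fun a a' i j c => GraphSum.op (star4 p) a P
      ![PowerSeries.coeff i F,
        GraphSum.op (star4 p) a' P ![PowerSeries.coeff j G, PowerSeries.coeff c H]],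
    ← Finset.sum_sub_distrib]
  refine Finset.sum_congr rfl fun a ha => ?_
  rw [← Finset.sum_sub_distrib]
  refine Finset.sum_congr rfl fun b _ => ?_
  rw [← Finset.sum_sub_distrib]
  refine Finset.sum_congr rfl fun t _ => ?_
  have ha4 : a.1 ≤ 4 := by
    have := Finset.HasAntidiagonal.mem_antidiagonal.1 ha
    omega
  rw [op_assoc4 p P (Fin.forall_fin_succ.2 ⟨hF _, Fin.forall_fin_two.2 ⟨hG _, hH _⟩⟩) ha4,
    ← Finset.sum_sub_distrib]
  refine Finset.sum_congr rfl fun r _ => ?_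
  have i0 : ∀ X Y Z : N → ℝ, (fun i => (![X, Y, Z] : Fin 3 → N → ℝ) (innerSink 0 i)) = ![X, Y] := by
    intro X Y Z; funext t; fin_cases t <;> rfl
  have i1 : ∀ X Y Z : N → ℝ, (fun i => (![X, Y, Z] : Fin 3 → N → ℝ) (innerSink 1 i)) = ![Y, Z] := by
    intro X Y Z; funext t; fin_cases t <;> rfl
  rw [i0, i1]
  congr 2
  · funext s; fin_cases s <;> rfl
  · funext s; fin_cases s <;> rfl

lemma GraphSum.op_eq_zero_of_arg_eq_zero {m : ℕ} (A : GraphSum m) (k : ℕ) (P : Bivector d N)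
    {f : Fin m → N → ℝ} (s : Fin m) (hs : f s = 0) : GraphSum.op A k P f = 0 := by
  funext x
  rw [GraphSum.op, Finsupp.sum, Finset.sum_apply]
  refine Finset.sum_eq_zero fun Γ _ => ?_
  split_ifs
  · rw [Pi.smul_apply, KGraph.op, KGraph.localOp, Finset.sum_eq_zero, smul_zero]
    intro I _
    rw [Finset.prod_eq_zero (Finset.mem_univ s), mul_zero]
    rw [hs]
    exact congrFun (pderivs_zero _) _
  · rfl

/-- Constant series have no coefficients of positive order, and an operator with a zero argument
vanishes; so `ℏᵏ` can only come from the graphs themselves. -/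
theorem coeff_associator_C [AffineManifold d N] (p : Fin 10 → ℝ) (P : Bivector d N)
    {f g h : N → ℝ} (hf : SmoothFun d f) (hg : SmoothFun d g) (hh : SmoothFun d h)
    {k : ℕ} (hk : k ≤ 4) :
    PowerSeries.coeff k
      (starMul p P (starMul p P (PowerSeries.C f) (PowerSeries.C g)) (PowerSeries.C h) -
        starMul p P (PowerSeries.C f) (starMul p P (PowerSeries.C g) (PowerSeries.C h))) =
      GraphSum.op (assoc4 p) k P ![f, g, h] := by
  have hC : ∀ {u : N → ℝ}, SmoothFun d u → ∀ k, SmoothFun d (PowerSeries.coeff k (PowerSeries.C u)) := by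
    intro u hu k
    rw [PowerSeries.coeff_C]
    split_ifs
    · exact hu
    · exact SmoothFun.zero
  rw [map_sub, coeff_associator p P (hC hf) (hC hg) (hC hh) hk, Finset.sum_eq_single (k, 0)]
  · simp
  · rintro ⟨a, b⟩ hab hne
    refine Finset.sum_eq_zero fun c hc => Finset.sum_eq_zero fun t ht => ?_
    simp only [Finset.HasAntidiagonal.mem_antidiagonal] at hab hc ht
    by_cases h1 : t.1 = 0
    · by_cases h2 : t.2 = 0
      · refine GraphSum.op_eq_zero_of_arg_eq_zero _ _ P 2 ?_
        change PowerSeries.coeff c.2 (PowerSeries.C h) = 0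
        rw [PowerSeries.coeff_C, if_neg]
        intro h3
        exact hne (Prod.ext (by simp only; omega) (by simp only; omega))
      · refine GraphSum.op_eq_zero_of_arg_eq_zero _ _ P 1 ?_
        change PowerSeries.coeff t.2 (PowerSeries.C g) = 0
        rw [PowerSeries.coeff_C, if_neg h2]
    · refine GraphSum.op_eq_zero_of_arg_eq_zero _ _ P 0 ?_
      change PowerSeries.coeff t.1 (PowerSeries.C f) = 0
      rw [PowerSeries.coeff_C, if_neg h1]
  · intro hq
    exact absurd (Finset.HasAntidiagonal.mem_antidiagonal.2 (by simp)) hq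

/-- A graph sum which equals the expansion of a Leibniz sum vanishes at Poisson bi-vectors. -/
theorem LeibnizSum.op_eq_zero {m : ℕ} (D : LeibnizSum m) (k : ℕ) {P : Bivector d N}
    (hP : P.IsPoisson) (f : Fin m → N → ℝ) : LeibnizSum.op D k P f = 0 := by
  funext x
  rw [LeibnizSum.op_apply, Finsupp.sum]
  refine Finset.sum_eq_zero fun Λ _ => ?_
  have h0 : ∀ i j k L, pderivs L (jacobiator (P.comp (chartAt (Fin d → ℝ) x)) i j k)
      (chartAt (Fin d → ℝ) x x) = 0 := by
    intro i j k L
    have h : Set.EqOn (jacobiator (P.comp (chartAt (Fin d → ℝ) x)) i j k) (fun _ => 0)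
        (chartAt (Fin d → ℝ) x).target := hP _ (chart_mem_atlas _ x) i j k
    rw [h.pderivs (chartAt (Fin d → ℝ) x).open_target L (mem_chart_target _ x), pderivs_zero]
  have : Λ.op P f x = 0 := by
    refine Finset.sum_eq_zero fun I _ => Finset.sum_eq_zero fun K _ => ?_
    -- A Leibniz graph has at least one Jacobiator, and the derivatives of a function that is zero
    -- on the whole chart vanish.
    rw [Finset.prod_eq_zero (Finset.mem_univ (⟨0, Λ.l_pos⟩ : Fin Λ.l)) (h0 _ _ _ _)]
    simp
  simp [this]

end Composition

/-! ### The associator as an affine function of the parameters -/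

section Components

/-- The associator modulo `o(ℏ⁴)` as a bilinear map of two graph sums. -/
def assocBil : GraphSum 2 →ₗ[ℝ] GraphSum 2 →ₗ[ℝ] GraphSum 3 :=
  Finsupp.linearCombination ℝ fun Γ => Finsupp.linearCombination ℝ fun Δ =>
    if Γ.n + Δ.n ≤ 4 then KGraph.insert 0 Γ Δ - KGraph.insert 1 Γ Δ else 0

lemma assocBil_single (Γ Δ : KGraph 2) (a b : ℝ) :
    assocBil (Finsupp.single Γ a) (Finsupp.single Δ b) =
      (a * b) • if Γ.n + Δ.n ≤ 4 then KGraph.insert 0 Γ Δ - KGraph.insert 1 Γ Δ else 0 := by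
  simp [assocBil, mul_smul]

lemma assoc4_eq_assocBil (p : Fin 10 → ℝ) : assoc4 p = assocBil (star4 p) (star4 p) := by
  rw [assoc4, assocBil, Finsupp.linearCombination_apply, Finsupp.sum, Finsupp.sum,
    LinearMap.sum_apply]
  refine Finset.sum_congr rfl fun Γ _ => ?_
  rw [LinearMap.smul_apply, Finsupp.linearCombination_apply, Finsupp.sum, Finsupp.sum,
    Finset.smul_sum]
  refine Finset.sum_congr rfl fun Δ _ => ?_
  rw [smul_smul]
  split_ifs
  · rfl
  · simp

/-- The part of the star-product with constant coefficients. -/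
def starConstSum : GraphSum 2 :=
  (starConst.map fun e => Finsupp.single (KGraph.ofTargets e.1) (e.2 : ℝ)).sum

/-- The coefficient of the `i`-th parameter (or the constant term, for `i = 0`) in `wₖ`. -/
def weightCoeff (k : ℕ) (i : Fin 11) : ℚ :=
  ((weightTable.getD (k - 1) []).map fun e => if e.1 = i then e.2 else 0).sum

/-- The coefficient of the `i`-th parameter in the sum of the prime graphs. -/
def starPrimeSum (i : Fin 11) : GraphSum 2 :=
  (starPrime.map fun e =>
    Finsupp.single (KGraph.ofTargets e.1) ((e.2.1 * weightCoeff e.2.2 i : ℚ) : ℝ)).sum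

lemma weight_eq (p : Fin 10 → ℝ) (k : ℕ) :
    weight p k = ∑ i, (Fin.cons 1 p : Fin 11 → ℝ) i * weightCoeff k i := by
  rw [weight]
  have h : ∀ (q : Fin 11 → ℝ) (l : List (Fin 11 × ℚ)),
      (l.map fun e => (e.2 : ℝ) * q e.1).sum =
        ∑ i, q i * (((l.map fun e => if e.1 = i then e.2 else 0).sum : ℚ) : ℝ) := by
    intro q l
    induction l with
    | nil => simp
    | cons e l ih =>
      simp only [List.map_cons, List.sum_cons, ih, Rat.cast_add, mul_add, Finset.sum_add_distrib]
      congr 1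
      rw [Finset.sum_eq_single e.1]
      · simp [mul_comm]
      · intro i _ hi; simp [Ne.symm hi]
      · simp
  exact h _ _

lemma star4_eq (p : Fin 10 → ℝ) :
    star4 p = starConstSum + ∑ i, (Fin.cons 1 p : Fin 11 → ℝ) i • starPrimeSum i := by
  rw [star4]
  congr 1
  simp only [weight_eq, starPrimeSum]
  generalize starPrime = l
  induction l with
  | nil => simp
  | cons e l ih =>
    simp only [List.map_cons, List.sum_cons, ih, smul_add, Finset.sum_add_distrib]
    congr 1
    rw [Finset.mul_sum, Finsupp.single_finsetSum]
    refine Finset.sum_congr rfl fun i _ => ?_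
    rw [Finsupp.smul_single, smul_eq_mul]
    congr 1
    push_cast
    ring

/-- The star-product's unit graph without internal vertices. -/
def emptySum : GraphSum 2 := Finsupp.single (KGraph.ofTargets []) 1

/-- The contribution of a sum of graphs with four internal vertices to the associator. -/
def assocLin (A : GraphSum 2) : GraphSum 3 := assocBil emptySum A + assocBil A emptySum

lemma LinearMap.map_list_sum' {R M M' ι : Type*} [Semiring R] [AddCommMonoid M] [AddCommMonoid M']
    [Module R M] [Module R M'] (T : M →ₗ[R] M') (l : List ι) (g : ι → M) :
    T (l.map g).sum = (l.map fun e => T (g e)).sum := by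
  rw [map_list_sum, List.map_map]; rfl

lemma LinearMap.list_sum_apply' {R M M' ι : Type*} [Semiring R] [AddCommMonoid M]
    [AddCommMonoid M'] [Module R M] [Module R M'] (l : List ι) (T : ι → M →ₗ[R] M') (x : M) :
    (l.map T).sum x = (l.map fun e => T e x).sum := by
  induction l with
  | nil => simp
  | cons e l ih => simp [ih]

lemma length_starPrime : ∀ e ∈ starPrime, e.1.length = 8 := by decide +kernel

lemma length_starConst : ∀ e ∈ starConst.tail, 2 ≤ e.1.length := by decide +kernel

lemma list_sum_map_eq_zero {M ι : Type*} [AddCommMonoid M] (l : List ι) (g : ι → M)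
    (h : ∀ e ∈ l, g e = 0) : (l.map g).sum = 0 :=
  List.sum_eq_zero fun x hx => by
    obtain ⟨e, he, rfl⟩ := List.mem_map.1 hx
    exact h e he

/-- The composite of two prime graphs has eight internal vertices and is truncated. -/
lemma assocBil_prime_prime (i j : Fin 11) : assocBil (starPrimeSum i) (starPrimeSum j) = 0 := by
  rw [starPrimeSum, LinearMap.map_list_sum', LinearMap.list_sum_apply']
  refine list_sum_map_eq_zero _ _ fun e he => ?_
  rw [starPrimeSum, LinearMap.map_list_sum']
  refine list_sum_map_eq_zero _ _ fun e' he' => ?_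
  rw [assocBil_single, if_neg, smul_zero]
  have h1 := length_starPrime e he
  have h2 := length_starPrime e' he'
  simp [KGraph.ofTargets, h1, h2]

lemma starConstSum_eq : starConstSum = emptySum +
    (starConst.tail.map fun e => Finsupp.single (KGraph.ofTargets e.1) (e.2 : ℝ)).sum := by
  have : starConst = ([], 1) :: starConst.tail := rfl
  rw [starConstSum, this, List.map_cons, List.sum_cons, List.tail_cons, emptySum]
  simp

/-- Only the empty graph leaves room for a prime one: any other graph would raise the order to at
least five. -/
lemma assocBil_const_prime (i : Fin 11) :
    assocBil starConstSum (starPrimeSum i) = assocBil emptySum (starPrimeSum i) := by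
  rw [starConstSum_eq, map_add, LinearMap.add_apply, LinearMap.map_list_sum',
    LinearMap.list_sum_apply', list_sum_map_eq_zero, add_zero]
  intro e he
  rw [starPrimeSum, LinearMap.map_list_sum']
  refine list_sum_map_eq_zero _ _ fun e' he' => ?_
  rw [assocBil_single, if_neg, smul_zero]
  have h1 := length_starConst e he
  have h2 := length_starPrime e' he'
  simp [KGraph.ofTargets, h2]
  omega

lemma assocBil_prime_const (i : Fin 11) :
    assocBil (starPrimeSum i) starConstSum = assocBil (starPrimeSum i) emptySum := by
  rw [starConstSum_eq, map_add, LinearMap.map_list_sum', list_sum_map_eq_zero, add_zero]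
  intro e he
  rw [starPrimeSum, LinearMap.map_list_sum', LinearMap.list_sum_apply']
  refine list_sum_map_eq_zero _ _ fun e' he' => ?_
  rw [assocBil_single, if_neg, smul_zero]
  have h1 := length_starConst e he
  have h2 := length_starPrime e' he'
  simp [KGraph.ofTargets, h2]
  omega

/-- The associator is quadratic in the star-product, but its terms of second degree in the prime
part vanish. In the vector `Fin.cons 1 p` the leading entry accounts for the constant terms of the
weights. -/
lemma assoc4_eq (p : Fin 10 → ℝ) : assoc4 p = assocBil starConstSum starConstSum +
    ∑ i, (Fin.cons 1 p : Fin 11 → ℝ) i • assocLin (starPrimeSum i) := by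
  rw [assoc4_eq_assocBil, star4_eq]
  simp only [map_add, map_sum, map_smul, LinearMap.add_apply, LinearMap.sum_apply,
    LinearMap.smul_apply, assocBil_prime_prime, assocBil_const_prime, assocBil_prime_const,
    assocLin, smul_add, Finset.sum_add_distrib, smul_zero, Finset.sum_const_zero, add_zero]
  rw [add_assoc, add_comm (∑ x, _ • assocBil (starPrimeSum x) _)]

lemma assocComponent_zero : assocComponent 0 =
    assocBil starConstSum starConstSum + assocLin (starPrimeSum 0) := by
  change assoc4 0 = _
  rw [assoc4_eq, Fin.sum_univ_succ]
  simp

lemma assocComponent_succ (i : Fin 10) :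
    assocComponent i.succ = assocLin (starPrimeSum i.succ) := by
  change assoc4 (Pi.single i 1) - assoc4 0 = _
  have h (q : Fin 10 → ℝ) (T : Fin 11 → GraphSum 3) :
      ∑ j, (Fin.cons 1 q : Fin 11 → ℝ) j • T j = T 0 + ∑ j : Fin 10, q j • T j.succ := by
    rw [Fin.sum_univ_succ]; simp
  rw [assoc4_eq, assoc4_eq, add_sub_add_left_eq_sub, h, h]
  simp [Pi.single_apply]

theorem assoc4_eq_sum (p : Fin 10 → ℝ) :
    assoc4 p = assocComponent 0 + ∑ i : Fin 10, p i • assocComponent i.succ := by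
  rw [assoc4_eq, assocComponent_zero, Fin.sum_univ_succ]
  simp [assocComponent_succ, add_assoc]

end Components

/-! ### Insertions of graphs as explicit lists of targets -/

section Enumeration

/-- The lists whose `i`-th entry is taken from the `i`-th of the given lists. -/
def selections : List (List ℕ) → List (List ℕ)
  | [] => [[]]
  | c :: C => c.flatMap fun t => (selections C).map (t :: ·)

lemma list_sum_flatMap {α β M : Type*} [AddCommMonoid M] (l : List α) (f : α → List β)
    (g : β → M) :
    ((l.flatMap f).map g).sum = (l.map fun a => ((f a).map g).sum).sum := by
  induction l with
  | nil => simp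
  | cons a l ih => simp [ih]

lemma sum_piFinset_succ {α M : Type*} [DecidableEq α] [AddCommMonoid M] {K : ℕ}
    (A : Fin (K + 1) → Finset α) (G : (Fin (K + 1) → α) → M) :
    ∑ x ∈ Fintype.piFinset A, G x =
      ∑ a ∈ A 0, ∑ x ∈ Fintype.piFinset (fun i => A i.succ), G (Fin.cons a x) := by
  rw [← Finset.sum_product']
  refine (Finset.sum_bij' (fun p _ => Fin.cons p.1 p.2) (fun x _ => (x 0, Fin.tail x))
    ?_ ?_ ?_ ?_ ?_).symm
  · rintro ⟨a, x⟩ h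
    simp only [Finset.mem_product, Fintype.mem_piFinset] at h ⊢
    exact Fin.cases h.1 h.2
  · intro x h
    simp only [Finset.mem_product, Fintype.mem_piFinset] at h ⊢
    exact ⟨h 0, fun i => h i.succ⟩
  · rintro ⟨a, x⟩ _
    simp
  · intro x _
    simp
  · intros; rfl

/-- This turns sums over finite sets of functions, in which the definitions are written, into sums
over lists of numbers that can be evaluated. It suffices to know a list for each coordinate. -/
lemma sum_piFinset_eq_selections {α M : Type*} [DecidableEq α] [AddCommMonoid M]
    (C : List (List ℕ)) : ∀ {K : ℕ} (_ : C.length = K) (A : Fin K → Finset α)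
    (dec : Fin K → ℕ → α) (_ : ∀ (i : Fin K) (g : α → M),
      ∑ x ∈ A i, g x = ((C.getD i []).map fun t => g (dec i t)).sum) (G : (Fin K → α) → M),
    ∑ x ∈ Fintype.piFinset A, G x =
      ((selections C).map fun y => G fun i => dec i (y.getD i 0)).sum := by
  induction C with
  | nil =>
    rintro K rfl A dec h G
    simp only [selections, List.map_cons, List.map_nil, List.sum_cons, List.sum_nil, add_zero]
    rw [Finset.sum_eq_single (fun i => i.elim0)]
    · congr 1
      funext i
      exact i.elim0
    · intro x _ hx
      exact absurd (funext fun i => i.elim0) hx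
    · intro hx
      exact absurd (Fintype.mem_piFinset.2 fun i => i.elim0) hx
  | cons c C ih =>
    rintro K rfl A dec h G
    simp only [List.length_cons] at A dec h G ⊢
    rw [sum_piFinset_succ, selections, list_sum_flatMap]
    have h0 := h 0
    simp only [Fin.val_zero, List.getD_cons_zero] at h0
    rw [h0]
    congr 1
    refine List.map_congr_left fun t _ => ?_
    rw [ih rfl (fun i => A i.succ) (fun i => dec i.succ)
      (fun i g => by simpa using h i.succ g), List.map_map]
    congr 1
    refine List.map_congr_left fun y _ => ?_
    simp only [Function.comp]
    congr 1
    funext i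
    refine Fin.cases ?_ (fun i => ?_) i <;> simp

lemma length_of_mem_selections {C : List (List ℕ)} {y : List ℕ} (h : y ∈ selections C) :
    y.length = C.length := by
  induction C generalizing y with
  | nil => simp_all [selections]
  | cons c C ih =>
    simp only [selections, List.mem_flatMap, List.mem_map] at h
    obtain ⟨t, -, y, hy, rfl⟩ := h
    simp [ih hy]

lemma mem_of_mem_selections {C : List (List ℕ)} {y : List ℕ} (h : y ∈ selections C) {t : ℕ}
    (ht : t ∈ y) : ∃ c ∈ C, t ∈ c := by
  induction C generalizing y with
  | nil => simp_all [selections]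
  | cons c C ih =>
    simp only [selections, List.mem_flatMap, List.mem_map] at h
    obtain ⟨u, hu, y, hy, rfl⟩ := h
    rcases List.mem_cons.1 ht with rfl | ht
    · exact ⟨c, by simp, hu⟩
    · obtain ⟨c', hc', ht'⟩ := ih hy ht
      exact ⟨c', by simp [hc'], ht'⟩

/-- The vertex with number `t` of a graph with `m` sinks and `n` internal vertices. -/
def vertexOf (m n t : ℕ) (hn : 0 < n) : Fin m ⊕ Fin n :=
  if h : t < m then .inl ⟨t, h⟩ else .inr ⟨(t - m) % n, Nat.mod_lt _ hn⟩

/-- The graph with `m` sinks and `n` internal vertices with a given list of targets. -/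
def graphOf (m n : ℕ) (l : List ℕ) : KGraph m :=
  ⟨n, fun v j => vertexOf m n (l.getD (2 * v.val + j.val) 0) v.pos⟩

lemma ofTargets_eq_graphOf (l : List ℕ) : KGraph.ofTargets l = graphOf 2 (l.length / 2) l := rfl

/-- The number of the `t`-th vertex of an inserted graph in the composite graph. -/
def innerCode (s t : ℕ) : ℕ := if t < 2 then t + s else t + 1

/-- The numbers of the vertices on which an edge of the outer graph may land after the insertion of
a graph with `b` internal vertices in the sink `s`. -/
def insertCodes (s b t : ℕ) : List ℕ :=
  if 2 ≤ t then [t + 1 + b] else if t = s then (List.range (2 + b)).map (innerCode s) else [2 * t]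

/-- The lists of targets of the graphs in the action of a graph on another one in its sink `s`. -/
def insertLists (s : ℕ) (lΓ lΔ : List ℕ) : List (List ℕ) :=
  (selections (lΓ.map (insertCodes s (lΔ.length / 2)))).map (lΔ.map (innerCode s) ++ ·)

/-- The bound guarantees that targets are genuine vertex numbers, and thus octal digits when there
are at most four internal vertices. -/
lemma lt_of_mem_insertLists {s : ℕ} (hs : s < 2) {lΓ lΔ : List ℕ} {a : ℕ}
    (hΓ : ∀ t ∈ lΓ, t < 2 + a) (hΔ : ∀ t ∈ lΔ, t < 2 + lΔ.length / 2) {l : List ℕ}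
    (hl : l ∈ insertLists s lΓ lΔ) {t : ℕ} (ht : t ∈ l) : t < 3 + (a + lΔ.length / 2) := by
  have hin : ∀ t < 2 + lΔ.length / 2, innerCode s t < 3 + lΔ.length / 2 := by
    intro t ht
    unfold innerCode
    split_ifs <;> omega
  obtain ⟨y, hy, rfl⟩ := List.mem_map.1 hl
  rcases List.mem_append.1 ht with ht | ht
  · obtain ⟨u, hu, rfl⟩ := List.mem_map.1 ht
    have := hin u (hΔ u hu)
    omega
  · obtain ⟨c, hc, htc⟩ := mem_of_mem_selections hy ht
    obtain ⟨u, hu, rfl⟩ := List.mem_map.1 hc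
    have h1 := hΓ u hu
    unfold insertCodes at htc
    split_ifs at htc with h2 h3
    · rw [List.mem_singleton.1 htc]; omega
    · obtain ⟨v, hv, rfl⟩ := List.mem_map.1 htc
      have := hin v (List.mem_range.1 hv)
      omega
    · rw [List.mem_singleton.1 htc]; omega

/-- The remainder in `vertexOf` is only a default for numbers that are too large. For `t` in the
stated range it has no effect on either side. -/
lemma vertexOf_innerCode (s : Fin 2) {a b t : ℕ} (hb : 0 < b) (ht : t < 2 + b) (hn : 0 < b + a) :
    vertexOf 3 (b + a) (innerCode s t) hn =
      Sum.map (innerSink s) (Fin.castAdd a) (vertexOf 2 b t hb) := by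
  unfold vertexOf innerCode
  by_cases h : t < 2
  · have : t + s.val < 3 := by omega
    simp [h, this, innerSink, add_comm]
  · have h3 : ¬ t + 1 < 3 := by omega
    simp only [h, h3, if_false, dif_neg, not_false_eq_true, Sum.map_inr]
    congr 1
    ext
    simp only [Fin.val_castAdd]
    rw [Nat.mod_eq_of_lt (by omega), Nat.mod_eq_of_lt (by omega)]
    omega

lemma sum_univ_vertex {M : Type*} [AddCommMonoid M] {b : ℕ} (g : Fin 2 ⊕ Fin b → M)
    (G : ℕ → M) (h : ∀ (y : Fin 2 ⊕ Fin b), G (Sum.elim Fin.val (fun u => 2 + u.val) y) = g y) :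
    ∑ y, g y = ((List.range (2 + b)).map G).sum := by
  have : ((List.range (2 + b)).map G).sum = ∑ i ∈ Finset.range (2 + b), G i := rfl
  rw [this, Finset.sum_range_add, Finset.sum_range, Finset.sum_range, Fintype.sum_sum_type]
  exact congr_arg₂ _ (Finset.sum_congr rfl fun i _ => (h (.inl i)).symm)
    (Finset.sum_congr rfl fun u _ => (h (.inr u)).symm)

/-- Where an edge of a graph with `a` internal vertices may land after a graph with `b` internal
vertices is inserted in its sink `s`. -/
def slotTargets (s : Fin 2) (a b : ℕ) : Fin 2 ⊕ Fin a → Finset (Fin 3 ⊕ Fin (b + a))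
  | .inl t => if t = s then Finset.univ.image (Sum.map (innerSink s) (Fin.castAdd a))
      else {.inl (outerSink t)}
  | .inr v => {.inr (Fin.natAdd b v)}

lemma insertTargets_graphOf (s : Fin 2) (lΓ lΔ : List ℕ) (a b : ℕ) :
    insertTargets s (graphOf 2 a lΓ) (graphOf 2 b lΔ) = slotTargets s a b := by
  funext z
  rcases z with t | v <;> rfl

/-- The passage from sets of possible targets to lists of codes, for one edge; distinct vertices of
the inserted graph remain distinct, so the image has no collapsed terms. -/
lemma sum_slotTargets {M : Type*} [AddCommMonoid M] (s : Fin 2) {a b : ℕ}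
    {t : ℕ} (ha : 0 < a) (ht : t < 2 + a) (hn : 0 < b + a) (g : Fin 3 ⊕ Fin (b + a) → M) :
    ∑ x ∈ slotTargets s a b (vertexOf 2 a t ha), g x =
      ((insertCodes s b t).map fun t => g (vertexOf 3 (b + a) t hn)).sum := by
  unfold insertCodes
  by_cases h : 2 ≤ t
  · have h' : ¬ t < 2 := by omega
    have h3 : ¬ t + 1 + b < 3 := by omega
    have hA : slotTargets s a b (vertexOf 2 a t ha) = {vertexOf 3 (b + a) (t + 1 + b) hn} := by
      simp only [vertexOf, h', h3, dif_neg, not_false_eq_true, slotTargets]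
      congr 2
      apply Fin.ext
      change b + (t - 2) % a = (t + 1 + b - 3) % (b + a)
      rw [Nat.mod_eq_of_lt (by omega), Nat.mod_eq_of_lt (by omega)]
      omega
    simp [hA, h]
  · have h' : t < 2 := by omega
    by_cases hs : t = s.val
    · have hs' : (⟨t, h'⟩ : Fin 2) = s := Fin.ext hs
      have hinj : Function.Injective (Sum.map (innerSink s) (Fin.castAdd (n := b) a)) :=
        innerVertex_injective s (graphOf 2 b []) a
      rw [if_neg h, if_pos hs]
      simp only [vertexOf, h', dif_pos, slotTargets, hs', if_true]
      rw [Finset.sum_image hinj.injOn, List.map_map]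
      refine sum_univ_vertex _ _ fun y => ?_
      simp only [Function.comp]
      congr 1
      rcases y with i | u
      · have h2 : i.val + s.val < 3 := by omega
        have h3 : innerCode s i.val = i.val + s.val := if_pos i.2
        simp only [Sum.elim_inl, h3, Sum.map_inl, dif_pos h2, innerSink]
        congr 2
        omega
      · have h3 : innerCode s (2 + u.val) = u.val + 3 := by
          rw [innerCode, if_neg (by omega)]; omega
        simp only [Sum.elim_inr, h3, Sum.map_inr]
        rw [dif_neg (by omega)]
        congr 1
        apply Fin.ext
        change (u.val + 3 - 3) % (b + a) = u.val
        rw [Nat.mod_eq_of_lt (by omega)]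
        omega
    · have hs' : (⟨t, h'⟩ : Fin 2) ≠ s := fun e => hs (by rw [← e])
      have h3 : 2 * t < 3 := by omega
      simp [slotTargets, vertexOf, h, h', hs, hs', h3, outerSink]

theorem KGraph.insert_graphOf (s : Fin 2) {lΓ lΔ : List ℕ} {a b : ℕ} (hΓ : lΓ.length = 2 * a)
    (hΔ : lΔ.length = 2 * b) (hΓ' : ∀ t ∈ lΓ, t < 2 + a) (hΔ' : ∀ t ∈ lΔ, t < 2 + b) :
    KGraph.insert s (graphOf 2 a lΓ) (graphOf 2 b lΔ) =
      ((insertLists s lΓ lΔ).map fun l => Finsupp.single (graphOf 3 (b + a) l) 1).sum := by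
  have hb : lΔ.length / 2 = b := by omega
  have ha (i : Fin (a * 2)) : 0 < a := by have := i.2; omega
  have hn (i : Fin (a * 2)) : 0 < b + a := by have := i.2; omega
  have hsel := sum_piFinset_eq_selections (M := GraphSum 3) (lΓ.map (insertCodes s b)) (K := a * 2)
    (by simp [hΓ, mul_comm])
    (fun i => slotTargets s a b (vertexOf 2 a (lΓ.getD i 0) (ha i)))
    (fun i t => vertexOf 3 (b + a) t (hn i))
    (fun i g => by
      have hi : i.val < lΓ.length := by omega
      rw [sum_slotTargets s (ha i) (hΓ' _ (by
        rw [List.getD_eq_getElem _ _ hi]; exact List.getElem_mem hi)) (hn i)]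
      simp [hi])
  rw [KGraph.insert, sum_piFinset_curry, insertTargets_graphOf]
  -- The lists of targets store the `j`-th edge of `v` at the position `2 * v + j`, which is the
  -- number that `finProdFinEquiv` assigns to the pair.
  have hval (v : Fin a) (j : Fin 2) : (finProdFinEquiv (v, j)).val = 2 * v.val + j.val := by
    rw [finProdFinEquiv_apply_val, add_comm]
  have hcomp (F : (Fin a × Fin 2 → Fin 3 ⊕ Fin (b + a)) → GraphSum 3) :
      ∑ τ ∈ Fintype.piFinset (fun e : Fin a × Fin 2 =>
        slotTargets s a b ((graphOf 2 a lΓ).tgt e.1 e.2)), F τ =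
      ∑ τ ∈ Fintype.piFinset (fun i : Fin (a * 2) =>
        slotTargets s a b (vertexOf 2 a (lΓ.getD i 0) (ha i))),
        F fun e => τ (finProdFinEquiv e) := by
    symm
    refine Finset.sum_equiv (Equiv.arrowCongr finProdFinEquiv.symm (Equiv.refl _)) ?_ ?_
    · intro τ
      simp only [Fintype.mem_piFinset, Equiv.arrowCongr_apply, Equiv.coe_refl, Function.comp,
        Equiv.symm_symm, id]
      rw [finProdFinEquiv.symm.surjective.forall]
      refine forall_congr' fun i => ?_
      have : 2 * (finProdFinEquiv.symm i).1.val + (finProdFinEquiv.symm i).2.val = i.val := by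
        rw [← hval, Prod.mk.eta, Equiv.apply_symm_apply]
      simp only [graphOf, this, Equiv.apply_symm_apply]
    · intro τ _
      rfl
  refine (hcomp _).trans ((hsel _).trans ?_)
  rw [insertLists, List.map_map, hb]
  congr 1
  refine List.map_congr_left fun y hy => ?_
  simp only [Function.comp, graphOf]
  congr 2
  funext v j
  refine Fin.addCases (fun u => ?_) (fun v => ?_) v
  · have hu : 2 * u.val + j.val < lΔ.length := by omega
    rw [Fin.append_left, Fin.val_castAdd, List.getD_append _ _ _ _ (by simpa using hu)]
    have : (lΔ.map (innerCode s)).getD (2 * u.val + j.val) 0 =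
        innerCode s (lΔ.getD (2 * u.val + j.val) 0) := by simp [hu]
    rw [this, vertexOf_innerCode s u.pos]
    · rfl
    · rw [List.getD_eq_getElem _ _ hu]
      exact hΔ' _ (List.getElem_mem hu)
  · rw [Fin.append_right, List.getD_append_right _ _ _ _ (by simp [hΔ]; omega)]
    simp only [hval, List.length_map, hΔ, Fin.val_natAdd]
    congr 2
    omega

end Enumeration

/-! ### Expansions of Leibniz graphs with one Jacobiator as explicit lists -/

section LeibnizEnumeration

/-- The vertex with number `t` of a Leibniz graph on three sinks with one Jacobiator: the sinks
come first, then the `b` vertices with two edges, then the Jacobiator. -/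
def leibnizVertex (b t : ℕ) : Fin 3 ⊕ (Fin b ⊕ Fin 1) :=
  if h : t < 3 then .inl ⟨t, h⟩ else if h' : t - 3 < b then .inr (.inl ⟨t - 3, h'⟩)
    else .inr (.inr 0)

lemma leibnizVertex_injOn (b : ℕ) {t t' : ℕ} (_ : t < 3 + b)
    (h : leibnizVertex b t = leibnizVertex b t') (_ : t' < 3 + b) : t = t' := by
  unfold leibnizVertex at h
  split_ifs at h <;> simp_all <;> omega

/-- The Leibniz graph with one Jacobiator whose edges land on the vertices `J 0`, `J 1`, `J 2`, and
with a given list `w` of targets of the `b` vertices with two edges. -/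
def leibnizOf (b : ℕ) (w : List ℕ) (J : Fin 3 → ℕ) (hJ : StrictMono J) (hb : J 2 < 3 + b) :
    LeibnizGraph 3 where
  b := b
  l := 1
  l_pos := one_pos
  wedge v j := leibnizVertex b (w.getD (2 * v.val + j.val) 0)
  jac _ i := leibnizVertex b (J i)
  jac_injective _ i i' h := hJ.injective (leibnizVertex_injOn b
    ((hJ.monotone (Fin.le_last i)).trans_lt hb) h ((hJ.monotone (Fin.le_last i')).trans_lt hb))
  jac_ne j i h := by
    have := (hJ.monotone (Fin.le_last i)).trans_lt hb
    unfold leibnizVertex at h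
    split_ifs at h <;> simp_all <;> omega

/-- The numbers of the vertices on which an edge to the vertex `t` of a Leibniz graph with one
Jacobiator and `b` other internal vertices lands in the expansion. -/
def expandCodes (b t : ℕ) : List ℕ := if t < 3 + b then [t] else [3 + b, 4 + b]

/-- The lists of targets of the graphs in the expansion of a Leibniz graph with one Jacobiator. -/
def expandLists (b : ℕ) (w : List ℕ) (J : Fin 3 → ℕ) : List (List ℕ) :=
  (List.finRange 3).flatMap fun c =>
    (selections (w.map (expandCodes b))).map (· ++ [J c, J (c + 1), 3 + b, J (c + 2)])

lemma lt_of_mem_expandLists {b : ℕ} {w : List ℕ} {J : Fin 3 → ℕ} (hJ : ∀ i, J i < 3 + b)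
    {l : List ℕ} (hl : l ∈ expandLists b w J) {t : ℕ} (ht : t ∈ l) : t < 3 + (b + 2) := by
  obtain ⟨c, -, hl⟩ := List.mem_flatMap.1 hl
  obtain ⟨y, hy, rfl⟩ := List.mem_map.1 hl
  rcases List.mem_append.1 ht with ht | ht
  · obtain ⟨c, hc, htc⟩ := mem_of_mem_selections hy ht
    obtain ⟨u, -, rfl⟩ := List.mem_map.1 hc
    unfold expandCodes at htc
    split_ifs at htc with h
    · rw [List.mem_singleton.1 htc]; omega
    · simp only [List.mem_cons, List.not_mem_nil, or_false] at htc
      omega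
  · simp only [List.mem_cons, List.not_mem_nil, or_false] at ht
    have h0 := hJ c
    have h1 := hJ (c + 1)
    have h2 := hJ (c + 2)
    rcases ht with rfl | rfl | rfl | rfl <;> omega

/-- Where an edge lands in the expansion of a Leibniz graph with one Jacobiator. -/
def splitTargets (b : ℕ) : Fin 3 ⊕ (Fin b ⊕ Fin 1) → Finset (Fin 3 ⊕ Fin (b + 1 * 2))
  | .inl s => {.inl s}
  | .inr (.inl v) => {.inr (Fin.castAdd (1 * 2) v)}
  | .inr (.inr j) =>
      Finset.univ.image fun e : Fin 2 => .inr (Fin.natAdd b (finProdFinEquiv (j, e)))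

lemma targets_leibnizOf (b : ℕ) (w : List ℕ) (J : Fin 3 → ℕ) (hJ : StrictMono J)
    (hb : J 2 < 3 + b) : (leibnizOf b w J hJ hb).targets = splitTargets b := by
  funext z
  rcases z with t | v | j <;> rfl

lemma splitTargets_of_lt {b t : ℕ} (h : t < 3 + b) :
    splitTargets b (leibnizVertex b t) = {vertexOf 3 (b + 1 * 2) t (by omega)} := by
  unfold leibnizVertex vertexOf
  by_cases h3 : t < 3
  · simp [h3, splitTargets]
  · have hb : t - 3 < b := by omega
    simp only [h3, hb, dif_pos, dif_neg, not_false_eq_true, splitTargets]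
    congr 2
    apply Fin.ext
    change t - 3 = (t - 3) % (b + 1 * 2)
    rw [Nat.mod_eq_of_lt (by omega)]

lemma vertexOf_jac (b : ℕ) (e : Fin 2) :
    vertexOf 3 (b + 1 * 2) (3 + b + e.val) (by omega) =
      .inr (Fin.natAdd b (finProdFinEquiv ((0 : Fin 1), e))) := by
  rw [vertexOf, dif_neg (by omega)]
  congr 1
  apply Fin.ext
  rw [Fin.val_natAdd, finProdFinEquiv_apply_val]
  change (3 + b + e.val - 3) % (b + 1 * 2) = b + (e.val + 2 * 0)
  rw [Nat.mod_eq_of_lt (by omega)]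
  omega

lemma sum_splitTargets {M : Type*} [AddCommMonoid M] (b t : ℕ) (hn : 0 < b + 1 * 2)
    (g : Fin 3 ⊕ Fin (b + 1 * 2) → M) :
    ∑ x ∈ splitTargets b (leibnizVertex b t), g x =
      ((expandCodes b t).map fun t => g (vertexOf 3 (b + 1 * 2) t hn)).sum := by
  unfold expandCodes
  by_cases h : t < 3 + b
  · rw [splitTargets_of_lt h]
    simp [h]
  · have h3 : ¬ t < 3 := by omega
    have hb : ¬ t - 3 < b := by omega
    have h0 := vertexOf_jac b 0
    have h1 := vertexOf_jac b 1
    have e1 : 3 + b + (1 : Fin 2).val = 4 + b := by rw [Fin.val_one]; omega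
    simp only [e1, Fin.val_zero, add_zero] at h0 h1
    simp only [leibnizVertex, h3, hb, h, dif_neg, if_false, not_false_eq_true, splitTargets,
      List.map_cons, List.map_nil, List.sum_cons, List.sum_nil, add_zero, h0, h1]
    rw [Finset.sum_image, Fin.sum_univ_two]
    intro e _ e' _ hee
    have := finProdFinEquiv.injective (Fin.natAdd_injective _ _ (Sum.inr_injective hee))
    exact (Prod.mk.inj this).2

/-- The two vertices of the Jacobiator receive the numbers `3 + b` and `4 + b`, after the sinks and
the `b` other vertices; an edge to the Jacobiator chooses between them. -/
theorem LeibnizGraph.expand_leibnizOf {b : ℕ} {w : List ℕ} (hw : w.length = 2 * b)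
    (J : Fin 3 → ℕ) (hJ : StrictMono J) (hb : J 2 < 3 + b) :
    (leibnizOf b w J hJ hb).expand =
      ((expandLists b w J).map fun l => Finsupp.single (graphOf 3 (b + 1 * 2) l) 1).sum := by
  have hn : 0 < b + 1 * 2 := by omega
  have hJlt (i : Fin 3) : J i < 3 + b := (hJ.monotone (Fin.le_last i)).trans_lt hb
  have hval (v : Fin b) (j : Fin 2) : (finProdFinEquiv (v, j)).val = 2 * v.val + j.val := by
    rw [finProdFinEquiv_apply_val, add_comm]
  have hsel := sum_piFinset_eq_selections (M := GraphSum 3) (w.map (expandCodes b)) (K := b * 2)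
    (by simp [hw, mul_comm])
    (fun i => splitTargets b (leibnizVertex b (w.getD i 0)))
    (fun i t => vertexOf 3 (b + 1 * 2) t hn)
    (fun i g => by
      have hi : i.val < w.length := by omega
      rw [sum_splitTargets b _ hn]
      simp [hi])
  have hcomp (F : (Fin b × Fin 2 → Fin 3 ⊕ Fin (b + 1 * 2)) → GraphSum 3) :
      ∑ τ ∈ Fintype.piFinset (fun e : Fin b × Fin 2 =>
        splitTargets b ((leibnizOf b w J hJ hb).wedge e.1 e.2)), F τ =
      ∑ τ ∈ Fintype.piFinset (fun i : Fin (b * 2) =>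
        splitTargets b (leibnizVertex b (w.getD i 0))),
        F fun e => τ (finProdFinEquiv e) := by
    symm
    refine Finset.sum_equiv (Equiv.arrowCongr finProdFinEquiv.symm (Equiv.refl _)) ?_ ?_
    · intro τ
      simp only [Fintype.mem_piFinset, Equiv.arrowCongr_apply, Equiv.coe_refl, Function.comp,
        Equiv.symm_symm, id]
      rw [finProdFinEquiv.symm.surjective.forall]
      refine forall_congr' fun i => ?_
      have : 2 * (finProdFinEquiv.symm i).1.val + (finProdFinEquiv.symm i).2.val = i.val := by
        rw [← hval, Prod.mk.eta, Equiv.apply_symm_apply]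
      simp only [leibnizOf, this, Equiv.apply_symm_apply]
    · intro τ _
      rfl
  -- The edges that leave the only Jacobiator end elsewhere, so the Leibniz rule leaves them no
  -- choice.
  have hθ : (Fintype.piFinset fun j : Fin 1 => Fintype.piFinset fun i : Fin 3 =>
      splitTargets b ((leibnizOf b w J hJ hb).jac j i)) =
        {fun _ i => vertexOf 3 (b + 1 * 2) (J i) hn} := by
    ext θ
    simp only [Fintype.mem_piFinset, Finset.mem_singleton]
    have (j : Fin 1) (i : Fin 3) : splitTargets b ((leibnizOf b w J hJ hb).jac j i) =
      {vertexOf 3 (b + 1 * 2) (J i) hn} := splitTargets_of_lt (hJlt i)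
    simp only [this, Finset.mem_singleton, funext_iff]
  rw [LeibnizGraph.expand, targets_leibnizOf, expandLists, list_sum_flatMap]
  have hsum (F : (Fin 1 → Fin 3) → GraphSum 3) : ∑ c : Fin 1 → Fin 3, F c =
      ((List.finRange 3).map fun c => F fun _ => c).sum := by
    rw [← Equiv.sum_comp (Equiv.funUnique (Fin 1) (Fin 3)).symm, Fin.sum_univ_def]
    rfl
  refine (hsum _).trans ?_
  congr 1
  refine List.map_congr_left fun c _ => ?_
  refine (sum_piFinset_curry (n := b) (r := 2)
    (fun v i => splitTargets b ((leibnizOf b w J hJ hb).wedge v i)) _).trans ?_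
  refine (hcomp _).trans ((hsel _).trans ?_)
  rw [List.map_map]
  congr 1
  refine List.map_congr_left fun y hy => ?_
  have hy' : y.length = 2 * b := by rw [length_of_mem_selections hy, List.length_map, hw]
  refine (Finset.sum_congr hθ fun _ _ => rfl).trans ?_
  refine (Finset.sum_singleton _ _).trans ?_
  refine congrArg (fun T => Finsupp.single (⟨b + 1 * 2, T⟩ : KGraph 3) (1 : ℝ)) (?_ :
    Fin.append (m := b) (n := 1 * 2)
      (fun v (j : Fin 2) => vertexOf 3 (b + 1 * 2) (y.getD (finProdFinEquiv (v, j)) 0) hn)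
      (fun u => if (finProdFinEquiv.symm u).2 = 0 then
          ![vertexOf 3 (b + 1 * 2) (J c) hn, vertexOf 3 (b + 1 * 2) (J (c + 1)) hn]
        else ![.inr (Fin.natAdd b (finProdFinEquiv ((finProdFinEquiv.symm u).1, 0))),
          vertexOf 3 (b + 1 * 2) (J (c + 2)) hn]) =
      fun v j => vertexOf 3 (b + 1 * 2)
        ((y ++ [J c, J (c + 1), 3 + b, J (c + 2)]).getD (2 * v.val + j.val) 0) hn)
  funext v j
  refine Fin.addCases (fun v => ?_) (fun u => ?_) v
  · rw [Fin.append_left, Fin.val_castAdd, List.getD_append _ _ _ _ (by omega), hval]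
  · rw [Fin.append_right, List.getD_append_right _ _ _ _ (by rw [Fin.val_natAdd]; omega)]
    obtain ⟨⟨k, e⟩, rfl⟩ := finProdFinEquiv.surjective u
    obtain rfl := Subsingleton.elim k 0
    have he : (finProdFinEquiv ((0 : Fin 1), e)).val = e.val := by
      rw [finProdFinEquiv_apply_val]; simp
    have hidx : 2 * (b + e.val) + j.val - y.length = 2 * e.val + j.val := by omega
    simp only [Fin.val_natAdd, he, hidx, Equiv.symm_apply_apply]
    have hj := (vertexOf_jac b 0).symm
    rw [Fin.val_zero, add_zero] at hj
    fin_cases e <;> fin_cases j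
    · rfl
    · rfl
    · exact hj
    · rfl

end LeibnizEnumeration

/-! ### Graphs modulo skew-symmetry and their normal forms -/

section GraphClasses

/-- The class of a graph modulo skew-symmetry. -/
def graphClass {m : ℕ} (Γ : KGraph m) : GraphSum m ⧸ skewRel m :=
  Submodule.Quotient.mk (Finsupp.single Γ 1)

lemma graphClass_relabel {m : ℕ} (Γ : KGraph m) (σ : Equiv.Perm (Fin Γ.n)) :
    graphClass (Γ.relabel σ) = graphClass Γ :=
  (Submodule.Quotient.eq _).2 (Submodule.subset_span (Or.inl ⟨Γ, σ, rfl⟩))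

lemma graphClass_swap {m : ℕ} (Γ : KGraph m) (v : Fin Γ.n) :
    graphClass (Γ.swap v) = - graphClass Γ := by
  rw [eq_neg_iff_add_eq_zero]
  exact (Submodule.Quotient.mk_eq_zero _).2 (Submodule.subset_span (Or.inr ⟨Γ, v, rfl⟩))

/-- The swaps of Left and Right at several vertices at once. -/
lemma graphClass_swaps {m n : ℕ} (tgt : Fin n → Fin 2 → Fin m ⊕ Fin n) (B : Finset (Fin n)) :
    graphClass ⟨n, fun v j => if v ∈ B then tgt v j.rev else tgt v j⟩ =
      (-1 : ℝ) ^ B.card • graphClass ⟨n, tgt⟩ := by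
  induction B using Finset.induction with
  | empty => simp
  | insert u B hu ih =>
    have := graphClass_swap ⟨n, fun v j => if v ∈ B then tgt v j.rev else tgt v j⟩ u
    rw [Finset.card_insert_of_notMem hu, pow_succ, mul_neg_one, neg_smul, ← ih, ← this]
    congr 2
    funext v j
    by_cases h : v = u
    · subst h
      simp [hu]
    · simp [h]

/-- The new number of the target `t` when the internal vertices are relabelled by a permutation
which is given by the list of its values. -/
def relabelCode (n : ℕ) (σ : List ℕ) (t : ℕ) : ℕ :=
  if t < 3 then t else 3 + σ.getD ((t - 3) % n) 0

/-- The octal digits of the targets, under the numbering `f`, of the consecutive internal vertices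
in a list, where the targets of every vertex are put in order; it comes with the parity of the
number of the transpositions. -/
def normalForm (f : ℕ → ℕ) (l : List ℕ) : List ℕ → Bool × ℕ
  | [] => (false, 0)
  | v :: T =>
    if f (l.getD (2 * v + 1) 0) < f (l.getD (2 * v) 0) then
      (!(normalForm f l T).1,
        f (l.getD (2 * v + 1) 0) + 8 * (f (l.getD (2 * v) 0) + 8 * (normalForm f l T).2))
    else
      ((normalForm f l T).1,
        f (l.getD (2 * v) 0) + 8 * (f (l.getD (2 * v + 1) 0) + 8 * (normalForm f l T).2))

/-- The graph with three sinks whose targets are the octal digits of a number. -/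
def digitGraph (n k : ℕ) : KGraph 3 :=
  ⟨n, fun v j => vertexOf 3 n (k / 8 ^ (2 * v.val + j.val) % 8) v.pos⟩

lemma normalForm_digit (f : ℕ → ℕ) (hf : ∀ t, f t < 8) (l : List ℕ) :
    ∀ (T : List ℕ) (u : ℕ) (_ : u < T.length) (j : Fin 2),
      (normalForm f l T).2 / 8 ^ (2 * u + j.val) % 8 =
        if f (l.getD (2 * T.getD u 0 + 1) 0) < f (l.getD (2 * T.getD u 0) 0) then
          f (l.getD (2 * T.getD u 0 + j.rev.val) 0)
        else f (l.getD (2 * T.getD u 0 + j.val) 0) := by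
  -- Each vertex contributes two octal digits, the lowest ones for the head of the list; the others
  -- shift by one vertex.
  have key : ∀ a b r u j : ℕ, a < 8 → b < 8 → j < 2 → (a + 8 * (b + 8 * r)) / 8 ^ (2 * u + j) % 8 =
      if u = 0 then (if j = 0 then a else b) else r / 8 ^ (2 * (u - 1) + j) % 8 := by
    intro a b r u j ha hb hj
    have e1 : (a + 8 * (b + 8 * r)) / 8 = b + 8 * r := by omega
    have e2 : (b + 8 * r) / 8 = r := by omega
    rcases u with _ | u
    · interval_cases j
      · simp; omega
      · simp [e1]; omega
    · have : 2 * (u + 1) + j = 1 + (1 + (2 * u + j)) := by ring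
      rw [this, pow_add, ← Nat.div_div_eq_div_mul, pow_one, e1, pow_add, ← Nat.div_div_eq_div_mul,
        pow_one, e2]
      simp
  intro T
  induction T with
  | nil => intro u hu; simp at hu
  | cons v T ih =>
    intro u hu j
    rw [normalForm]
    rcases u with _ | u
    · simp only [List.getD_cons_zero]
      split_ifs with h <;> rw [key _ _ _ _ _ (hf _) (hf _) j.2] <;> fin_cases j <;> simp
    · have := ih u (by simpa using hu) j
      simp only [List.getD_cons_succ]
      rw [← this]
      split_ifs with h <;> rw [key _ _ _ _ _ (hf _) (hf _) j.2] <;> simp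

/-- The Boolean records the parity of the number of vertices at which Left and Right had to be
exchanged. -/
lemma normalForm_sign (f : ℕ → ℕ) (l : List ℕ) : ∀ (T : List ℕ),
    (if (normalForm f l T).1 then (-1 : ℝ) else 1) = (-1) ^ (Finset.univ.filter fun u : Fin T.length =>
      f (l.getD (2 * T.getD u 0 + 1) 0) < f (l.getD (2 * T.getD u 0) 0)).card := by
  intro T
  induction T with
  | nil => simp [normalForm]
  | cons v T ih =>
    rw [Finset.card_filter] at ih ⊢
    simp only [List.length_cons]
    rw [Fin.sum_univ_succ, normalForm, pow_add]
    simp only [Fin.val_zero, List.getD_cons_zero, Fin.val_succ, List.getD_cons_succ]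
    rw [← ih]
    by_cases h : f (l.getD (2 * v + 1) 0) < f (l.getD (2 * v) 0)
    · simp only [h, if_true]
      cases (normalForm f l T).1 <;> norm_num
    · simp only [h, if_false]
      rw [pow_zero, one_mul]

/-- The data of a permutation of `0, …, n - 1`, as the lists of its values and of the values of its
inverse. -/
def IsPermData (n : ℕ) (q : List ℕ × List ℕ) : Prop :=
  q.1.length = n ∧ q.2.length = n ∧ ∀ v < n, q.1.getD v 0 < n ∧ q.2.getD v 0 < n ∧
    q.1.getD (q.2.getD v 0) 0 = v ∧ q.2.getD (q.1.getD v 0) 0 = v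

instance (n : ℕ) : DecidablePred (IsPermData n) := fun q => by
  unfold IsPermData; infer_instance

/-- Renumbering does not change the class, and sorting the two targets at each vertex costs one sign
per exchange. Nothing requires the resulting code to be canonical: every permutation gives a valid
identity. -/
theorem graphClass_graphOf {n : ℕ} (hn : n ≤ 4) (l : List ℕ) {q : List ℕ × List ℕ}
    (hq : IsPermData n q) :
    graphClass (graphOf 3 n l) =
      (if (normalForm (relabelCode n q.1) l q.2).1 then (-1 : ℝ) else 1) •
        graphClass (digitGraph n (normalForm (relabelCode n q.1) l q.2).2) := by
  obtain ⟨σ, T⟩ := q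
  obtain ⟨-, rfl, hq⟩ := hq
  simp only at hn hq ⊢
  set n := T.length with hnT
  set f := relabelCode n σ with hfdef
  let τ : Equiv.Perm (Fin n) :=
    ⟨fun v => ⟨σ.getD v 0, (hq v v.2).1⟩, fun v => ⟨T.getD v 0, (hq v v.2).2.1⟩,
      fun v => Fin.ext (hq v v.2).2.2.2, fun v => Fin.ext (hq v v.2).2.2.1⟩
  have hf8 : ∀ t, 0 < n → f t < 3 + n := by
    intro t h0
    simp only [hfdef, relabelCode]
    split_ifs
    · omega
    · have := (hq ((t - 3) % n) (Nat.mod_lt _ h0)).1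
      omega
  -- Three sinks and at most four internal vertices give numbers below 7, so octal digits suffice.
  have hf : ∀ t, 0 < n → f t < 8 := fun t h0 => (hf8 t h0).trans_le (by omega)
  have hv : ∀ t (h0 : 0 < n), vertexOf 3 n (f t) h0 = Sum.map id τ (vertexOf 3 n t h0) := by
    intro t h0
    by_cases h : t < 3
    · have : f t = t := by simp [hfdef, relabelCode, h]
      rw [this]
      simp [vertexOf, h]
    · have : f t = 3 + σ.getD ((t - 3) % n) 0 := by simp only [hfdef, relabelCode, h, if_false]
      have hlt := (hq ((t - 3) % n) (Nat.mod_lt _ h0)).1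
      rw [this, vertexOf, dif_neg (by omega), vertexOf, dif_neg h, Sum.map_inr]
      congr 1
      apply Fin.ext
      change (3 + _ - 3) % n = σ.getD ((t - 3) % n) 0
      rw [Nat.add_sub_cancel_left, Nat.mod_eq_of_lt hlt]
  rw [← graphClass_relabel (graphOf 3 n l) τ]
  have hrel : (graphOf 3 n l).relabel τ =
      ⟨n, fun u j => vertexOf 3 n (f (l.getD (2 * T.getD u 0 + j.val) 0)) u.pos⟩ := by
    simp only [KGraph.relabel, graphOf]
    congr 1
    funext u j
    rw [hv]
    rfl
  rw [hrel, normalForm_sign]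
  set B := Finset.univ.filter fun u : Fin T.length =>
      f (l.getD (2 * T.getD u 0 + 1) 0) < f (l.getD (2 * T.getD u 0) 0) with hB
  have hdig : digitGraph n (normalForm f l T).2 = ⟨n, fun u j => if u ∈ B then
      (fun u (j : Fin 2) => vertexOf 3 n (f (l.getD (2 * T.getD u.val 0 + j.val) 0)) u.pos) u j.rev
      else (fun u (j : Fin 2) =>
        vertexOf 3 n (f (l.getD (2 * T.getD u.val 0 + j.val) 0)) u.pos) u j⟩ := by
    simp only [digitGraph]
    congr 1
    funext u j
    have := normalForm_digit f (fun t => hf t u.pos) l T u u.2 j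
    rw [this]
    simp only [hB, Finset.mem_filter, Finset.mem_univ, true_and]
    split_ifs <;> rfl
  rw [hdig]
  refine Eq.trans ?_ (congrArg (fun x => (-1 : ℝ) ^ B.card • x) (graphClass_swaps _ B).symm)
  -- The sign of the exchanges occurs twice and cancels.
  rw [smul_smul, ← mul_pow, neg_one_mul, neg_neg, one_pow, one_smul]

end GraphClasses

/-! ### A verified checker for identities of graph sums modulo skew-symmetry -/

section Certificate

/-- The permutations of `0, …, n - 1` for `n ≤ 4`, together with their inverses. -/
def permTable : ℕ → List (List ℕ × List ℕ)
  | 1 => [([0], [0])]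
  | 2 => [([0,1], [0,1]), ([1,0], [1,0])]
  | 3 => [([0,1,2], [0,1,2]), ([0,2,1], [0,2,1]), ([1,0,2], [1,0,2]), ([1,2,0], [2,0,1]),
      ([2,0,1], [1,2,0]), ([2,1,0], [2,1,0])]
  | 4 => [([0,1,2,3], [0,1,2,3]), ([0,1,3,2], [0,1,3,2]), ([0,2,1,3], [0,2,1,3]), ([0,2,3,1], [0,3,1,2]),
      ([0,3,1,2], [0,2,3,1]), ([0,3,2,1], [0,3,2,1]), ([1,0,2,3], [1,0,2,3]), ([1,0,3,2], [1,0,3,2]),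
      ([1,2,0,3], [2,0,1,3]), ([1,2,3,0], [3,0,1,2]), ([1,3,0,2], [2,0,3,1]), ([1,3,2,0], [3,0,2,1]),
      ([2,0,1,3], [1,2,0,3]), ([2,0,3,1], [1,3,0,2]), ([2,1,0,3], [2,1,0,3]), ([2,1,3,0], [3,1,0,2]),
      ([2,3,0,1], [2,3,0,1]), ([2,3,1,0], [3,2,0,1]), ([3,0,1,2], [1,2,3,0]), ([3,0,2,1], [1,3,2,0]),
      ([3,1,0,2], [2,1,3,0]), ([3,1,2,0], [3,1,2,0]), ([3,2,0,1], [2,3,1,0]), ([3,2,1,0], [3,2,1,0])]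
  | _ => []

/-- The `h`-th permutation of `0, …, n - 1` in the table, or else the identity. -/
def permData (n h : ℕ) : List ℕ × List ℕ := (permTable n).getD h (List.range n, List.range n)

/-- Every number, also one outside the table, yields a permutation; hence the numbers stored in the
certificates need no validation. -/
lemma isPermData_permData {n : ℕ} (hn : n ≤ 4) (h : ℕ) : IsPermData n (permData n h) := by
  have hid : IsPermData n (List.range n, List.range n) := by
    refine ⟨by simp, by simp, fun v hv => ?_⟩
    simp [hv]
  have htab : ∀ n ≤ 4, ∀ q ∈ permTable n, IsPermData n q := by decide +kernel
  rw [permData]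
  by_cases hh : h < (permTable n).length
  · rw [List.getD_eq_getElem _ _ hh]
    exact htab n hn _ (List.getElem_mem hh)
  · rw [List.getD_eq_default _ _ (by omega)]
    exact hid

/-- The class of the graph which is encoded by a number: its lowest octal digit is the number of
internal vertices, the others are the targets of the edges. -/
def keyClass (k : ℕ) : GraphSum 3 ⧸ skewRel 3 := graphClass (digitGraph (k % 8) (k / 8))

/-- The normal form of a graph with `n` internal vertices, where the vertices are renumbered by the
`h`-th permutation. -/
def keyOf (n h : ℕ) (l : List ℕ) : Bool × ℕ :=
  let q := permData n h
  let r := normalForm (relabelCode n q.1) l q.2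
  (r.1, n + 8 * r.2)

/-- The identity holds for all `h`. The choice of `h` matters only for whether equivalent graphs
receive the same key and so cancel. -/
lemma graphClass_eq_keyClass {n : ℕ} (hn : n ≤ 4) (h : ℕ) (l : List ℕ) :
    graphClass (graphOf 3 n l) =
      (if (keyOf n h l).1 then (-1 : ℝ) else 1) • keyClass (keyOf n h l).2 := by
  rw [graphClass_graphOf hn l (isPermData_permData hn h)]
  have h1 : (keyOf n h l).2 % 8 = n := by simp only [keyOf]; omega
  have h2 : (keyOf n h l).2 / 8 =
      (normalForm (relabelCode n (permData n h).1) l (permData n h).2).2 := by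
    simp only [keyOf]; omega
  rw [keyClass, h1, h2]
  rfl

/-- Binary search trees of coefficients of graphs. -/
inductive KeyTree
  | leaf
  | node (l : KeyTree) (k : ℕ) (v : ℤ) (r : KeyTree)

/-- The linear combination of graphs which is stored in a tree. -/
def KeyTree.total : KeyTree → GraphSum 3 ⧸ skewRel 3
  | leaf => 0
  | node l k v r => l.total + (v : ℝ) • keyClass k + r.total

/-- The value of `c` at `n`; the kernel evaluates `n` first. -/
def evalNat (n : ℕ) (c : ℕ → Bool) : Bool := Nat.rec (c 0) (fun m _ => c (m + 1)) n

lemma evalNat_eq (n : ℕ) (c : ℕ → Bool) : evalNat n c = c n := by cases n <;> rfl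

/-- The value of `c` at `z`; the kernel evaluates `z` first. -/
def evalInt (z : ℤ) (c : ℤ → Bool) : Bool :=
  match z with
  | .ofNat n => evalNat n fun n => c (.ofNat n)
  | .negSucc n => evalNat n fun n => c (.negSucc n)

lemma evalInt_eq (z : ℤ) (c : ℤ → Bool) : evalInt z c = c z := by
  cases z <;> simp [evalInt, evalNat_eq]

/-- The number by which the keys are ordered in the trees, which keeps these balanced. -/
def scramble (k : ℕ) : ℕ := Nat.mod (Nat.mul k 77777) 1000003

/-- The addition of `v` to the coefficient of the graph with number `k`, in continuation-passing
style. -/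
def KeyTree.add (t : KeyTree) : ℕ → ℤ → (KeyTree → Bool) → Bool :=
  KeyTree.rec (fun k v c => c (node leaf k v leaf))
    (fun l k' v' r addL addR k v c =>
      bif Nat.beq k k' then evalInt (v' + v) fun w => c (node l k' w r)
      else bif Nat.ble (scramble k) (scramble k') then addL k v fun l' => c (node l' k' v' r)
      else addR k v fun r' => c (node l k' v' r')) t

lemma KeyTree.add_node (l r : KeyTree) (k k' : ℕ) (v v' : ℤ) (c : KeyTree → Bool) :
    (node l k' v' r).add k v c =
      bif Nat.beq k k' then evalInt (v' + v) fun w => c (node l k' w r)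
      else bif Nat.ble (scramble k) (scramble k') then l.add k v fun l' => c (node l' k' v' r)
      else r.add k v fun r' => c (node l k' v' r') := rfl

/-- A specification in continuation-passing style: the result is some tree with the right total, and
every continuation is called with it. The order of the keys plays no role here; a misplaced key
would only be stored twice. -/
lemma KeyTree.exists_add (t : KeyTree) (k : ℕ) (v : ℤ) :
    ∃ t' : KeyTree, t'.total = t.total + (v : ℝ) • keyClass k ∧ ∀ c, t.add k v c = c t' := by
  induction t with
  | leaf => exact ⟨node leaf k v leaf, by simp [total], fun c => rfl⟩
  | node l k' v' r ihl ihr =>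
    obtain ⟨l', hl, hl'⟩ := ihl
    obtain ⟨r', hr, hr'⟩ := ihr
    rcases h : Nat.beq k k' with _ | _
    · rcases h' : Nat.ble (scramble k) (scramble k') with _ | _
      · refine ⟨node l k' v' r', by simp only [total, hr]; abel, fun c => ?_⟩
        simp only [add_node, h, h', cond_false, hr']
      · refine ⟨node l' k' v' r, by simp only [total, hl]; abel, fun c => ?_⟩
        simp only [add_node, h, h', cond_false, cond_true, hl']
    · refine ⟨node l k' (v' + v) r, ?_, fun c => ?_⟩
      · rw [Nat.eq_of_beq_eq_true h]
        simp only [total, Int.cast_add, add_smul]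
        abel
      · simp only [add_node, h, cond_true, evalInt_eq]

/-- The number with the given octal digits. -/
def encode (l : List ℕ) : ℕ := List.rec 0 (fun a _ k => Nat.add a (Nat.mul 8 k)) l

/-- The `i`-th octal digit of a number. -/
def octal (k i : ℕ) : ℕ := Nat.mod (Nat.div k (Nat.pow 8 i)) 8

lemma octal_encode {l : List ℕ} (hl : ∀ t ∈ l, t < 8) (i : ℕ) :
    octal (encode l) i = l.getD i 0 := by
  change encode l / 8 ^ i % 8 = _
  induction l generalizing i with
  | nil => simp [encode]
  | cons a l ih =>
    have h : encode (a :: l) = a + 8 * encode l := rfl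
    have ha := hl a (by simp)
    rcases i with _ | i
    · rw [h, pow_zero, Nat.div_one, List.getD_cons_zero]
      omega
    · rw [h, pow_succ', ← Nat.div_div_eq_div_mul, List.getD_cons_succ,
        ← ih (fun t ht => hl t (by simp [ht]))]
      congr 2
      omega

/-- The value of `c` at the normal form of the graph whose targets are the octal digits of `L`,
where the new number of `t` is the `t`-th octal digit of `S`. -/
def evalForm (S L : ℕ) (T : List ℕ) : (Bool → ℕ → Bool) → Bool :=
  List.rec (fun c => c false 0) (fun v _ ev c =>
    evalNat (octal S (octal L (Nat.mul 2 v))) fun a =>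
      evalNat (octal S (octal L (Nat.succ (Nat.mul 2 v)))) fun b =>
        ev fun s k =>
          bif Nat.ble a b then c s (Nat.add a (Nat.mul 8 (Nat.add b (Nat.mul 8 k))))
          else c (!s) (Nat.add b (Nat.mul 8 (Nat.add a (Nat.mul 8 k))))) T

/-- `S` tabulates the renumbering by its octal digits, so that the new number of a target is found
by arithmetic on numerals alone. -/
lemma evalForm_eq {f : ℕ → ℕ} {l : List ℕ} {S L : ℕ}
    (h : ∀ i, octal S (octal L i) = f (l.getD i 0)) (T : List ℕ) :
    ∀ c, evalForm S L T c = c (normalForm f l T).1 (normalForm f l T).2 := by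
  induction T with
  | nil => exact fun c => rfl
  | cons v T ih =>
    intro c
    have h1 : evalForm S L (v :: T) c =
      evalNat (octal S (octal L (2 * v))) fun a => evalNat (octal S (octal L (2 * v + 1))) fun b =>
        evalForm S L T fun s k => bif Nat.ble a b then c s (a + 8 * (b + 8 * k))
          else c (!s) (b + 8 * (a + 8 * k)) := rfl
    rw [h1, evalNat_eq, evalNat_eq, ih, h, h, normalForm]
    by_cases hab : f (l.getD (2 * v + 1) 0) < f (l.getD (2 * v) 0)
    · have : Nat.ble (f (l.getD (2 * v) 0)) (f (l.getD (2 * v + 1) 0)) = false := by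
        rw [← Bool.not_eq_true, Nat.ble_eq]
        omega
      rw [this, if_pos hab]
      rfl
    · have : Nat.ble (f (l.getD (2 * v) 0)) (f (l.getD (2 * v + 1) 0)) = true := by
        rw [Nat.ble_eq]
        omega
      rw [this, if_neg hab]
      rfl

/-- The value of `c` at `keyOf n h l`, for a graph with at most four internal vertices. -/
def evalKey (n h : ℕ) (l : List ℕ) (c : Bool → ℕ → Bool) : Bool :=
  evalNat (encode ([0, 1, 2] ++ (permData n h).1.map (3 + ·))) fun S =>
    evalNat (encode l) fun L =>
      evalForm S L (permData n h).2 fun s k => evalNat (Nat.add n (Nat.mul 8 k)) fun k => c s k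

lemma evalKey_eq {n : ℕ} (hn : n ≤ 4) (h : ℕ) {l : List ℕ} (hl : ∀ t ∈ l, t < 3 + n)
    (c : Bool → ℕ → Bool) : evalKey n h l c = c (keyOf n h l).1 (keyOf n h l).2 := by
  obtain ⟨hlen, -, hp⟩ := isPermData_permData hn h
  have hS : ∀ t ∈ [0, 1, 2] ++ (permData n h).1.map (3 + ·), t < 8 := by
    intro t ht
    rcases List.mem_append.1 ht with ht | ht
    · simp only [List.mem_cons, List.not_mem_nil, or_false] at ht
      omega
    · obtain ⟨u, hu, rfl⟩ := List.mem_map.1 ht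
      obtain ⟨i, hi, rfl⟩ := List.getElem_of_mem hu
      have := (hp i (by omega)).1
      rw [List.getD_eq_getElem _ _ hi] at this
      omega
  rw [evalKey, evalNat_eq, evalNat_eq,
    evalForm_eq (f := relabelCode n (permData n h).1) (l := l) (fun i => ?_), evalNat_eq]
  · rfl
  · rw [octal_encode fun t ht => (hl t ht).trans_le (by omega), octal_encode hS]
    have ht : l.getD i 0 < 3 + n := by
      by_cases hi : i < l.length
      · rw [List.getD_eq_getElem _ _ hi]
        exact hl _ (List.getElem_mem hi)
      · rw [List.getD_eq_default _ _ (by omega)]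
        omega
    generalize l.getD i 0 = t at ht
    by_cases h3 : t < 3
    · rw [relabelCode, if_pos h3]
      interval_cases t <;> rfl
    · have hlt : t - 3 < (permData n h).1.length := by omega
      rw [relabelCode, if_neg h3, Nat.mod_eq_of_lt (by omega),
        List.getD_append_right _ _ _ _ (by simpa using h3)]
      simp [hlt]

/-- The addition of graphs with a common coefficient; the digits of `h` are the numbers of the
permutations by which their internal vertices are renumbered. -/
def addGraphs (n : ℕ) (v : ℤ) : List (List ℕ) → ℕ → KeyTree → (KeyTree → Bool) → Bool
  | [], _, t, c => c t
  | l :: L, h, t, c =>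
    evalNat (h % 24) fun d => evalNat (h / 24) fun h' =>
      evalKey n d l fun s k =>
        t.add k (bif s then -v else v) fun t' => addGraphs n v L h' t' c

lemma exists_addGraphs {n : ℕ} (hn : n ≤ 4) (v : ℤ) (L : List (List ℕ))
    (hL : ∀ l ∈ L, ∀ t ∈ l, t < 3 + n) :
    ∀ (h : ℕ) (t : KeyTree), ∃ t' : KeyTree,
      t'.total = t.total + (v : ℝ) • (L.map fun l => graphClass (graphOf 3 n l)).sum ∧
      ∀ c, addGraphs n v L h t c = c t' := by
  induction L with
  | nil => exact fun h t => ⟨t, by simp, fun c => rfl⟩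
  | cons l L ih =>
    intro h t
    obtain ⟨t₁, h₁, h₁'⟩ := t.exists_add (keyOf n (h % 24) l).2
      (bif (keyOf n (h % 24) l).1 then -v else v)
    obtain ⟨t₂, h₂, h₂'⟩ := ih (fun l hl => hL l (by simp [hl])) (h / 24) t₁
    refine ⟨t₂, ?_, fun c => ?_⟩
    · rw [h₂, h₁, List.map_cons, List.sum_cons, smul_add, ← add_assoc,
        graphClass_eq_keyClass hn (h % 24) l, smul_smul]
      congr 3
      cases (keyOf n (h % 24) l).1 <;> simp
    · simp only [addGraphs, evalNat_eq, evalKey_eq hn _ (hL l (by simp)), h₁', h₂']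

/-- A family of graphs with `n` internal vertices and a common coefficient `v`, with the numbers of
permutations of their vertices. -/
structure GraphFamily where
  n : ℕ
  v : ℤ
  lists : List (List ℕ)
  perms : ℕ

/-- The condition that the members of a family are graphs with at most four internal vertices. -/
def GraphFamily.IsValid (e : GraphFamily) : Prop :=
  e.n ≤ 4 ∧ ∀ l ∈ e.lists, ∀ t ∈ l, t < 3 + e.n

/-- The sum of the graphs in a family. -/
def GraphFamily.total (e : GraphFamily) : GraphSum 3 ⧸ skewRel 3 :=
  (e.v : ℝ) • (e.lists.map fun l => graphClass (graphOf 3 e.n l)).sum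

/-- The addition of several families of graphs. -/
def addFamilies : List GraphFamily → KeyTree → (KeyTree → Bool) → Bool
  | [], t, c => c t
  | e :: E, t, c => evalInt e.v fun v =>
      match v with
      | .ofNat 0 => addFamilies E t c
      | v => addGraphs e.n v e.lists e.perms t fun t' => addFamilies E t' c

lemma exists_addFamilies (E : List GraphFamily) (hE : ∀ e ∈ E, e.IsValid) :
    ∀ t : KeyTree, ∃ t' : KeyTree, t'.total = t.total + (E.map GraphFamily.total).sum ∧
      ∀ c, addFamilies E t c = c t' := by
  induction E with
  | nil => exact fun t => ⟨t, by simp, fun c => rfl⟩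
  | cons e E ih =>
    intro t
    obtain ⟨t₁, h₁, h₁'⟩ := exists_addGraphs (hE e (by simp)).1 e.v e.lists
      (hE e (by simp)).2 e.perms t
    -- The checker skips families with coefficient zero without enumerating their graphs.
    by_cases hv : e.v = 0
    · obtain ⟨t₂, h₂, h₂'⟩ := ih (fun e he => hE e (by simp [he])) t
      refine ⟨t₂, ?_, fun c => ?_⟩
      · simp [h₂, GraphFamily.total, hv]
      · simp only [addFamilies, evalInt_eq, hv]
        exact h₂' c
    · obtain ⟨t₂, h₂, h₂'⟩ := ih (fun e he => hE e (by simp [he])) t₁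
      refine ⟨t₂, ?_, fun c => ?_⟩
      · rw [h₂, h₁, List.map_cons, List.sum_cons, add_assoc]
        rfl
      · simp only [addFamilies, evalInt_eq]
        split
        · rename_i h; exact absurd h hv
        · rw [h₁', h₂']

/-- Whether a graph with four internal vertices has an odd symmetry: it turns into itself, with the
opposite sign, under the `h`-th permutation. -/
def isOdd (e : List ℕ × ℕ) : Bool :=
  ((keyOf 4 0 e.1).1 != (keyOf 4 e.2 e.1).1) && Nat.beq (keyOf 4 0 e.1).2 (keyOf 4 e.2 e.1).2

/-- Two renumberings of one graph lead to the same key with opposite signs, so the class is its own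
negative, and a real vector space has no 2-torsion. -/
lemma keyClass_eq_zero {e : List ℕ × ℕ} (he : isOdd e = true) : keyClass (keyOf 4 0 e.1).2 = 0 := by
  rw [isOdd, Bool.and_eq_true] at he
  have h := (graphClass_eq_keyClass le_rfl 0 e.1).symm.trans
    (graphClass_eq_keyClass le_rfl e.2 e.1)
  rw [← Nat.eq_of_beq_eq_true he.2] at h
  have h1 := he.1
  rw [bne_iff_ne] at h1
  have h2 : (2 : ℝ) • keyClass (keyOf 4 0 e.1).2 = 0 := by
    revert h h1
    cases (keyOf 4 0 e.1).1 <;> cases (keyOf 4 e.2 e.1).1 <;> intro h h1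
    · exact absurd rfl h1
    · simp only [if_true, Bool.false_eq_true, if_false, one_smul, neg_smul] at h
      rw [two_smul]; nth_rewrite 1 [h]; simp
    · simp only [if_true, Bool.false_eq_true, if_false, one_smul, neg_smul] at h
      rw [two_smul]; nth_rewrite 1 [← h]; simp
    · exact absurd rfl h1
  exact (smul_eq_zero.1 h2).resolve_left two_ne_zero

/-- Whether the coefficients in a tree are zero, except for those of the given graphs with odd
symmetries. -/
def KeyTree.vanishes (O : List (List ℕ × ℕ)) : KeyTree → Bool
  | leaf => true
  | node l k v r => l.vanishes O && r.vanishes O &&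
      (match v with
        | .ofNat 0 => true
        | _ => O.any fun e => isOdd e && Nat.beq (keyOf 4 0 e.1).2 k)

lemma KeyTree.total_eq_zero {O : List (List ℕ × ℕ)} {t : KeyTree} (h : t.vanishes O = true) :
    t.total = 0 := by
  induction t with
  | leaf => rfl
  | node l k v r ihl ihr =>
    simp only [vanishes, Bool.and_eq_true] at h
    obtain ⟨⟨hl, hr⟩, hv⟩ := h
    rw [total, ihl hl, ihr hr, zero_add, add_zero]
    split at hv
    · simp
    · obtain ⟨e, -, he⟩ := List.any_eq_true.1 hv
      rw [Bool.and_eq_true] at he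
      rw [← Nat.eq_of_beq_eq_true he.2, keyClass_eq_zero he.1, smul_zero]

/-- Soundness of the checker: success means that the accumulated tree represents zero, and this tree
has the same total as the families. -/
theorem sum_total_eq_zero {O : List (List ℕ × ℕ)} {E : List GraphFamily}
    (hE : ∀ e ∈ E, e.IsValid) (h : addFamilies E .leaf (KeyTree.vanishes O) = true) :
    (E.map GraphFamily.total).sum = 0 := by
  obtain ⟨t, ht, hc⟩ := exists_addFamilies E hE .leaf
  rw [hc] at h
  rw [← KeyTree.total_eq_zero h, ht]
  simp [KeyTree.total]

end Certificate

/-! ### The data of the certificate -/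

section Tables

/-- The pairs of graphs in the constant part of the star-product which contribute to the associator
modulo `o(ℏ⁴)`. -/
def constPairs : List ((List ℕ × ℚ) × (List ℕ × ℚ)) :=
  starConst.flatMap fun e => (starConst.filter fun e' => Nat.ble (e.1.length + e'.1.length) 8).map
    fun e' => (e, e')

/-- The permutations (as digits to the base 24) which bring the graphs in the two actions of the
pairs in `constPairs` to their normal forms. -/
def constPerms : List (ℕ × ℕ) :=
  [
   (0, 0), (0, 0), (0, 0), (0, 0), (0, 0), (0, 0), (0, 0), (0, 0), (0, 0), (0, 0), (0, 0),
   (0, 0), (0, 0), (0, 0), (0, 0), (0, 0), (0, 0), (0, 0), (0, 0), (0, 0), (0, 0), (0, 0),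
   (0, 0), (0, 0), (0, 0), (0, 0), (0, 0), (0, 0), (0, 0), (0, 0), (0, 0), (0, 0), (0, 0),
   (0, 0), (0, 0), (0, 0), (0, 0), (0, 0), (0, 0), (0, 601), (27648, 70923), (1, 70923),
   (25, 70923), (3, 70923), (2737152, 5852961), (1, 5852961), (25, 5852961), (3, 7926561),
   (663555, 5852961), (663627, 5852961), (346203, 5852961), (346251, 5852961), (3, 5935905),
   (27, 7843617), (33, 5852961), (9, 7843617), (346209, 5852961), (576, 576),
   (4777588224, 244071749476), (3056570481440157225984, 10349553677982852372880),
   (22021772475976622260, 7320409980246575733136),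
   (23774754446110081252, 7320409980246575733136),
   (22240895221046923984, 7278335369831190288784), (576, 0), (4777588224, 2980),
   (3161749082056000164864, 328144), (913011437784629426, 328144), (1059093277402513588, 328144),
   (913011437790024400, 328144), (0, 0), (0, 229722394802), (82944, 7375296867468687410888),
   (2, 7375296867661319791306), (50, 7375296872944950797050), (8, 7375296867441171153616),
   (0, 0), (576, 2404), (97344, 313744), (14400, 313744), (14404, 313744), (14400, 313744),
   (590561856, 590561856),
   (100151081102399986866384024111429120, 5110372994102842933202071814053186626),
   (590561856, 1152), (100150888142941530517407685992003072, 1756393899138), (1152, 16588800),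
   (9555176448, 4810263050490035234661481434079913004), (2304, 0), (129193630272, 689266890306),
   (589898304, 0), (100146256766981224162751218612188672, 8514), (0, 191103552),
   (0, 4843142633295345318767553532445124630), (1152, 0), (9555176448, 8364), (0, 0),
   (0, 689167184406), (2304, 0), (129193630272, 689266890306), (1152, 0),
   (119638453824, 1608040145964), (0, 0), (1152, 1378334368812), (2880, 0), (244038569472, 7362),
   (0, 0), (1152, 7212), (196927701389665321536, 196927701389665321536),
   (196927701389665321536, 1580582016), (1580582016, 7313613016966963200),
   (3111397632, 49766400), (196708578644597097024, 3456), (3456, 21045310545182589504),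
   (1580582016, 3456), (3456, 49766400), (3111397632, 49766400), (1580582016, 49766400),
   (6912, 0), (4496894784, 0), (6912, 0), (322924421835278995392, 4032), (1580582016, 49766400),
   (3107416320, 0), (4032, 147261153075412602816), (6912, 0), (9216, 9216)]

/-- The permutations (as digits to the base 24) which bring the graphs in the two actions of the
graphs in `starPrime` to their normal forms. -/
def primePerms : List (ℕ × ℕ) :=
  [
   (1580582016, 3456), (3456, 49766400), (1580582016, 3456), (3456, 49766400), (3456, 3456),
   (3456, 3456), (4032, 4032), (196708181713014178368, 0), (0, 65006281840152232512),
   (322924532350894424640, 0), (0, 65006281840152232512), (1578591360, 0), (3456, 191103552),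
   (1578591360, 0), (6912, 0), (1578591360, 0), (0, 382207104), (328328043114671972928, 0),
   (0, 64933241145279455808), (496941980990958490176, 0), (0, 107114242434308002368),
   (2727863424, 0), (3456, 191103552), (2727863424, 0), (6912, 0), (2727863424, 0), (10368, 0),
   (2727863424, 0), (0, 382207104), (2727863424, 0), (0, 382207104), (2727863424, 0),
   (0, 382207104), (3107416320, 0), (4032, 191103552), (4254034176, 0), (6912, 0),
   (3107416320, 0), (0, 764414208), (3107416320, 0), (0, 764414208), (4254034176, 0),
   (0, 764414208), (3456, 0), (3456, 0), (3456, 0), (3456, 191103552), (3348286272, 0),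
   (3456, 191103552), (3206949120, 0), (3456, 0), (6912, 0), (3456, 0), (6912, 0), (3456, 0),
   (6912, 0), (3456, 0), (6912, 0), (3456, 0), (6912, 0), (3456, 0), (10368, 0), (3456, 0),
   (0, 0), (3456, 0), (0, 0), (3456, 0), (0, 0), (3456, 0), (0, 0), (4032, 0), (0, 0), (3456, 0),
   (0, 0), (2774975616, 0), (0, 382207104), (3206949120, 0), (0, 764414208), (3206949120, 0),
   (0, 764414208), (6912, 0), (6912, 0), (10368, 0), (6912, 0), (10368, 0), (6912, 0),
   (3348286272, 0), (0, 955517760), (6912, 0), (6912, 0), (6912, 0), (0, 0), (6912, 0), (0, 0),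
   (6912, 0), (0, 0), (6912, 0), (0, 0), (6912, 0), (0, 0), (6912, 0), (0, 0), (10368, 0),
   (0, 0), (10368, 0), (0, 0), (0, 0), (0, 0), (0, 0), (0, 0), (1578594816, 0), (0, 0),
   (1578594816, 0), (0, 0), (1578594816, 0), (0, 0), (3107414016, 0), (0, 0), (3456, 576),
   (12096, 0), (4032, 4032), (13248, 13248), (3456, 576), (10368, 0), (3456, 0), (0, 0),
   (3456, 0), (0, 0), (3456, 0), (0, 0), (3456, 0), (0, 0), (1628361216, 0), (0, 0),
   (3206946816, 0), (0, 0), (4353564672, 0), (0, 0), (4353564672, 0), (0, 191103552),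
   (4115681280, 0), (0, 0), (3348283392, 0), (0, 0), (6912, 0), (12096, 0), (6912, 0),
   (12672, 12672), (6912, 0), (10368, 0), (6912, 0), (0, 0), (6912, 0), (0, 0), (6912, 0),
   (0, 0), (4115681280, 0), (0, 191103552), (4496891904, 0), (0, 191103552), (6912, 0),
   (12672, 12672), (6912, 0), (8064, 0), (6912, 0), (6912, 0), (0, 0), (6912, 0), (0, 0),
   (6912, 0), (0, 0), (4546326528, 0), (0, 191103552), (10368, 0), (10368, 0), (0, 576),
   (10368, 0), (0, 0), (10368, 0), (0, 0), (6912, 0), (0, 0), (6912, 0), (0, 0), (6912, 0),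
   (0, 576), (6912, 0), (0, 0), (6912, 0), (0, 0), (6912, 0), (0, 0), (10368, 0), (0, 0),
   (10368, 0), (0, 0), (10368, 0), (0, 0), (2982666816, 0), (0, 191103552), (8064, 0), (8064, 0),
   (9216, 9216), (8064, 0), (0, 0), (8064, 0), (0, 0), (8064, 0), (0, 0), (9216, 0), (0, 0),
   (9216, 0), (0, 0), (12672, 0), (0, 0), (0, 0), (0, 0), (0, 0), (0, 0), (0, 0), (0, 0),
   (9216, 9216), (9216, 0), (0, 0), (9216, 0), (0, 0), (12672, 0), (0, 0), (12096, 0), (0, 0),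
   (9792, 0), (0, 0), (0, 0), (8640, 0), (0, 0), (0, 0), (0, 0), (0, 0), (0, 0), (0, 0),
   (9792, 0), (0, 576), (0, 0), (8640, 0), (0, 0), (0, 0), (0, 0), (0, 0), (0, 0), (0, 0),
   (13248, 0), (0, 0), (0, 0), (8064, 0), (0, 0), (0, 0), (0, 0), (0, 0), (0, 0), (0, 0),
   (8640, 0), (0, 0), (0, 0), (0, 0), (0, 0), (0, 0), (0, 0), (0, 0), (0, 0), (0, 0), (0, 0),
   (0, 0), (0, 0), (0, 0), (0, 0), (0, 0), (0, 0), (0, 0), (0, 0), (0, 0)]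

set_option maxHeartbeats 4000000 in
/-- The Leibniz graphs of the factorization, with one Jacobiator each. An entry consists of the
targets of the vertices with two edges, the targets of the Jacobiator, the nonzero coefficients in
the eleven components, multiplied by 180, and the permutations (as digits to the base 24) which
bring the graphs in the expansion to their normal forms. -/
def leibnizTable : List (List ℕ × (ℕ × ℕ × ℕ) × List (ℕ × ℤ) × ℕ) :=
  [
   ([], (0, 1, 2), [(0, 120)], 24), ([0,1], (0, 1, 2), [(0, 120)], 26),
   ([0,2], (0, 1, 2), [(0, 120)], 1178), ([0,4], (0, 1, 2), [(0, 60)], 16602674),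
   ([1,2], (0, 1, 2), [(0, 120)], 1274), ([2,4], (0, 1, 2), [(0, -60)], 33249698),
   ([0,2], (0, 1, 3), [(0, 30)], 26), ([1,2], (0, 1, 3), [(0, 60)], 1274),
   ([2,4], (0, 1, 3), [(0, -30)], 16660850), ([0,1], (0, 2, 3), [(0, -30)], 24),
   ([1,2], (0, 2, 3), [(0, -30)], 1274), ([0,1], (1, 2, 3), [(0, 60)], 24),
   ([0,2], (1, 2, 3), [(0, 30)], 24), ([0,4], (1, 2, 3), [(0, 30)], 7976472),
   ([0,1,0,1], (0, 1, 2), [(0, 60)], 32), ([0,1,0,2], (0, 1, 2), [(0, 120)], 1184),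
   ([0,1,0,3], (0, 1, 2), [(0, 40)], 1178), ([0,1,0,5], (0, 1, 2), [(0, 60)], 16602824),
   ([0,1,1,2], (0, 1, 2), [(0, 120)], 1280), ([0,1,1,3], (0, 1, 2), [(0, -40)], 1274),
   ([0,1,2,3], (0, 1, 2), [(0, -80)], 2426), ([0,1,2,5], (0, 1, 2), [(0, -60)], 33249848),
   ([0,1,3,5], (0, 1, 2), [(0, 80)], 33249850), ([0,2,0,2], (0, 1, 2), [(0, 60)], 4640),
   ([0,2,0,3], (0, 1, 2), [(0, 40)], 1184), ([0,2,0,5], (0, 1, 2), [(0, 60)], 66369224),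
   ([0,2,1,2], (0, 1, 2), [(0, 120)], 4736), ([0,2,2,3], (0, 1, 2), [(0, -40)], 5890),
   ([0,2,2,5], (0, 1, 2), [(0, -60)], 83016248), ([0,2,3,5], (0, 1, 2), [(0, 50)], 83016250),
   ([0,4,0,5], (0, 1, 2), [(0, 4)], 68359886), ([0,4,1,2], (0, 1, 2), [(0, 80)], 4640),
   ([0,4,1,3], (0, 1, 2), [(0, -20)], 5024), ([0,4,1,5], (0, 1, 2), [(0, -28)], 66600200),
   ([0,4,2,3], (0, 1, 2), [(0, -20)], 5024), ([0,4,2,5], (0, 1, 2), [(0, -64)], 66600200),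
   ([0,4,3,5], (0, 1, 2), [(0, 26)], 66600200),
   ([0,5,0,5], (0, 1, 2), [(0, 24)], 16126497868012616),
   ([0,5,1,2], (0, 1, 2), [(0, 60)], 82352120),
   ([0,5,1,5], (0, 1, 2), [(0, 12)], 15878167943967560),
   ([0,5,2,5], (0, 1, 2), [(0, -24)], 15878388094595960),
   ([0,5,3,5], (0, 1, 2), [(0, 46)], 15878387991081850), ([1,2,1,2], (0, 1, 2), [(0, 60)], 5024),
   ([1,2,1,3], (0, 1, 2), [(0, 40)], 6176), ([1,2,2,3], (0, 1, 2), [(0, -40)], 6178),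
   ([1,2,2,5], (0, 1, 2), [(0, -60)], 83189048), ([1,2,3,5], (0, 1, 2), [(0, -10)], 83189050),
   ([1,4,1,5], (0, 1, 2), [(0, -8)], 182144654), ([1,4,2,3], (0, 1, 2), [(0, -20)], 9632),
   ([1,4,2,5], (0, 1, 2), [(0, -28)], 132955400), ([1,4,3,5], (0, 1, 2), [(0, 8)], 132955400),
   ([1,5,1,5], (0, 1, 2), [(0, 12)], 25785003602791496),
   ([1,5,2,5], (0, 1, 2), [(0, 12)], 25404803419849592),
   ([1,5,3,5], (0, 1, 2), [(0, 28)], 25388952574608250),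
   ([2,4,2,5], (0, 1, 2), [(0, 4)], 182808548), ([2,4,3,5], (0, 1, 2), [(0, 26)], 132955600),
   ([2,5,2,5], (0, 1, 2), [(0, 24)], 25785884205392648),
   ([2,5,3,5], (0, 1, 2), [(0, 46)], 25405463871821050), ([0,1,2,3], (0, 1, 3), [(0, 24)], 2426),
   ([0,1,2,5], (0, 1, 3), [(0, -36)], 33249656), ([0,2,0,1], (0, 1, 3), [(0, 30)], 3638),
   ([0,2,0,2], (0, 1, 3), [(0, 30)], 32), ([0,2,0,3], (0, 1, 3), [(0, 34)], 1184),
   ([0,2,0,5], (0, 1, 3), [(0, 6)], 16602824), ([0,2,1,2], (0, 1, 3), [(0, 30)], 1280),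
   ([0,2,1,3], (0, 1, 3), [(0, 2)], 1280), ([0,2,1,5], (0, 1, 3), [(0, -6)], 32586248),
   ([0,2,2,3], (0, 1, 3), [(0, -2)], 2432), ([0,2,2,5], (0, 1, 3), [(0, -36)], 33249800),
   ([0,2,3,5], (0, 1, 3), [(0, 19), (5, -8640), (6, -2880), (7, 4320)], 33249848),
   ([0,4,0,2], (0, 1, 3), [(0, -2)], 3638), ([0,4,1,2], (0, 1, 3), [(0, 26)], 4640),
   ([0,4,2,3], (0, 1, 3), [(0, -14), (6, 2880)], 5024),
   ([0,4,2,5], (0, 1, 3), [(0, -52), (4, -8640), (5, 17280), (6, 5760)], 66600200),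
   ([0,5,2,3], (0, 1, 3), [(0, 14), (5, -8640), (6, -2880)], 83015672),
   ([0,5,2,5], (0, 1, 3), [(0, -24)], 15878387991081800),
   ([1,2,0,1], (0, 1, 3), [(0, 60)], 7382), ([1,2,0,2], (0, 1, 3), [(0, 60)], 7382),
   ([1,2,0,3], (0, 1, 3), [(0, 80)], 4790), ([1,2,0,5], (0, 1, 3), [(0, 24)], 67952366),
   ([1,2,1,2], (0, 1, 3), [(0, 60)], 5024), ([1,2,1,3], (0, 1, 3), [(0, 52)], 6176),
   ([1,2,1,5], (0, 1, 3), [(0, -12)], 82525448), ([1,2,2,3], (0, 1, 3), [(0, -4)], 6176),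
   ([1,2,2,5], (0, 1, 3), [(0, -42)], 83189000), ([1,2,3,5], (0, 1, 3), [(0, -30)], 83189048),
   ([1,4,0,2], (0, 1, 3), [(0, -22)], 7382), ([1,4,1,2], (0, 1, 3), [(0, 4)], 5030),
   ([1,4,2,3], (0, 1, 3), [(0, -2)], 5024), ([1,4,2,5], (0, 1, 3), [(0, -16)], 66600200),
   ([1,5,2,3], (0, 1, 3), [(0, 2)], 83189048),
   ([1,5,2,5], (0, 1, 3), [(0, -12)], 15878445429801800),
   ([2,4,0,1], (0, 1, 3), [(0, 30)], 7380), ([2,4,0,2], (0, 1, 3), [(0, 4)], 7382),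
   ([2,4,0,3], (0, 1, 3), [(0, 20), (6, -2880)], 3878),
   ([2,4,0,5], (0, 1, 3), [(0, 52), (4, 8640), (5, -17280), (6, -5760)], 155541230),
   ([2,4,1,2], (0, 1, 3), [(0, -22)], 5030), ([2,4,1,3], (0, 1, 3), [(0, -14)], 5030),
   ([2,4,1,5], (0, 1, 3), [(0, 20)], 66600494), ([2,4,2,3], (0, 1, 3), [(0, 24)], 5024),
   ([2,4,2,5], (0, 1, 3), [(0, 2)], 66600206),
   ([2,4,3,5], (0, 1, 3), [(0, -5), (4, 2880), (5, -2880), (7, -1440)], 66600200),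
   ([2,5,0,1], (0, 1, 3), [(0, -30)], 99806750), ([2,5,0,2], (0, 1, 3), [(0, -30)], 99806750),
   ([2,5,0,3], (0, 1, 3), [(0, -44), (5, 8640), (6, 2880)], 82525598),
   ([2,5,0,5], (0, 1, 3), [(0, -12)], 29724388086094190),
   ([2,5,1,2], (0, 1, 3), [(0, -30)], 82525598), ([2,5,1,3], (0, 1, 3), [(0, -28)], 83189150),
   ([2,5,1,5], (0, 1, 3), [(0, 6)], 15878225279314286),
   ([2,5,2,3], (0, 1, 3), [(0, 2)], 83189144),
   ([2,5,3,5], (0, 1, 3), [(0, 15), (7, -1440)], 15878445429801848),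
   ([4,5,0,2], (0, 1, 3), [(0, 30), (5, -17280), (6, -5760)], 99806894),
   ([4,5,2,3], (0, 1, 3), [(5, 2880)], 82525598),
   ([4,5,2,5], (0, 1, 3), [(4, 2880)], 15872941664237294),
   ([0,1,0,1], (0, 2, 3), [(0, -30)], 24), ([0,1,0,2], (0, 2, 3), [(0, -30)], 26),
   ([0,1,0,3], (0, 2, 3), [(0, -34)], 1178), ([0,1,0,5], (0, 2, 3), [(0, -6)], 16602674),
   ([0,1,1,2], (0, 2, 3), [(0, -30)], 1274), ([0,1,1,3], (0, 2, 3), [(0, -6)], 1274),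
   ([0,1,1,5], (0, 2, 3), [(0, 42)], 16660850), ([0,1,2,3], (0, 2, 3), [(0, 54)], 1274),
   ([0,1,2,5], (0, 2, 3), [(0, 18)], 32586098),
   ([0,1,3,5], (0, 2, 3), [(0, 19), (5, 8640), (6, 2880), (7, 4320)], 33249698),
   ([0,2,1,3], (0, 2, 3), [(0, -32)], 1274), ([0,2,1,5], (0, 2, 3), [(0, 18)], 16660856),
   ([0,4,0,1], (0, 2, 3), [(0, 2)], 3636), ([0,4,1,2], (0, 2, 3), [(0, 28)], 4640),
   ([0,4,1,3], (0, 2, 3), [(0, -16), (6, 2880)], 4640),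
   ([0,4,1,5], (0, 2, 3), [(0, 22), (4, -8640)], 66369224),
   ([0,5,1,3], (0, 2, 3), [(0, -14), (5, 8640), (6, 2880)], 80361464),
   ([0,5,1,5], (0, 2, 3), [(0, 24)], 15872884225373000),
   ([1,2,0,1], (0, 2, 3), [(0, -30)], 7380), ([1,2,0,2], (0, 2, 3), [(0, -30)], 7382),
   ([1,2,0,3], (0, 2, 3), [(0, 10)], 4790), ([1,2,0,5], (0, 2, 3), [(0, -18)], 67952366),
   ([1,2,1,2], (0, 2, 3), [(0, -30)], 5024), ([1,2,1,3], (0, 2, 3), [(0, 6)], 5024),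
   ([1,2,2,3], (0, 2, 3), [(0, 34)], 6176), ([1,2,2,5], (0, 2, 3), [(0, 6)], 82525448),
   ([1,2,3,5], (0, 2, 3), [(0, -49), (5, 8640), (6, 2880), (7, -4320)], 83189048),
   ([1,4,0,1], (0, 2, 3), [(0, -18)], 7380), ([1,4,0,2], (0, 2, 3), [(0, -50)], 7380),
   ([1,4,0,3], (0, 2, 3), [(0, 6), (6, -2880)], 3638),
   ([1,4,0,5], (0, 2, 3), [(0, -18), (4, 8640)], 67952366),
   ([1,4,1,2], (0, 2, 3), [(0, -24)], 5030), ([1,4,1,3], (0, 2, 3), [(0, -12)], 5024),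
   ([1,4,1,5], (0, 2, 3), [(0, 4)], 66600206),
   ([1,4,2,3], (0, 2, 3), [(0, 6), (6, -2880)], 5024),
   ([1,4,2,5], (0, 2, 3), [(0, 12), (4, 8640), (5, -17280), (6, -5760)], 66600200),
   ([1,4,3,5], (0, 2, 3), [(0, -10), (4, 5760), (5, -5760), (7, -2880)], 66600200),
   ([1,5,0,3], (0, 2, 3), [(0, 18), (5, -8640), (6, -2880)], 82381022),
   ([1,5,0,5], (0, 2, 3), [(0, -6)], 16000197914630510),
   ([1,5,1,3], (0, 2, 3), [(0, 4)], 82525592),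
   ([1,5,2,3], (0, 2, 3), [(0, -12), (5, 8640), (6, 2880)], 83189048),
   ([1,5,2,5], (0, 2, 3), [(0, -6)], 15878225279173448),
   ([1,5,3,5], (0, 2, 3), [(0, -30), (7, -2880)], 15878445429801848),
   ([2,4,0,1], (0, 2, 3), [(0, 36)], 7380), ([2,4,1,2], (0, 2, 3), [(0, -2)], 5030),
   ([2,4,1,3], (0, 2, 3), [(0, -16), (6, 2880)], 5030),
   ([2,4,1,5], (0, 2, 3), [(0, -8), (4, -8640), (5, 17280), (6, 5760)], 66600494),
   ([2,5,1,3], (0, 2, 3), [(0, 16), (5, -8640), (6, -2880)], 82525598),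
   ([2,5,1,5], (0, 2, 3), [(0, 24)], 15872941664233838),
   ([4,5,1,2], (0, 2, 3), [(0, -30), (5, 17280), (6, 5760)], 66600494),
   ([4,5,1,3], (0, 2, 3), [(5, 5760)], 66600350),
   ([4,5,1,5], (0, 2, 3), [(4, 5760)], 12702772615968494), ([0,1,0,2], (0, 3, 4), [(0, 12)], 24),
   ([0,1,1,2], (0, 3, 4), [(0, 54)], 1274),
   ([0,1,2,3], (0, 3, 4), [(0, -73), (1, -4320), (4, -17280), (5, 21600), (6, 1440), (7, -8640), (8, 8640)], 1274),
   ([0,1,2,5], (0, 3, 4), [(0, -60), (4, -17280), (5, 17280), (7, -8640), (8, 8640)], 16660850),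
   ([0,2,1,2], (0, 3, 4), [(0, 12)], 1274),
   ([0,2,1,3], (0, 3, 4), [(0, -61), (1, -4320), (4, -17280), (5, 21600), (6, 1440), (7, -8640), (8, 8640)], 1274),
   ([0,2,1,5], (0, 3, 4), [(0, -48), (4, -17280), (5, 17280), (7, -8640), (8, 8640)], 16660850),
   ([0,4,1,2], (0, 3, 4), [(0, 24)], 32), ([0,5,1,2], (0, 3, 4), [(0, 24)], 112210808),
   ([1,2,1,3], (0, 3, 4), [(0, -36)], 8480), ([1,2,1,5], (0, 3, 4), [(0, -6)], 164142344),
   ([1,2,2,3], (0, 3, 4), [(0, 7), (1, 4320), (4, 17280), (5, -21600), (6, -1440), (7, 8640), (8, -8640)], 8480),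
   ([1,2,2,5], (0, 3, 4), [(0, 24), (4, 17280), (5, -17280), (7, 8640), (8, -8640)], 164142344),
   ([1,2,3,5], (0, 3, 4), [(0, 2), (1, -1440), (5, 4320), (6, 1440), (7, 1440)], 116366648),
   ([1,4,2,3], (0, 3, 4), [(0, -13), (1, 1440), (4, 5760), (5, -7200), (6, 1440), (7, 2880), (8, -2880)], 8480),
   ([1,4,2,5], (0, 3, 4), [(0, 7), (1, -1440), (4, 2880), (5, -1440), (6, 1440), (7, 2880), (8, -2880)], 164142344),
   ([1,5,2,3], (0, 3, 4), [(0, 20), (1, 2880), (4, 2880), (5, -5760), (7, 2880), (8, -2880)], 116366648),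
   ([1,5,2,5], (0, 3, 4), [(0, 20), (4, 5760), (5, -5760), (7, 2880), (8, -2880)], 31375728762012488),
   ([0,1,0,1], (1, 2, 3), [(0, 60)], 24), ([0,1,0,2], (1, 2, 3), [(0, 60)], 24),
   ([0,1,0,3], (1, 2, 3), [(0, 4)], 24), ([0,1,1,2], (1, 2, 3), [(0, 60)], 26),
   ([0,1,1,3], (1, 2, 3), [(0, -52)], 1178), ([0,1,1,5], (1, 2, 3), [(0, 12)], 16602674),
   ([0,1,2,3], (1, 2, 3), [(0, -52)], 1274), ([0,1,2,5], (1, 2, 3), [(0, -24)], 32586098),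
   ([0,1,3,5], (1, 2, 3), [(0, 30)], 33249698), ([0,2,0,1], (1, 2, 3), [(0, 30)], 3630),
   ([0,2,0,2], (1, 2, 3), [(0, 30)], 24), ([0,2,0,3], (1, 2, 3), [(0, 2)], 24),
   ([0,2,1,2], (1, 2, 3), [(0, 30)], 26), ([0,2,1,3], (1, 2, 3), [(0, -30)], 1178),
   ([0,2,1,5], (1, 2, 3), [(0, 6)], 16602674), ([0,2,2,3], (1, 2, 3), [(0, -34)], 1274),
   ([0,2,2,5], (1, 2, 3), [(0, -6)], 32586098),
   ([0,2,3,5], (1, 2, 3), [(0, 11), (5, -8640), (6, -2880), (7, -4320)], 33249698),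
   ([0,4,0,1], (1, 2, 3), [(0, 64)], 3630), ([0,4,0,2], (1, 2, 3), [(0, 32)], 3630),
   ([0,4,0,3], (1, 2, 3), [(0, 24)], 24), ([0,4,0,5], (1, 2, 3), [(0, 2)], 7976472),
   ([0,4,1,2], (1, 2, 3), [(0, 40)], 24), ([0,4,1,3], (1, 2, 3), [(0, -14)], 24),
   ([0,4,1,5], (1, 2, 3), [(0, 20)], 7976472), ([0,4,2,3], (1, 2, 3), [(0, 20), (6, -2880)], 24),
   ([0,4,2,5], (1, 2, 3), [(0, 22), (4, 8640)], 7976472),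
   ([0,4,3,5], (1, 2, 3), [(0, -5), (4, 2880), (5, -2880), (7, -1440)], 7976472),
   ([0,5,0,1], (1, 2, 3), [(0, 30)], 57829422), ([0,5,0,2], (1, 2, 3), [(0, 30)], 57829422),
   ([0,5,0,3], (1, 2, 3), [(0, 2)], 57829422), ([0,5,1,2], (1, 2, 3), [(0, 30)], 40547066),
   ([0,5,1,3], (1, 2, 3), [(0, -28)], 40547066),
   ([0,5,1,5], (1, 2, 3), [(0, 6)], 7930950306838898),
   ([0,5,2,3], (1, 2, 3), [(0, -14), (5, -8640), (6, -2880)], 40548218),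
   ([0,5,2,5], (1, 2, 3), [(0, -12)], 7936233922582898),
   ([0,5,3,5], (1, 2, 3), [(0, 15), (7, -1440)], 7936454073211298),
   ([1,2,0,3], (1, 2, 3), [(0, 4)], 3630), ([1,2,0,5], (1, 2, 3), [(0, -6)], 155541060),
   ([1,4,0,1], (1, 2, 3), [(0, -4)], 3636), ([1,4,0,2], (1, 2, 3), [(0, -6)], 3636),
   ([1,4,0,3], (1, 2, 3), [(0, -2)], 3630), ([1,4,0,5], (1, 2, 3), [(0, -16)], 155541204),
   ([1,5,0,3], (1, 2, 3), [(0, 2)], 57829422),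
   ([1,5,0,5], (1, 2, 3), [(0, -12)], 29724387130564308), ([2,4,0,1], (1, 2, 3), [(0, 2)], 7380),
   ([2,4,0,2], (1, 2, 3), [(0, 2)], 7380), ([2,4,0,3], (1, 2, 3), [(0, -14), (6, 2880)], 3630),
   ([2,4,0,5], (1, 2, 3), [(0, -22), (4, -8640)], 155541204),
   ([2,5,0,3], (1, 2, 3), [(0, -16), (5, 8640), (6, 2880)], 57829422),
   ([2,5,0,5], (1, 2, 3), [(0, -24)], 29724387130564308),
   ([4,5,0,3], (1, 2, 3), [(5, 2880)], 57829422),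
   ([4,5,0,5], (1, 2, 3), [(4, 2880)], 29724387130564308),
   ([0,1,0,2], (1, 3, 4), [(0, -48)], 24), ([0,1,1,2], (1, 3, 4), [(0, -24)], 24),
   ([0,1,2,3], (1, 3, 4), [(0, 12)], 1274), ([0,1,2,5], (1, 3, 4), [(0, 12)], 16660850),
   ([0,2,0,3], (1, 3, 4), [(0, 91), (1, 4320), (4, 17280), (5, -21600), (6, -1440), (7, 8640), (8, -8640)], 24),
   ([0,2,0,5], (1, 3, 4), [(0, 78), (4, 17280), (5, -17280), (7, 8640), (8, -8640)], 7976472),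
   ([0,2,1,2], (1, 3, 4), [(0, -6)], 24), ([0,2,1,3], (1, 3, 4), [(0, 12)], 24),
   ([0,2,1,5], (1, 3, 4), [(0, 12)], 16602674),
   ([0,2,2,3], (1, 3, 4), [(0, 91), (1, 4320), (4, 17280), (5, -21600), (6, -1440), (7, 8640), (8, -8640)], 1274),
   ([0,2,2,5], (1, 3, 4), [(0, 78), (4, 17280), (5, -17280), (7, 8640), (8, -8640)], 16660850),
   ([0,2,3,5], (1, 3, 4), [(0, 4), (1, -2880), (5, 8640), (6, 2880), (7, 2880)], 16660850),
   ([0,4,1,2], (1, 3, 4), [(0, -12)], 24),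
   ([0,4,2,3], (1, 3, 4), [(0, 34), (1, 2880), (4, 11520), (5, -14400), (6, 2880), (7, 5760), (8, -5760)], 24),
   ([0,4,2,5], (1, 3, 4), [(0, 27), (1, 1440), (4, 5760), (5, -7200), (6, 1440), (7, 5760), (8, -5760)], 7976472),
   ([0,5,1,2], (1, 3, 4), [(0, -12)], 40547018),
   ([0,5,2,3], (1, 3, 4), [(0, 27), (1, 1440), (4, 5760), (5, -7200), (6, 1440), (7, 5760), (8, -5760)], 40547066),
   ([0,5,2,5], (1, 3, 4), [(0, 40), (4, 11520), (5, -11520), (7, 5760), (8, -5760)], 7930950290913650),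
   ([0,1,0,2], (2, 3, 4), [(0, -24)], 24),
   ([0,1,0,3], (2, 3, 4), [(0, 7), (1, 4320), (4, 17280), (5, -21600), (6, -1440), (7, 8640), (8, -8640)], 24),
   ([0,1,0,5], (2, 3, 4), [(0, 24), (4, 17280), (5, -17280), (7, 8640), (8, -8640)], 7976472),
   ([0,1,1,2], (2, 3, 4), [(0, 12)], 24), ([0,1,1,3], (2, 3, 4), [(0, -36)], 24),
   ([0,1,1,5], (2, 3, 4), [(0, -6)], 7976472), ([0,1,2,3], (2, 3, 4), [(0, -24)], 24),
   ([0,1,2,5], (2, 3, 4), [(0, -24)], 16602674),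
   ([0,1,3,5], (2, 3, 4), [(0, 2), (1, -1440), (5, 4320), (6, 1440), (7, 1440)], 16660850),
   ([0,2,1,2], (2, 3, 4), [(0, 12)], 24),
   ([0,2,1,3], (2, 3, 4), [(0, -61), (1, -4320), (4, -17280), (5, 21600), (6, 1440), (7, -8640), (8, 8640)], 24),
   ([0,2,1,5], (2, 3, 4), [(0, -48), (4, -17280), (5, 17280), (7, -8640), (8, 8640)], 7976472),
   ([0,4,1,2], (2, 3, 4), [(0, 73), (1, 4320), (4, 17280), (5, -21600), (6, -1440), (7, 8640), (8, -8640)], 24),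
   ([0,4,1,3], (2, 3, 4), [(0, -13), (1, 1440), (4, 5760), (5, -7200), (6, 1440), (7, 2880), (8, -2880)], 24),
   ([0,4,1,5], (2, 3, 4), [(0, 20), (1, 2880), (4, 2880), (5, -5760), (7, 2880), (8, -2880)], 7976472),
   ([0,5,1,2], (2, 3, 4), [(0, 60), (4, 17280), (5, -17280), (7, 8640), (8, -8640)], 40547018),
   ([0,5,1,3], (2, 3, 4), [(0, 7), (1, -1440), (4, 2880), (5, -1440), (6, 1440), (7, 2880), (8, -2880)], 40547018),
   ([0,5,1,5], (2, 3, 4), [(0, 20), (4, 5760), (5, -5760), (7, 2880), (8, -2880)], 7930950290884850)]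

/-- Graphs with odd symmetries, and the numbers of the latter. -/
def oddGraphs : List (List ℕ × ℕ) :=
  [
   ([0,4,1,2,0,4,3,5], 14), ([0,2,1,3,1,3,4,5], 2), ([0,1,2,3,2,3,4,5], 2),
   ([0,1,0,1,2,6,3,4], 6), ([0,2,0,2,1,6,3,4], 6), ([0,4,5,6,1,2,1,2], 1)]

end Tables

/-! ### Integer coefficients and evaluation of the certificate -/

section Check

/-- The integer `720 q`, if the denominator of `q` divides `720`. -/
def scaled (q : ℚ) : ℤ := q.num * (720 / q.den : ℕ)

/-- `scaled` divides natural numbers, which is exact precisely because the denominator divides 720.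
-/
lemma cast_scaled {q : ℚ} (h : q.den ∣ 720) : (scaled q : ℝ) = 720 * q := by
  obtain ⟨k, hk⟩ := h
  have h0 : (q.den : ℝ) ≠ 0 := by exact_mod_cast q.den_nz
  have h1 : (720 : ℝ) = q.den * k := by exact_mod_cast hk
  have h2 : 720 / q.den = k := by
    rw [hk, Nat.mul_div_cancel_left _ q.den_pos]
  rw [scaled, h2, h1]
  push_cast
  rw [Rat.cast_def]
  field_simp

/-- The families of graphs in the part of the associator which stems from the constant part of the
star-product, with their coefficients multiplied by 720. -/
def constFamilies : List GraphFamily :=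
  (constPairs.zip constPerms).flatMap fun e =>
    [⟨(e.1.1.1.length + e.1.2.1.length) / 2, scaled (e.1.1.2 * e.1.2.2),
        insertLists 0 e.1.1.1 e.1.2.1, e.2.1⟩,
      ⟨(e.1.1.1.length + e.1.2.1.length) / 2, -scaled (e.1.1.2 * e.1.2.2),
        insertLists 1 e.1.1.1 e.1.2.1, e.2.2⟩]

/-- The families of graphs in the part of the `i`-th component of the associator which stems from
the prime graphs of the star-product, with their coefficients multiplied by 720. -/
def primeFamilies (i : Fin 11) : List GraphFamily :=
  (starPrime.zip primePerms).flatMap fun e =>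
    [⟨4, scaled (e.1.2.1 * weightCoeff e.1.2.2 i),
        insertLists 0 e.1.1 [] ++ insertLists 0 [] e.1.1, e.2.1⟩,
      ⟨4, -scaled (e.1.2.1 * weightCoeff e.1.2.2 i),
        insertLists 1 e.1.1 [] ++ insertLists 1 [] e.1.1, e.2.2⟩]

/-- The entries of a triple. -/
def tripleFun (J : ℕ × ℕ × ℕ) : Fin 3 → ℕ := ![J.1, J.2.1, J.2.2]

/-- The coefficient, multiplied by 180, of an entry of the table in the `i`-th component. -/
def tableCoeff (C : List (ℕ × ℤ)) (i : ℕ) : ℤ :=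
  match C with
  | [] => 0
  | c :: C => bif Nat.beq c.1 i then c.2 else tableCoeff C i

/-- The families of graphs in the expansion of the Leibniz graphs in the `i`-th component, with
their coefficients multiplied by `-720`. -/
def leibnizFamilies (i : ℕ) : List GraphFamily :=
  leibnizTable.map fun e =>
    ⟨e.1.length / 2 + 2, -4 * tableCoeff e.2.2.1 i,
      expandLists (e.1.length / 2) e.1 (tripleFun e.2.1), e.2.2.2⟩

/-- The verification for the constant component. The Leibniz graphs carry the factor `-4 =
-720/180`, so that everything cancels if the factorization is right. -/
lemma addFamilies_zero : addFamilies (constFamilies ++ primeFamilies 0 ++ leibnizFamilies 0) .leaf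
    (KeyTree.vanishes oddGraphs) = true := by decide +kernel

/-- The same for the ten other components, to which the constant part of the star-product does not
contribute. -/
lemma addFamilies_succ : ∀ i : Fin 10,
    addFamilies (primeFamilies i.succ ++ leibnizFamilies (i.val + 1)) .leaf
      (KeyTree.vanishes oddGraphs) = true := by decide +kernel

lemma length_constPerms : constPairs.length = constPerms.length := by decide +kernel

lemma length_primePerms : starPrime.length = primePerms.length := by decide +kernel

lemma den_constPairs : ∀ e ∈ constPairs, (e.1.2 * e.2.2).den ∣ 720 := by decide +kernel

lemma den_starPrime : ∀ e ∈ starPrime, ∀ i, (e.2.1 * weightCoeff e.2.2 i).den ∣ 720 := by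
  decide +kernel

/-- A list of targets of the internal vertices of a graph on two sinks. -/
def IsTargetList (l : List ℕ) : Prop := l.length % 2 = 0 ∧ ∀ t ∈ l, t < 2 + l.length / 2

instance : DecidablePred IsTargetList := fun l => by unfold IsTargetList; infer_instance

lemma isTargetList_starConst : ∀ e ∈ starConst, IsTargetList e.1 := by decide +kernel

lemma isTargetList_starPrime : ∀ e ∈ starPrime, IsTargetList e.1 := by decide +kernel

/-- The conditions on the entries of the table that make it a Leibniz graph in which at most two
edges fall on the Jacobiator. -/
def IsLeibnizDatum (w : List ℕ) (J : ℕ × ℕ × ℕ) : Prop :=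
  w.length % 2 = 0 ∧ w.length / 2 ≤ 2 ∧ J.1 < J.2.1 ∧ J.2.1 < J.2.2 ∧ J.2.2 < 3 + w.length / 2 ∧
    ∀ v < w.length / 2, w.getD (2 * v) 0 < 3 + w.length / 2

instance (w : List ℕ) (J : ℕ × ℕ × ℕ) : Decidable (IsLeibnizDatum w J) := by
  unfold IsLeibnizDatum; infer_instance

lemma isLeibnizDatum_table : ∀ e ∈ leibnizTable, IsLeibnizDatum e.1 e.2.1 := by decide +kernel

end Check

/-! ### The factorization of the components via the Jacobiator -/

section Factorization

/-- The sum of the classes of the graphs in the action of the graph `lΓ` on the graph `lΔ` in its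
sink `s`. -/
def insertClass (s : ℕ) (lΓ lΔ : List ℕ) : GraphSum 3 ⧸ skewRel 3 :=
  ((insertLists s lΓ lΔ).map fun l =>
    graphClass (graphOf 3 ((lΓ.length + lΔ.length) / 2) l)).sum

lemma mkQ_insert (s : Fin 2) {lΓ lΔ : List ℕ} (hΓ : IsTargetList lΓ) (hΔ : IsTargetList lΔ) :
    (skewRel 3).mkQ (KGraph.insert s (KGraph.ofTargets lΓ) (KGraph.ofTargets lΔ)) =
      insertClass s lΓ lΔ := by
  have e : lΔ.length / 2 + lΓ.length / 2 = (lΓ.length + lΔ.length) / 2 := by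
    have := hΓ.1
    have := hΔ.1
    omega
  rw [ofTargets_eq_graphOf, ofTargets_eq_graphOf, KGraph.insert_graphOf s
    (by have := hΓ.1; omega) (by have := hΔ.1; omega) hΓ.2 hΔ.2, LinearMap.map_list_sum', e]
  rfl

/-- The class of the difference of the two actions of a pair of graphs. -/
def pairClass (lΓ lΔ : List ℕ) : GraphSum 3 ⧸ skewRel 3 :=
  insertClass 0 lΓ lΔ - insertClass 1 lΓ lΔ

/-- A list of targets has two entries per internal vertex, so the truncation at four vertices is a
bound of 8 on the total length. -/
lemma mkQ_assocBil_single {lΓ lΔ : List ℕ} (hΓ : IsTargetList lΓ) (hΔ : IsTargetList lΔ)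
    (a b : ℝ) :
    (skewRel 3).mkQ (assocBil (Finsupp.single (KGraph.ofTargets lΓ) a)
      (Finsupp.single (KGraph.ofTargets lΔ) b)) =
      (a * b) • if lΓ.length + lΔ.length ≤ 8 then pairClass lΓ lΔ else 0 := by
  have e : (KGraph.ofTargets lΓ).n + (KGraph.ofTargets lΔ).n ≤ 4 ↔
      lΓ.length + lΔ.length ≤ 8 := by
    have := hΓ.1
    have := hΔ.1
    simp only [KGraph.ofTargets]
    omega
  rw [assocBil_single, map_smul]
  congr 1
  by_cases h : lΓ.length + lΔ.length ≤ 8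
  · rw [if_pos (e.2 h), if_pos h, map_sub, mkQ_insert 0 hΓ hΔ, mkQ_insert 1 hΓ hΔ]
    rfl
  · rw [if_neg (mt e.1 h), if_neg h, map_zero]

lemma list_sum_filter_map {α M : Type*} [AddCommMonoid M] (l : List α) (q : α → Bool)
    (g : α → M) : ((l.filter q).map g).sum = (l.map fun a => if q a then g a else 0).sum := by
  induction l with
  | nil => rfl
  | cons a l ih => by_cases h : q a <;> simp [h, ih]

lemma list_sum_zip_map {α β M : Type*} [AddCommMonoid M] {l : List α} {l' : List β}
    (h : l.length = l'.length) (g : α → M) :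
    ((l.zip l').map fun e => g e.1).sum = (l.map g).sum := by
  conv_rhs => rw [← List.map_fst_zip h.le, List.map_map]
  rfl

lemma list_smul_sum {α M : Type*} [AddCommMonoid M] [Module ℝ M] (l : List α) (c : ℝ)
    (g : α → M) : c • (l.map g).sum = (l.map fun a => c • g a).sum := by
  rw [List.smul_sum, List.map_map]; rfl

lemma mem_constPairs {e : (List ℕ × ℚ) × (List ℕ × ℚ)} (h : e ∈ constPairs) :
    e.1 ∈ starConst ∧ e.2 ∈ starConst ∧ e.1.1.length + e.2.1.length ≤ 8 := by
  simp only [constPairs, List.mem_flatMap, List.mem_map, List.mem_filter] at h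
  obtain ⟨a, ha, b, ⟨hb, hab⟩, rfl⟩ := h
  exact ⟨ha, hb, Nat.le_of_ble_eq_true hab⟩

lemma constFamilies_total : (constFamilies.map GraphFamily.total).sum =
    (720 : ℝ) • (skewRel 3).mkQ (assocBil starConstSum starConstSum) := by
  have h1 : (constFamilies.map GraphFamily.total).sum =
      (constPairs.map fun e => (720 : ℝ) • ((e.1.2 : ℝ) * e.2.2) • pairClass e.1.1 e.2.1).sum := by
    rw [constFamilies, list_sum_flatMap, ← list_sum_zip_map length_constPerms]
    refine congrArg List.sum (List.map_congr_left fun e he => ?_)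
    have := cast_scaled (den_constPairs e.1 (List.of_mem_zip he).1)
    simp only [List.map_cons, List.map_nil, List.sum_cons, List.sum_nil, add_zero,
      GraphFamily.total, Int.cast_neg, this, pairClass, insertClass, smul_sub, smul_smul]
    rw [neg_smul, ← sub_eq_add_neg]
    push_cast
    rfl
  have h2 : (skewRel 3).mkQ (assocBil starConstSum starConstSum) =
      (constPairs.map fun e => ((e.1.2 : ℝ) * e.2.2) • pairClass e.1.1 e.2.1).sum := by
    rw [constPairs, list_sum_flatMap, starConstSum, LinearMap.map_list_sum' assocBil,
      LinearMap.list_sum_apply', LinearMap.map_list_sum']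
    refine congrArg List.sum (List.map_congr_left fun e he => ?_)
    rw [LinearMap.map_list_sum', LinearMap.map_list_sum', List.map_map,
      list_sum_filter_map]
    refine congrArg List.sum (List.map_congr_left fun e' he' => ?_)
    rw [mkQ_assocBil_single (isTargetList_starConst e he) (isTargetList_starConst e' he')]
    by_cases h : e.1.length + e'.1.length ≤ 8
    · simp [h]
    · simp [h]
  rw [h1, h2, list_smul_sum]

/-- Each prime graph occurs twice in every slot, as the outer and as the inner graph, the partner
being the empty graph. -/
lemma primeFamilies_total (i : Fin 11) : ((primeFamilies i).map GraphFamily.total).sum =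
    (720 : ℝ) • (skewRel 3).mkQ (assocLin (starPrimeSum i)) := by
  have hnil : IsTargetList [] := ⟨rfl, by simp⟩
  rw [primeFamilies, list_sum_flatMap, assocLin, map_add, emptySum, starPrimeSum,
    LinearMap.map_list_sum', LinearMap.map_list_sum', LinearMap.map_list_sum',
    LinearMap.list_sum_apply', LinearMap.map_list_sum', ← List.sum_map_add, list_smul_sum,
    ← list_sum_zip_map length_primePerms]
  refine congrArg List.sum (List.map_congr_left fun e he => ?_)
  have he' := (List.of_mem_zip he).1
  have h8 := length_starPrime e.1 he'
  rw [mkQ_assocBil_single hnil (isTargetList_starPrime _ he'),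
    mkQ_assocBil_single (isTargetList_starPrime _ he') hnil, one_mul, mul_one]
  have := cast_scaled (den_starPrime e.1 he' i)
  simp only [List.map_cons, List.map_nil, List.sum_cons, List.sum_nil, add_zero,
      GraphFamily.total, Int.cast_neg, this, pairClass, insertClass, h8, List.length_nil,
      List.map_append, List.sum_append, le_refl, if_true, ← smul_add, smul_smul, zero_add]
  rw [neg_smul, ← sub_eq_add_neg, ← smul_sub]
  congr 1
  abel

lemma strictMono_tripleFun {w : List ℕ} {J : ℕ × ℕ × ℕ} (h : IsLeibnizDatum w J) :
    StrictMono (tripleFun J) :=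
  Fin.strictMono_iff_lt_succ.2 fun i => by
    obtain ⟨-, -, h1, h2, -⟩ := h
    fin_cases i
    · exact h1
    · exact h2

lemma tripleFun_lt {w : List ℕ} {J : ℕ × ℕ × ℕ} (h : IsLeibnizDatum w J) :
    tripleFun J 2 < 3 + w.length / 2 := h.2.2.2.2.1

/-- The Leibniz graph of an entry of the table. -/
def leibnizGraph (w : List ℕ) (J : ℕ × ℕ × ℕ) : LeibnizGraph 3 :=
  if h : IsLeibnizDatum w J then
    leibnizOf (w.length / 2) w (tripleFun J) (strictMono_tripleFun h) (tripleFun_lt h)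
  else leibnizOf 0 [] Fin.val Fin.val_strictMono (by decide)

lemma leibnizGraph_l (w : List ℕ) (J : ℕ × ℕ × ℕ) : (leibnizGraph w J).l = 1 := by
  rw [leibnizGraph]
  split_ifs <;> rfl

lemma leibnizVertex_of_lt {b t : ℕ} (h : t < 3 + b) (j : Fin 1) :
    leibnizVertex b t ≠ .inr (.inr j) := by
  unfold leibnizVertex
  split_ifs with h1 h2
  · simp
  · simp
  · omega

/-- By `hw` a Left edge never falls on the Jacobiator, nor do the edges of the Jacobiator itself.
This leaves at most one edge for each of the `b` other vertices. -/
lemma jacIndegree_leibnizOf {b : ℕ} {w : List ℕ} {J : Fin 3 → ℕ} (hJ : StrictMono J)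
    (hb : J 2 < 3 + b) (hw : ∀ v < b, w.getD (2 * v) 0 < 3 + b) (j : Fin 1) :
    (leibnizOf b w J hJ hb).jacIndegree j ≤ b := by
  have h2 : (Finset.univ.filter fun e : Fin 1 × Fin 3 =>
      leibnizVertex b (J e.2) = .inr (.inr j)) = ∅ := by
    refine Finset.filter_eq_empty_iff.2 fun e _ => ?_
    exact leibnizVertex_of_lt ((hJ.monotone (Fin.le_last e.2)).trans_lt hb) j
  have h1 : (Finset.univ.filter fun e : Fin b × Fin 2 =>
      leibnizVertex b (w.getD (2 * e.1.val + e.2.val) 0) = .inr (.inr j)) ⊆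
        Finset.univ.image fun v : Fin b => (v, (1 : Fin 2)) := by
    rintro ⟨v, i⟩ h
    have h := (Finset.mem_filter.1 h).2
    refine Finset.mem_image.2 ⟨v, Finset.mem_univ _, ?_⟩
    fin_cases i
    · exact absurd h (leibnizVertex_of_lt (hw v v.2) j)
    · rfl
  have h3 := Finset.card_le_card h1
  have h4 : (Finset.univ.image fun v : Fin b => (v, (1 : Fin 2))).card ≤ b :=
    Finset.card_image_le.trans (by simp)
  change (Finset.univ.filter fun e : Fin b × Fin 2 =>
      leibnizVertex b (w.getD (2 * e.1.val + e.2.val) 0) = .inr (.inr j)).card +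
    (Finset.univ.filter fun e : Fin 1 × Fin 3 => leibnizVertex b (J e.2) = .inr (.inr j)).card ≤ b
  rw [h2, Finset.card_empty, add_zero]
  exact h3.trans h4

lemma jacIndegree_leibnizGraph (w : List ℕ) (J : ℕ × ℕ × ℕ) :
    ∀ j, (leibnizGraph w J).jacIndegree j ≤ 2 := by
  by_cases h : IsLeibnizDatum w J
  · rw [leibnizGraph, dif_pos h]
    exact fun j => (jacIndegree_leibnizOf _ _ h.2.2.2.2.2 j).trans h.2.1
  · rw [leibnizGraph, dif_neg h]
    exact fun j => (jacIndegree_leibnizOf _ _ (by simp) j).trans (by norm_num)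

/-- The factorization of the `i`-th component of the associator via the Jacobiator. -/
def assocFactor (i : ℕ) : LeibnizSum 3 :=
  (leibnizTable.map fun e => Finsupp.single (leibnizGraph e.1 e.2.1)
    ((tableCoeff e.2.2.1 i : ℝ) / 180)).sum

lemma mem_support_list_sum {α β : Type*} (l : List α) (g : α → β) (c : α → ℝ) {x : β}
    (hx : x ∈ ((l.map fun e => Finsupp.single (g e) (c e)).sum).support) : ∃ e ∈ l, g e = x := by
  classical
  induction l with
  | nil => simp at hx
  | cons a l ih =>
    rw [List.map_cons, List.sum_cons] at hx
    rcases Finset.mem_union.1 (Finsupp.support_add hx) with h | h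
    · exact ⟨a, by simp, (Finset.mem_singleton.1 (Finsupp.support_single_subset h)).symm⟩
    · obtain ⟨e, he, rfl⟩ := ih h
      exact ⟨e, by simp [he], rfl⟩

/-- The expansion of sums of Leibniz graphs, as a linear map. -/
def expandL (m : ℕ) : LeibnizSum m →ₗ[ℝ] GraphSum m :=
  Finsupp.linearCombination ℝ LeibnizGraph.expand

lemma LeibnizSum.expand_eq_expandL {m : ℕ} (D : LeibnizSum m) : D.expand = expandL m D := rfl

lemma leibnizFamilies_total (i : ℕ) : ((leibnizFamilies i).map GraphFamily.total).sum =
    -(720 : ℝ) • (skewRel 3).mkQ (assocFactor i).expand := by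
  rw [LeibnizSum.expand_eq_expandL, assocFactor, LinearMap.map_list_sum',
    LinearMap.map_list_sum', list_smul_sum, leibnizFamilies, List.map_map]
  refine congrArg List.sum (List.map_congr_left fun e he => ?_)
  have hd := isLeibnizDatum_table e he
  have hn : e.1.length / 2 + 1 * 2 = e.1.length / 2 + 2 := rfl
  rw [expandL, Finsupp.linearCombination_single, map_smul, smul_smul, leibnizGraph, dif_pos hd,
    LeibnizGraph.expand_leibnizOf (by have := hd.1; omega), LinearMap.map_list_sum']
  simp only [Function.comp, GraphFamily.total]
  congr 1
  push_cast
  ring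

/-- In the quotient, 720 times the difference is the sum of the families that the checker has found
to be zero. -/
theorem sub_assocFactor_mem (i : Fin 11) :
    assocComponent i - (assocFactor i).expand ∈ skewRel 3 := by
  rw [← Submodule.ker_mkQ (skewRel 3), LinearMap.mem_ker, map_sub]
  have h720 : (720 : ℝ) ≠ 0 := by norm_num
  have hn (j : ℕ) : ∀ e ∈ leibnizFamilies j, e.IsValid := by
    intro e he
    obtain ⟨d, hd, rfl⟩ := List.mem_map.1 he
    have hd' := isLeibnizDatum_table d hd
    refine ⟨by have := hd'.2.1; simp only; omega, fun l hl t ht => ?_⟩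
    exact lt_of_mem_expandLists (fun i => ((strictMono_tripleFun hd').monotone
      (Fin.le_last i)).trans_lt (tripleFun_lt hd')) hl ht
  have hp (j : Fin 11) : ∀ e ∈ primeFamilies j, e.IsValid := by
    have H : ∀ s < 2, ∀ w : List ℕ, w.length = 8 → IsTargetList w →
        ∀ l ∈ insertLists s w [] ++ insertLists s [] w, ∀ t ∈ l, t < 3 + 4 := by
      intro s hs w h8 hw l hl t ht
      rcases List.mem_append.1 hl with hl | hl
      · have := lt_of_mem_insertLists hs hw.2 (by simp) hl ht
        simpa [h8] using this
      · have := lt_of_mem_insertLists hs (a := 0) (by simp) hw.2 hl ht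
        simpa [h8] using this
    intro e he
    simp only [primeFamilies, List.mem_flatMap, List.mem_cons, List.not_mem_nil, or_false] at he
    obtain ⟨d, hd, he⟩ := he
    have hd' := (List.of_mem_zip hd).1
    have h8 := length_starPrime _ hd'
    have ht := isTargetList_starPrime _ hd'
    rcases he with rfl | rfl
    · exact ⟨le_rfl, H 0 two_pos _ h8 ht⟩
    · exact ⟨le_rfl, H 1 one_lt_two _ h8 ht⟩
  have hc : ∀ e ∈ constFamilies, e.IsValid := by
    have H : ∀ s < 2, ∀ w w' : List ℕ, IsTargetList w → IsTargetList w' →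
        ∀ l ∈ insertLists s w w', ∀ t ∈ l, t < 3 + (w.length + w'.length) / 2 := by
      intro s hs w w' hw hw' l hl t ht
      have h1 := lt_of_mem_insertLists hs hw.2 hw'.2 hl ht
      have h2 := hw.1
      have h3 := hw'.1
      omega
    intro e he
    simp only [constFamilies, List.mem_flatMap, List.mem_cons, List.not_mem_nil, or_false] at he
    obtain ⟨d, hd, he⟩ := he
    obtain ⟨h1, h2, h3⟩ := mem_constPairs (List.of_mem_zip hd).1
    have h1' := isTargetList_starConst _ h1
    have h2' := isTargetList_starConst _ h2
    rcases he with rfl | rfl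
    · exact ⟨by simp only; omega, H 0 two_pos _ _ h1' h2'⟩
    · exact ⟨by simp only; omega, H 1 one_lt_two _ _ h1' h2'⟩
  refine (smul_eq_zero.1 (?_ : (720 : ℝ) • _ = _)).resolve_left h720
  refine Fin.cases ?_ (fun i => ?_) i
  · have := sum_total_eq_zero (fun e he => ?_) addFamilies_zero
    · rw [List.map_append, List.map_append, List.sum_append, List.sum_append, constFamilies_total,
        primeFamilies_total, leibnizFamilies_total, ← smul_add, ← map_add,
        ← assocComponent_zero, neg_smul, ← sub_eq_add_neg, ← smul_sub] at this
      exact this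
    · simp only [List.mem_append] at he
      rcases he with (he | he) | he
      exacts [hc e he, hp _ e he, hn _ e he]
  · have := sum_total_eq_zero (fun e he => ?_) (addFamilies_succ i)
    · rw [List.map_append, List.sum_append,
        primeFamilies_total, leibnizFamilies_total,
        ← assocComponent_succ, neg_smul, ← sub_eq_add_neg, ← smul_sub] at this
      exact this
    · simp only [List.mem_append] at he
      rcases he with he | he
      exacts [hp _ e he, hn _ e he]

theorem exists_assocFactor (i : Fin 11) : ∃ D : LeibnizSum 3,
    (∀ Λ ∈ D.support, Λ.l = 1 ∧ ∀ j, Λ.jacIndegree j ≤ 2) ∧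
    assocComponent i - D.expand ∈ skewRel 3 ∧
    ∀ (d : ℕ) (N : Type*) [TopologicalSpace N] [ChartedSpace (Fin d → ℝ) N]
      [AffineManifold d N] (P : Bivector d N) (f : Fin 3 → N → ℝ),
      (∀ s, SmoothFun d (f s)) → ∀ k,
      GraphSum.op (assocComponent i) k P f = LeibnizSum.op D k P f := by
  refine ⟨assocFactor i, fun Λ hΛ => ?_, sub_assocFactor_mem i, ?_⟩
  · obtain ⟨e, -, rfl⟩ := mem_support_list_sum _ _ _ hΛ
    exact ⟨leibnizGraph_l _ _, jacIndegree_leibnizGraph _ _⟩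
  · intro d N _ _ _ P f hf k
    rw [GraphSum.op_eq_of_sub_mem_skewRel (sub_assocFactor_mem i) k P hf,
      LeibnizSum.op_eq_op_expand _ k P hf]

end Factorization

/-! ### Associativity for Poisson structures -/

section Associativity

/-- A factorization of the associator via the Jacobiator. -/
def assocLeibniz (p : Fin 10 → ℝ) : LeibnizSum 3 :=
  assocFactor 0 + ∑ i : Fin 10, p i • assocFactor (i.val + 1)

/-- Both sides are the same affine combination of components, and `skewRel` is a subspace. -/
lemma assoc4_sub_assocLeibniz_mem (p : Fin 10 → ℝ) :
    assoc4 p - (assocLeibniz p).expand ∈ skewRel 3 := by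
  have h : assoc4 p - (assocLeibniz p).expand = (assocComponent 0 - (assocFactor 0).expand) +
      ∑ i : Fin 10, p i • (assocComponent i.succ - (assocFactor (i.val + 1)).expand) := by
    simp only [LeibnizSum.expand_eq_expandL, assocLeibniz, assoc4_eq_sum, map_add, map_sum,
      map_smul, smul_sub, Finset.sum_sub_distrib]
    abel
  rw [h]
  exact add_mem (sub_assocFactor_mem 0)
    (sum_mem fun i _ => Submodule.smul_mem _ _ (sub_assocFactor_mem i.succ))

variable {d : ℕ} {N : Type*} [TopologicalSpace N] [ChartedSpace (Fin d → ℝ) N]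

lemma op_assoc4_eq_op_assocLeibniz (p : Fin 10 → ℝ) (k : ℕ) (P : Bivector d N)
    {f : Fin 3 → N → ℝ} (hf : ∀ s, SmoothFun d (f s)) :
    GraphSum.op (assoc4 p) k P f = LeibnizSum.op (assocLeibniz p) k P f := by
  rw [GraphSum.op_eq_of_sub_mem_skewRel (assoc4_sub_assocLeibniz_mem p) k P hf,
    LeibnizSum.op_eq_op_expand _ k P hf]

theorem starMul_assoc [AffineManifold d N] (p : Fin 10 → ℝ) {P : Bivector d N}
    (hP : P.IsPoisson) {F G H : PowerSeries (N → ℝ)}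
    (hF : ∀ k, SmoothFun d (PowerSeries.coeff k F)) (hG : ∀ k, SmoothFun d (PowerSeries.coeff k G))
    (hH : ∀ k, SmoothFun d (PowerSeries.coeff k H)) {k : ℕ} (hk : k ≤ 4) :
    PowerSeries.coeff k (starMul p P (starMul p P F G) H) =
      PowerSeries.coeff k (starMul p P F (starMul p P G H)) := by
  rw [← sub_eq_zero, coeff_associator p P hF hG hH hk]
  refine Finset.sum_eq_zero fun a _ => Finset.sum_eq_zero fun b _ =>
    Finset.sum_eq_zero fun t _ => ?_
  rw [op_assoc4_eq_op_assocLeibniz p a.1 P, LeibnizSum.op_eq_zero _ _ hP]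
  intro s
  fin_cases s
  exacts [hF _, hG _, hH _]

end Associativity

/-! ### Derivatives of monomials at the origin -/

section Monomials

variable {d : ℕ}

/-- A monomial in the coordinates. -/
def coordMonomial (c : ℝ) (e : Fin d → ℕ) (x : Fin d → ℝ) : ℝ := c * ∏ i, x i ^ e i

lemma contDiff_coordMonomial (c : ℝ) (e : Fin d → ℕ) : ContDiff ℝ ∞ (coordMonomial c e) := by
  unfold coordMonomial
  fun_prop

/-- When `e i = 0` the truncated exponent is harmless, as the coefficient vanishes. -/
lemma pderiv'_coordMonomial (i : Fin d) (c : ℝ) (e : Fin d → ℕ) :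
    pderiv' i (coordMonomial c e) = coordMonomial (c * e i) (Function.update e i (e i - 1)) := by
  funext x
  have h := (HasFDerivAt.finsetProd (u := Finset.univ) (x := x)
    (g := fun (j : Fin d) (y : Fin d → ℝ) => y j ^ e j) fun j _ =>
      (hasFDerivAt_apply (𝕜 := ℝ) (F' := fun _ : Fin d => ℝ) j x).pow (e j)).const_mul c
  have h' : coordMonomial c e = fun y : Fin d → ℝ => c * ∏ j, y j ^ e j := rfl
  rw [pderiv', h', h.fderiv, coordMonomial, ← Finset.mul_prod_erase _ _ (Finset.mem_univ i)]
  simp only [smul_apply, sum_apply, smul_eq_mul,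
    ContinuousLinearMap.proj_apply]
  rw [Finset.sum_eq_single i]
  · have : ∏ j ∈ Finset.univ.erase i, x j ^ Function.update e i (e i - 1) j =
        ∏ j ∈ Finset.univ.erase i, x j ^ e j :=
      Finset.prod_congr rfl fun j hj => by
        rw [Function.update_of_ne (Finset.ne_of_mem_erase hj)]
    rw [this, Function.update_self, Pi.single_eq_same]
    ring
  · intro j _ hj
    simp [Pi.single_eq_of_ne hj]
  · simp

lemma pderivs_coordMonomial (L : List (Fin d)) (c : ℝ) (e : Fin d → ℕ) :
    pderivs L (coordMonomial c e) =
      coordMonomial (c * ∏ i, ((e i).descFactorial (L.count i) : ℝ)) fun i => e i - L.count i := by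
  induction L with
  | nil => simp [pderivs]
  | cons a L ih =>
    have : pderivs (a :: L) (coordMonomial c e) = pderiv' a (pderivs L (coordMonomial c e)) := rfl
    rw [this, ih, pderiv'_coordMonomial]
    congr 1
    · rw [mul_assoc, ← Finset.mul_prod_erase _ _ (Finset.mem_univ a),
        ← Finset.mul_prod_erase _ _ (Finset.mem_univ a), List.count_cons_self,
        Nat.descFactorial_succ]
      have : ∏ j ∈ Finset.univ.erase a, ((e j).descFactorial ((a :: L).count j) : ℝ) =
          ∏ j ∈ Finset.univ.erase a, ((e j).descFactorial (L.count j) : ℝ) :=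
        Finset.prod_congr rfl fun j hj => by
          rw [List.count_cons_of_ne (Finset.ne_of_mem_erase hj).symm]
      rw [this]
      push_cast
      ring
    · funext i
      by_cases h : i = a
      · subst h
        rw [Function.update_self, List.count_cons_self]
        omega
      · rw [Function.update_of_ne h, List.count_cons_of_ne (Ne.symm h)]

lemma pderivs_coordMonomial_zero (L : List (Fin d)) (c : ℝ) (e : Fin d → ℕ) :
    pderivs L (coordMonomial c e) 0 =
      if ∀ i, L.count i = e i then c * ∏ i, ((e i).factorial : ℝ) else 0 := by
  rw [pderivs_coordMonomial, coordMonomial, mul_assoc, ← Finset.prod_mul_distrib]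
  split_ifs with h
  · congr 1
    refine Finset.prod_congr rfl fun i _ => ?_
    rw [h i, Nat.descFactorial_self]
    simp
  · push Not at h
    obtain ⟨i, hi⟩ := h
    rw [Finset.prod_eq_zero (Finset.mem_univ i), mul_zero]
    rcases lt_or_gt_of_ne hi with h | h
    · simp [Nat.sub_ne_zero_of_lt h]
    · simp [Nat.descFactorial_of_lt h]

/-- At the origin the order of differentiation must equal the degree. Applied to a vertex with
monomial content, this constrains the number of edges that fall on it, whatever their labels. -/
lemma pderivs_coordMonomial_eq_zero {L : List (Fin d)} {c : ℝ} {e : Fin d → ℕ}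
    (h : L.length ≠ ∑ i, e i) : pderivs L (coordMonomial c e) 0 = 0 := by
  rw [pderivs_coordMonomial_zero, if_neg]
  intro h'
  apply h
  simp only [← h']
  simpa using (Multiset.sum_count_eq_card (s := Finset.univ) (m := (L : Multiset (Fin d)))
    (fun _ _ => Finset.mem_univ _)).symm

end Monomials

/-! ### No factorization of order at most one in the Jacobiator -/

section Obstruction

lemma length_edgeLabels {n r d : ℕ} {V : Type} [DecidableEq V] (tgt : Fin n → Fin r → V)
    (I : Fin n → Fin r → Fin d) (y : V) : (edgeLabels tgt I y).length =
      (Finset.univ.filter fun e : Fin n × Fin r => tgt e.1 e.2 = y).card := by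
  rw [← Multiset.coe_card, coe_edgeLabels, edgeM, Multiset.card_sum, Finset.card_filter]
  refine Finset.sum_congr rfl fun e _ => ?_
  split_ifs <;> simp

/-- The coefficients of a bi-vector with monomial components on three-dimensional space. -/
def testCoeff : Fin 3 → Fin 3 → ℝ := ![![0, 1, -1], ![-1, 0, 0], ![1, 0, 0]]

/-- The exponents of a bi-vector with monomial components on three-dimensional space. -/
def testExp : Fin 3 → Fin 3 → Fin 3 → ℕ :=
  ![![0, 0, ![3, 0, 0]], ![0, 0, 0], ![![3, 0, 0], 0, 0]]

/-- The bi-vector `∂₀ ∧ ∂₁ - x₀³ ∂₀ ∧ ∂₂` on three-dimensional space. -/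
def testBivector : Bivector 3 (Fin 3 → ℝ) where
  comp _ i j := coordMonomial (testCoeff i j) (testExp i j)
  smooth _ _ i j := (contDiff_coordMonomial _ _).contDiffOn
  skew _ _ i j x _ := by
    fin_cases i <;> fin_cases j <;> simp [testCoeff, testExp, coordMonomial]
  transform φ hφ ψ hψ x hx i j := by
    rw [chartedSpaceSelf_atlas] at hφ hψ
    subst hφ hψ
    have h (a i : Fin 3) : pderiv' a (fun y : Fin 3 → ℝ => y i) x = if i = a then 1 else 0 := by
      have := (hasFDerivAt_apply (𝕜 := ℝ) (F' := fun _ : Fin 3 => ℝ) i x).fderiv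
      rw [pderiv', this, ContinuousLinearMap.proj_apply, Pi.single_apply]
    simp [h]

/-- The completely antisymmetric symbol. -/
def leviCivita (i j k : Fin 3) : ℝ :=
  if (i, j, k) ∈ [((0 : Fin 3), (1 : Fin 3), (2 : Fin 3)), (1, 2, 0), (2, 0, 1)] then 1
  else if (i, j, k) ∈ [((0 : Fin 3), (2 : Fin 3), (1 : Fin 3)), (2, 1, 0), (1, 0, 2)] then -1 else 0

/-- The only nonconstant entries are `∓x₀³`, and their `x₀`-derivative meets the constant entries
`±1`. The point of the exponent 3 is that the Jacobiator becomes homogeneous of degree two. -/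
lemma jacobiator_testBivector (i j k : Fin 3) :
    jacobiator (fun i j => coordMonomial (testCoeff i j) (testExp i j)) i j k =
      coordMonomial (3 * leviCivita i j k) ![2, 0, 0] := by
  funext x
  simp only [jacobiator, pderiv'_coordMonomial]
  fin_cases i <;> fin_cases j <;> fin_cases k <;>
    simp [Fin.sum_univ_three, testCoeff, testExp, leviCivita, coordMonomial, Fin.prod_univ_three]

/-- The arguments `x₀ x₁²`, `x₁`, `x₂` of the tri-differential operators. -/
def testFun (s : Fin 3) : (Fin 3 → ℝ) → ℝ := coordMonomial 1 (![![1, 2, 0], ![0, 1, 0], ![0, 0, 1]] s)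

lemma smoothFun_testFun (s : Fin 3) : SmoothFun 3 (testFun s) := by
  intro φ hφ
  rw [chartedSpaceSelf_atlas] at hφ
  subst hφ
  exact (contDiff_coordMonomial _ _).contDiffOn

/-- The value of the operator of a Leibniz graph at the test data. -/
def testValue (Λ : LeibnizGraph 3) : ℝ := Λ.op testBivector testFun 0

lemma testValue_eq (Λ : LeibnizGraph 3) : testValue Λ =
    Λ.localOp (fun i j => coordMonomial (testCoeff i j) (testExp i j))
      (fun i j k => coordMonomial (3 * leviCivita i j k) ![2, 0, 0]) testFun 0 := by
  have : jacobiator (fun i j => coordMonomial (testCoeff i j) (testExp i j)) =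
      fun i j k => coordMonomial (3 * leviCivita i j k) ![2, 0, 0] := by
    funext i j k; exact jacobiator_testBivector i j k
  rw [testValue, LeibnizGraph.op, ← this]
  rfl

/-- The Jacobiator is a quadratic monomial or zero in each component, so any number of derivatives
other than two gives zero at the origin. -/
lemma testValue_eq_zero_of_jac (Λ : LeibnizGraph 3) (j : Fin Λ.l) (h : Λ.jacIndegree j ≠ 2) :
    testValue Λ = 0 := by
  rw [testValue_eq, LeibnizGraph.localOp]
  refine Finset.sum_eq_zero fun I _ => Finset.sum_eq_zero fun K _ => ?_
  rw [Finset.prod_eq_zero (f := fun j => pderivs _ _ _) (Finset.mem_univ j), mul_zero, zero_mul]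
  refine pderivs_coordMonomial_eq_zero ?_
  rw [List.length_append, length_edgeLabels, length_edgeLabels, Fin.sum_univ_three]
  exact h

/-- The numbers 3, 1, 1 are the degrees of the arguments `x₀ x₁²`, `x₁`, `x₂`. -/
lemma testValue_eq_zero_of_sink (Λ : LeibnizGraph 3) (s : Fin 3)
    (h : (Finset.univ.filter fun e : Fin Λ.b × Fin 2 => Λ.wedge e.1 e.2 = .inl s).card +
      (Finset.univ.filter fun e : Fin Λ.l × Fin 3 => Λ.jac e.1 e.2 = .inl s).card ≠
        ![3, 1, 1] s) : testValue Λ = 0 := by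
  rw [testValue_eq, LeibnizGraph.localOp]
  refine Finset.sum_eq_zero fun I _ => Finset.sum_eq_zero fun K _ => ?_
  rw [Finset.prod_eq_zero (f := fun s => pderivs _ _ _) (Finset.mem_univ s), mul_zero]
  refine pderivs_coordMonomial_eq_zero ?_
  rw [List.length_append, length_edgeLabels, length_edgeLabels]
  revert h
  fin_cases s <;> simp [Fin.sum_univ_three]

lemma isLeibnizDatum_test : IsLeibnizDatum [0,5,0,5] (0, 1, 2) := by decide

lemma pderivs_testFun_zero (a c : Fin 3) :
    pderivs [a, c, 0] (testFun 0) 0 = if a = 1 ∧ c = 1 then 2 else 0 := by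
  have h : ∀ a c : Fin 3, (∀ i, [a, c, 0].count i = (![1, 2, 0] : Fin 3 → ℕ) i) ↔
      a = 1 ∧ c = 1 := by decide
  refine (pderivs_coordMonomial_zero _ _ ![1, 2, 0]).trans ?_
  simp only [h]
  split_ifs
  · simp [Fin.prod_univ_three]
  · rfl

lemma pderivs_testFun_one (a : Fin 3) : pderivs [a] (testFun 1) 0 = if a = 1 then 1 else 0 := by
  have h : ∀ a : Fin 3, (∀ i, [a].count i = (![0, 1, 0] : Fin 3 → ℕ) i) ↔ a = 1 := by decide
  refine (pderivs_coordMonomial_zero _ _ ![0, 1, 0]).trans ?_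
  simp only [h]
  split_ifs
  · simp [Fin.prod_univ_three]
  · rfl

lemma pderivs_testFun_two (a : Fin 3) : pderivs [a] (testFun 2) 0 = if a = 2 then 1 else 0 := by
  have h : ∀ a : Fin 3, (∀ i, [a].count i = (![0, 0, 1] : Fin 3 → ℕ) i) ↔ a = 2 := by decide
  refine (pderivs_coordMonomial_zero _ _ ![0, 0, 1]).trans ?_
  simp only [h]
  split_ifs
  · simp [Fin.prod_univ_three]
  · rfl

lemma pderivs_leviCivita (a c k : Fin 3) :
    pderivs [a, c] (coordMonomial (3 * leviCivita k 1 2) ![2, 0, 0]) 0 =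
      if a = 0 ∧ c = 0 ∧ k = 0 then 6 else 0 := by
  have h : ∀ a c : Fin 3, (∀ i, [a, c].count i = (![2, 0, 0] : Fin 3 → ℕ) i) ↔
      a = 0 ∧ c = 0 := by decide
  rw [pderivs_coordMonomial_zero]
  simp only [h, ← and_assoc]
  by_cases hac : a = 0 ∧ c = 0
  · simp only [hac, true_and, if_true]
    fin_cases k <;> simp [leviCivita, Fin.prod_univ_three] <;> norm_num
  · simp [hac]

/-- In this graph each of the two bi-vectors has one edge to the first sink and one to the
Jacobiator, whose own edges go to the three sinks. -/
lemma testValue_test : testValue (leibnizGraph [0,5,0,5] (0, 1, 2)) = 12 := by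
  rw [leibnizGraph, dif_pos isLeibnizDatum_test, testValue_eq, LeibnizGraph.localOp]
  -- A single labelling survives. The arguments `x₁`, `x₂` fix two labels of the Jacobiator; its
  -- component is then nonzero only for the third label 0, and differentiable twice only along `x₀`;
  -- two derivatives along `x₁` are left for the first argument. The value is `(-1)² · 6 · 2`, with
  -- 6 from `∂₀²(3 x₀²)` and 2 from `∂₀ ∂₁²(x₀ x₁²)`.
  have hterm (I : Fin 2 → Fin 2 → Fin 3) (K : Fin 1 → Fin 3 → Fin 3) :
      coordMonomial (testCoeff (I 0 0) (I 0 1)) (testExp (I 0 0) (I 0 1)) 0 *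
        coordMonomial (testCoeff (I 1 0) (I 1 1)) (testExp (I 1 0) (I 1 1)) 0 *
        pderivs [I 0 1, I 1 1]
          (coordMonomial (3 * leviCivita (K 0 0) (K 0 1) (K 0 2)) ![2, 0, 0]) 0 *
        (pderivs [I 0 0, I 1 0, K 0 0] (testFun 0) 0 * pderivs [K 0 1] (testFun 1) 0 *
          pderivs [K 0 2] (testFun 2) 0) =
      if I = ![![1, 0], ![1, 0]] ∧ K = ![![0, 1, 2]] then 12 else 0 := by
    have hIK : (I = ![![1, 0], ![1, 0]] ∧ K = ![![0, 1, 2]]) ↔ K 0 1 = 1 ∧ K 0 2 = 2 ∧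
        (I 0 1 = 0 ∧ I 1 1 = 0 ∧ K 0 0 = 0) ∧ I 0 0 = 1 ∧ I 1 0 = 1 := by
      simp only [funext_iff, Fin.forall_fin_succ]
      simp
      tauto
    rw [pderivs_testFun_one, pderivs_testFun_two]
    by_cases h1 : K 0 1 = 1
    · by_cases h2 : K 0 2 = 2
      · rw [h1, h2, pderivs_leviCivita]
        by_cases h3 : I 0 1 = 0 ∧ I 1 1 = 0 ∧ K 0 0 = 0
        · rw [h3.2.2, pderivs_testFun_zero]
          by_cases h4 : I 0 0 = 1 ∧ I 1 0 = 1
          · rw [if_pos (hIK.2 ⟨h1, h2, h3, h4⟩), h3.1, h3.2.1, h4.1, h4.2]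
            simp [testCoeff, testExp, coordMonomial]
            norm_num
          · rw [if_neg fun h => h4 (hIK.1 h).2.2.2, if_neg h4]
            simp
        · rw [if_neg fun h => h3 (hIK.1 h).2.2.1, if_neg h3]
          simp
      · rw [if_neg fun h => h2 (hIK.1 h).2.1, if_neg h2]
        simp
    · rw [if_neg fun h => h1 (hIK.1 h).1, if_neg h1]
      simp
  have hsum : ∑ I : Fin 2 → Fin 2 → Fin 3, ∑ K : Fin 1 → Fin 3 → Fin 3,
      (if I = ![![1, 0], ![1, 0]] ∧ K = ![![0, 1, 2]] then (12 : ℝ) else 0) = 12 := by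
    rw [Finset.sum_eq_single ![![1, 0], ![1, 0]], Finset.sum_eq_single ![![0, 1, 2]]]
    · simp
    · intro K _ hK; simp [hK]
    · simp
    · intro I _ hI; simp [hI]
    · simp
  refine Eq.trans ?_ hsum
  refine Finset.sum_congr rfl fun I _ => Finset.sum_congr rfl fun K _ => ?_
  rw [← hterm I K]
  refine congr_arg₂ _ (congr_arg₂ _ ?_ ?_) ?_
  · exact Fin.prod_univ_two _
  · exact Fin.prod_univ_one _
  · exact Fin.prod_univ_three _

/-- The entries of the table other than `[0,5,0,5]` with Jacobiator `(0, 1, 2)` do not have three,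
one, one edges on the sinks and two edges on the Jacobiator. -/
lemma indegrees_table : ∀ e ∈ leibnizTable, (e.1 = [0,5,0,5] ∧ e.2.1 = (0, 1, 2)) ∨
    e.1.length / 2 ≠ 2 ∨
    (∃ s : Fin 3, (Finset.univ.filter fun q : Fin (e.1.length / 2) × Fin 2 =>
        leibnizVertex (e.1.length / 2) (e.1.getD (2 * q.1.val + q.2.val) 0) = .inl s).card +
      (Finset.univ.filter fun q : Fin 1 × Fin 3 =>
        leibnizVertex (e.1.length / 2) (tripleFun e.2.1 q.2) = .inl s).card ≠ ![3, 1, 1] s) ∨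
    (Finset.univ.filter fun q : Fin (e.1.length / 2) × Fin 2 =>
        leibnizVertex (e.1.length / 2) (e.1.getD (2 * q.1.val + q.2.val) 0) =
          .inr (.inr 0)).card +
      (Finset.univ.filter fun q : Fin 1 × Fin 3 =>
        leibnizVertex (e.1.length / 2) (tripleFun e.2.1 q.2) = .inr (.inr 0)).card ≠ 2 := by
  decide +kernel

/-- The distinguished graph is absent from the ten components multiplied by parameters, so no choice
of these can remove it. -/
lemma tableCoeff_test : ∀ i : Fin 11, (leibnizTable.map fun e =>
    if e.1 = [0,5,0,5] ∧ e.2.1 = (0, 1, 2) then tableCoeff e.2.2.1 i else 0).sum =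
      if i = 0 then 24 else 0 := by
  decide +kernel

/-- The coefficient of `ℏ⁴` in the operator of a sum of Leibniz graphs at the test data. -/
def testValueL : LeibnizSum 3 →ₗ[ℝ] ℝ :=
  Finsupp.linearCombination ℝ fun Λ => if Λ.b + Λ.l * 2 = 4 then testValue Λ else 0

lemma op_testBivector (D : LeibnizSum 3) :
    LeibnizSum.op D 4 testBivector testFun 0 = testValueL D := by
  rw [LeibnizSum.op_apply, testValueL, Finsupp.linearCombination_apply]
  rfl

lemma testValueL_eq_zero (D : LeibnizSum 3)
    (hD : ∀ Λ ∈ D.support, ∀ j, Λ.jacIndegree j ≤ 1) : testValueL D = 0 := by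
  rw [testValueL, Finsupp.linearCombination_apply]
  refine Finset.sum_eq_zero fun Λ hΛ => ?_
  have h := hD Λ hΛ ⟨0, Λ.l_pos⟩
  simp only [testValue_eq_zero_of_jac Λ ⟨0, Λ.l_pos⟩ (by omega), ite_self, smul_zero]

lemma testValueL_single {e : List ℕ × (ℕ × ℕ × ℕ) × List (ℕ × ℤ) × ℕ} (he : e ∈ leibnizTable)
    (a : ℝ) : testValueL (Finsupp.single (leibnizGraph e.1 e.2.1) a) =
      if e.1 = [0,5,0,5] ∧ e.2.1 = (0, 1, 2) then 12 * a else 0 := by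
  rw [testValueL, Finsupp.linearCombination_single]
  by_cases h : e.1 = [0,5,0,5] ∧ e.2.1 = (0, 1, 2)
  · rw [if_pos h, h.1, h.2, testValue_test, leibnizGraph_l, if_pos]
    · exact mul_comm _ _
    · rw [leibnizGraph, dif_pos isLeibnizDatum_test]
      rfl
  · rw [if_neg h, leibnizGraph, dif_pos (isLeibnizDatum_table e he)]
    -- All other entries fail for one of three reasons: the wrong order in `ℏ`, a wrong degree at a
    -- sink, or a wrong degree at the Jacobiator.
    rcases (indegrees_table e he).resolve_left h with h | ⟨s, h⟩ | h
    · rw [if_neg, smul_zero]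
      intro h'
      apply h
      change e.1.length / 2 + 1 * 2 = 4 at h'
      omega
    · rw [testValue_eq_zero_of_sink _ s h, ite_self, smul_zero]
    · have hd := isLeibnizDatum_table e he
      rw [testValue_eq_zero_of_jac (leibnizOf _ _ _ (strictMono_tripleFun hd) (tripleFun_lt hd))
        (0 : Fin 1) h, ite_self, smul_zero]

lemma cast_list_sum_div {α : Type*} (l : List α) (g : α → ℤ) (c : ℝ) :
    ((l.map g).sum : ℝ) / c = (l.map fun e => (g e : ℝ) / c).sum := by
  induction l with
  | nil => simp
  | cons a l ih => simp [add_div, ← ih]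

lemma testValueL_assocFactor (i : Fin 11) :
    testValueL (assocFactor i) = if i = 0 then 8 / 5 else 0 := by
  -- The divisor is `15 = 180/12`: the table is scaled by 180, and the graph has the value 12.
  have h := congrArg (fun z : ℤ => (z : ℝ) / 15) (tableCoeff_test i)
  rw [assocFactor, LinearMap.map_list_sum']
  refine Eq.trans ?_ (h.trans ?_)
  · rw [cast_list_sum_div]
    refine congrArg List.sum (List.map_congr_left fun e he => ?_)
    rw [testValueL_single he]
    split_ifs
    · ring
    · simp
  · split_ifs
    · norm_num
    · simp

lemma testValueL_assocLeibniz (p : Fin 10 → ℝ) : testValueL (assocLeibniz p) = 8 / 5 := by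
  have h (i : Fin 10) : testValueL (assocFactor (i.val + 1)) = 0 :=
    (testValueL_assocFactor i.succ).trans (if_neg (Fin.succ_ne_zero i))
  have h0 : testValueL (assocFactor 0) = 8 / 5 := (testValueL_assocFactor 0).trans (if_pos rfl)
  simp [assocLeibniz, h, h0]

/-- Evaluation at the test data gives `8/5` for the associator, through its known factorization, but
zero for an operator of order at most one. -/
theorem not_exists_leibniz_op_eq (p : Fin 10 → ℝ) : ¬ ∃ D : LeibnizSum 3,
    (∀ Λ ∈ D.support, ∀ j, Λ.jacIndegree j ≤ 1) ∧
    ∀ (d : ℕ) (P : Bivector d (Fin d → ℝ)) (f : Fin 3 → (Fin d → ℝ) → ℝ),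
      (∀ s, SmoothFun d (f s)) → ∀ k,
      GraphSum.op (assoc4 p) k P f = LeibnizSum.op D k P f := by
  rintro ⟨D, hD, h⟩
  have h1 := congrFun (h 3 testBivector testFun smoothFun_testFun 4) 0
  rw [op_assoc4_eq_op_assocLeibniz p 4 testBivector smoothFun_testFun, op_testBivector,
    op_testBivector, testValueL_assocLeibniz, testValueL_eq_zero D hD] at h1
  norm_num at h1

/-- An identity of graphs would imply one of operators, which has been excluded. -/
theorem not_exists_leibniz_expand_eq (p : Fin 10 → ℝ) : ¬ ∃ D : LeibnizSum 3,
    (∀ Λ ∈ D.support, ∀ j, Λ.jacIndegree j ≤ 1) ∧ assoc4 p - D.expand ∈ skewRel 3 := by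
  rintro ⟨D, hD, h⟩
  refine not_exists_leibniz_op_eq p ⟨D, hD, fun d P f hf k => ?_⟩
  rw [GraphSum.op_eq_of_sub_mem_skewRel h k P hf, LeibnizSum.op_eq_op_expand _ k P hf]

end Obstruction

end

/-! ### The theorem -/

theorem mainTheorem2 :
    -- the graph sum `assoc4` is the associator of the star-product modulo `o(ℏ⁴)`
    (∀ (p : Fin 10 → ℝ) (d : ℕ) (N : Type*) [TopologicalSpace N] [ChartedSpace (Fin d → ℝ) N]
        [AffineManifold d N] (P : Bivector d N) (f g h : N → ℝ),
        SmoothFun d f → SmoothFun d g → SmoothFun d h → ∀ k ≤ 4,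
        PowerSeries.coeff k
          (starMul p P (starMul p P (PowerSeries.C f) (PowerSeries.C g)) (PowerSeries.C h) -
            starMul p P (PowerSeries.C f) (starMul p P (PowerSeries.C g) (PowerSeries.C h))) =
          GraphSum.op (assoc4 p) k P ![f, g, h]) ∧
    -- its splitting into components
    (∀ p : Fin 10 → ℝ,
        assoc4 p = assocComponent 0 + ∑ i : Fin 10, p i • assocComponent i.succ) ∧
    -- the factorization of every component via the Jacobiator
    (∀ i : Fin 11, ∃ D : LeibnizSum 3,
        (∀ Λ ∈ D.support, Λ.l = 1 ∧ ∀ j, Λ.jacIndegree j ≤ 2) ∧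
        assocComponent i - D.expand ∈ skewRel 3 ∧
        ∀ (d : ℕ) (N : Type*) [TopologicalSpace N] [ChartedSpace (Fin d → ℝ) N]
          [AffineManifold d N] (P : Bivector d N) (f : Fin 3 → N → ℝ),
          (∀ s, SmoothFun d (f s)) → ∀ k,
          GraphSum.op (assocComponent i) k P f = LeibnizSum.op D k P f) ∧
    -- associativity modulo `o(ℏ⁴)` for all Poisson structures and all values of the parameters
    (∀ (p : Fin 10 → ℝ) (d : ℕ) (N : Type*) [TopologicalSpace N] [ChartedSpace (Fin d → ℝ) N]
        [AffineManifold d N] (P : Bivector d N), P.IsPoisson →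
        ∀ F G H : PowerSeries (N → ℝ), (∀ k, SmoothFun d (PowerSeries.coeff k F)) →
        (∀ k, SmoothFun d (PowerSeries.coeff k G)) → (∀ k, SmoothFun d (PowerSeries.coeff k H)) →
        ∀ k ≤ 4, PowerSeries.coeff k (starMul p P (starMul p P F G) H) =
          PowerSeries.coeff k (starMul p P F (starMul p P G H))) ∧
    -- no factorizing operator of order at most one in the Jacobiator, as an identity of graphs
    (∀ p : Fin 10 → ℝ, ¬ ∃ D : LeibnizSum 3,
        (∀ Λ ∈ D.support, ∀ j, Λ.jacIndegree j ≤ 1) ∧ assoc4 p - D.expand ∈ skewRel 3) ∧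
    -- nor as an identity of tri-differential operators for all bi-vectors
    (∀ p : Fin 10 → ℝ, ¬ ∃ D : LeibnizSum 3,
        (∀ Λ ∈ D.support, ∀ j, Λ.jacIndegree j ≤ 1) ∧
        ∀ (d : ℕ) (P : Bivector d (Fin d → ℝ)) (f : Fin 3 → (Fin d → ℝ) → ℝ),
          (∀ s, SmoothFun d (f s)) → ∀ k,
          GraphSum.op (assoc4 p) k P f = LeibnizSum.op D k P f) := by
  refine ⟨?_, assoc4_eq_sum, exists_assocFactor, ?_, not_exists_leibniz_expand_eq,
    not_exists_leibniz_op_eq⟩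
  · intro p d N _ _ _ P f g h hf hg hh k hk
    exact coeff_associator_C p P hf hg hh hk
  · intro p d N _ _ _ P hP F G H hF hG hH k hk
    exact starMul_assoc p hP hF hG hH hk
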